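/- Identify $\mathbb R^2$ with $\mathbb C$ and fix $\ell>0$. A (Prytz) planimeter of length $\ell$ has configuration space $E=\mathbb R^2\times S^1$: in the configuration $(q,e^{i\theta})$ the tracer point is at $q$ and the chisel edge at $p=q+\ell e^{i\theta}$. A motion of the planimeter is a piecewise $C^1$ curve in $E$ along which the velocity of the chisel edge has no component along the normal $N=-ie^{i\theta}$ of the rod, i.e. $N\cdot p'=0$, equivalently $\ell\,d\theta=\sin\theta\,dx-\cos\theta\,dy$. Let $SU(1,1)=\{\begin{pmatrix}a&b\\ \bar b&\bar a\end{pmatrix}:|a|^2-|b|^2=1\}$, acting on $S^1$ by $z\mapsto\frac{az+b}{\bar bz+\bar a}$, and let $\mathcal M_0(S^1)$ be the group of Möbius transformations that preserve $S^1$ and its orientation, regarded as transformations of $S^1$. It is doubly covered by $SU(1,1)$, and its Lie algebra is thereby identified with $\mathfrak{su}(1,1)$. Theorem 3. Let $G$ be $\mathcal M_0(S^1)$ or $SU(1,1)$, and let $P=\mathbb R^2\times G\to\mathbb R^2$ be the trivial principal $G$-bundle. 1. The bundle $E\to\mathbb R^2$ is isomorphic, as a smooth fiber bundle over $\mathbb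 R^2$, to the associated bundle $P\times_G S^1$ (the quotient of $P\times S^1$ by $(p,u)\cdot g=(pg,g^{-1}u)$), by the map $[(q,A),u]\mapsto(q,A\cdot u)$. 2. There is a connection on $E\to\mathbb R^2$ that is complete (every piecewise $C^1$ curve in $\mathbb R^2$ has a unique horizontal lift from every point over its start) and whose horizontal piecewise $C^1$ curves are exactly the motions of the planimeter, so that these are given by its parallel transport. Under the isomorphism in 1, it is induced by a principal connection on $P\to\mathbb R^2$. With respect to the standard frame $q\mapsto(q,I)$, the connection form of this principal connection is $$\omega=\frac1{2\ell}\begin{pmatrix}0&dz\\ d\bar z&0\end{pmatrix}$$ and its curvature form $\Omega=d\omega+\omega\wedge\omega$ is $$\Omega=-\frac1{\ell^2}\begin{pmatrix}i/2&0\\0&-i/2\end{pmatrix}dx\wedge dy.$$ 3. The holonomy group of the principal connection, at every point of $P$, is $G$. 4. The holonomy group of the connection on $E\to\mathbb R^2$, at every point $q$ of $\mathbb R^2$, as a group of transformations of the fiber $\{q\}\times S^1=S^1$, is $\mathcal M_0(S^1)$. (Holonomy groups are formed with piecewise $C^1$ loops.) -/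

import Mathlib

open scoped Manifold ContDiff ComplexConjugate

namespace Planimeter

/-! ### Transport of a manifold structure along a homeomorphism -/

section Transport

variable {V H M G : Type*} [NormedAddCommGroup V] [NormedSpace ℝ V] [TopologicalSpace H]
  [TopologicalSpace M] [TopologicalSpace G] [ChartedSpace H M]

/-- The charts of `G` are the charts of `M`, composed with the homeomorphism `e : G ≃ₜ M`. -/
abbrev transportCharts (e : G ≃ₜ M) : ChartedSpace H G where
  atlas := {c' | ∃ c ∈ atlas H M, c' = e.toOpenPartialHomeomorph.trans c}
  chartAt x := e.toOpenPartialHomeomorph.trans (chartAt H (e x))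
  mem_chart_source x := by simp
  chart_mem_atlas x := ⟨_, chart_mem_atlas H (e x), rfl⟩

theorem transport_isManifold (I : ModelWithCorners ℝ V H) (n : ℕ∞ω) [IsManifold I n M]
    (e : G ≃ₜ M) : @IsManifold ℝ _ V _ _ H _ I n G _ (transportCharts e) := by
  let _ : ChartedSpace H G := transportCharts e
  refine { compatible := ?_ }
  rintro c₁ c₂ ⟨d₁, h₁, rfl⟩ ⟨d₂, h₂, rfl⟩
  refine (contDiffGroupoid n I).mem_of_eqOnSource
    ((contDiffGroupoid n I).compatible h₁ h₂) ?_
  constructor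
  · ext x
    simp
  · intro x hx
    simp

theorem transport_contMDiff (I : ModelWithCorners ℝ V H) (n : ℕ∞ω) [IsManifold I n M]
    (e : G ≃ₜ M) : @ContMDiff ℝ _ V _ _ H _ I G _ (transportCharts e) V _ _ H _ I M _ _ n e := by
  let _ : ChartedSpace H G := transportCharts e
  have : IsManifold I n G := transport_isManifold I n e
  intro x
  rw [contMDiffAt_iff]
  refine ⟨e.continuous.continuousAt, ?_⟩
  have : ContDiffWithinAt ℝ n (id : V → V) (Set.range I) (extChartAt I x x) :=
    contDiffWithinAt_id
  refine this.congr_of_eventuallyEq_of_mem ?_ (by simp [extChartAt])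
  filter_upwards [extChartAt_target_mem_nhdsWithin (I := I) x] with y hy
  exact (extChartAt I x).right_inv hy

theorem transport_contMDiff_symm (I : ModelWithCorners ℝ V H) (n : ℕ∞ω) [IsManifold I n M]
    (e : G ≃ₜ M) :
    @ContMDiff ℝ _ V _ _ H _ I M _ _ V _ _ H _ I G _ (transportCharts e) n e.symm := by
  let _ : ChartedSpace H G := transportCharts e
  have : IsManifold I n G := transport_isManifold I n e
  intro x
  rw [contMDiffAt_iff]
  refine ⟨e.symm.continuous.continuousAt, ?_⟩
  have : ContDiffWithinAt ℝ n (id : V → V) (Set.range I) (extChartAt I x x) :=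
    contDiffWithinAt_id
  refine this.congr_of_eventuallyEq_of_mem ?_ (by simp [extChartAt])
  filter_upwards [extChartAt_target_mem_nhdsWithin (I := I) x] with y hy
  have h := (extChartAt I x).right_inv hy
  change I ((chartAt H (e (e.symm x))) (e (e.symm ((chartAt H x).symm (I.symm y))))) = y
  rw [e.apply_symm_apply, e.apply_symm_apply]
  exact h

end Transport

/-! ### The group `SU(1,1)` -/

/-- `SU(1,1)`: the matrices `[[a, b], [conj b, conj a]]` with `|a|² - |b|² = 1`. -/
def specialUnitary11 : Subgroup (Matrix.SpecialLinearGroup (Fin 2) ℂ) where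
  carrier := {A | ∃ a b : ℂ, ‖a‖ ^ 2 - ‖b‖ ^ 2 = 1 ∧
    (A : Matrix (Fin 2) (Fin 2) ℂ) = !![a, b; conj b, conj a]}
  one_mem' := ⟨1, 0, by simp, by simp [Matrix.one_fin_two]⟩
  mul_mem' := by
    rintro A B ⟨a, b, -, hA⟩ ⟨c, d, -, hB⟩
    have hAB : (A * B).1 = !![a * c + b * conj d, a * d + b * conj c;
        conj (a * d + b * conj c), conj (a * c + b * conj d)] := by
      rw [Matrix.SpecialLinearGroup.coe_mul, hA, hB]
      simp [add_comm, mul_comm]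
    refine ⟨_, _, ?_, hAB⟩
    have := (A * B).2
    rw [hAB, Matrix.det_fin_two_of, Complex.mul_conj, Complex.mul_conj, Complex.normSq_eq_norm_sq,
      Complex.normSq_eq_norm_sq] at this
    exact_mod_cast this
  inv_mem' := by
    rintro A ⟨a, b, h, hA⟩
    refine ⟨conj a, -b, by simpa using h, ?_⟩
    rw [Matrix.SpecialLinearGroup.coe_inv, hA, Matrix.adjugate_fin_two_of]
    simp

/-- `SU(1,1)` as a type. -/
abbrev SU11 : Type := specialUnitary11

namespace SU11

/-- The entry `a` of `[[a, b], [conj b, conj a]]`. -/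
def a (A : SU11) : ℂ := A.1.1 0 0

/-- The entry `b` of `[[a, b], [conj b, conj a]]`. -/
def b (A : SU11) : ℂ := A.1.1 0 1

theorem coe_eq (A : SU11) : (A.1 : Matrix (Fin 2) (Fin 2) ℂ) =
    !![A.a, A.b; conj A.b, conj A.a] := by
  obtain ⟨a, b, -, h⟩ := A.2
  simp [SU11.a, SU11.b, h]

theorem norm_sq (A : SU11) : ‖A.a‖ ^ 2 = 1 + ‖A.b‖ ^ 2 := by
  obtain ⟨a, b, h, hA⟩ := A.2
  simp only [SU11.a, SU11.b, hA]
  simp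
  linarith

/-- The element with given entries `a` and `b`. -/
def mk (a b : ℂ) (h : ‖a‖ ^ 2 - ‖b‖ ^ 2 = 1) : SU11 :=
  ⟨⟨!![a, b; conj b, conj a], by
    rw [Matrix.det_fin_two_of, Complex.mul_conj, Complex.mul_conj, Complex.normSq_eq_norm_sq,
      Complex.normSq_eq_norm_sq]
    exact_mod_cast h⟩, a, b, h, rfl⟩

@[simp] theorem mk_a (a b : ℂ) (h) : (mk a b h).a = a := rfl
@[simp] theorem mk_b (a b : ℂ) (h) : (mk a b h).b = b := rfl

theorem ext {A B : SU11} (ha : A.a = B.a) (hb : A.b = B.b) : A = B := by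
  apply Subtype.ext; apply Subtype.ext
  rw [coe_eq, coe_eq, ha, hb]

theorem mul_a (A B : SU11) : (A * B).a = A.a * B.a + A.b * conj B.b := by
  have : (A * B).1.1 = A.1.1 * B.1.1 := rfl
  simp only [SU11.a, this, Matrix.mul_apply, Fin.sum_univ_two]
  rw [coe_eq A, coe_eq B]; simp

theorem mul_b (A B : SU11) : (A * B).b = A.a * B.b + A.b * conj B.a := by
  have : (A * B).1.1 = A.1.1 * B.1.1 := rfl
  simp only [SU11.b, this, Matrix.mul_apply, Fin.sum_univ_two]
  rw [coe_eq A, coe_eq B]; simp [SU11.a]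

@[simp] theorem one_a : (1 : SU11).a = 1 := rfl
@[simp] theorem one_b : (1 : SU11).b = 0 := rfl

theorem inv_a (A : SU11) : (A⁻¹).a = conj A.a := by
  have : (A⁻¹).1.1 = (A.1.1).adjugate := rfl
  rw [SU11.a, this, coe_eq A, Matrix.adjugate_fin_two_of]; rfl

theorem inv_b (A : SU11) : (A⁻¹).b = - A.b := by
  have : (A⁻¹).1.1 = (A.1.1).adjugate := rfl
  rw [SU11.b, this, coe_eq A, Matrix.adjugate_fin_two_of]; rfl

theorem a_ne_zero (A : SU11) : A.a ≠ 0 := by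
  intro h
  have := A.norm_sq
  rw [h] at this
  simp at this
  nlinarith [sq_nonneg ‖A.b‖]

theorem norm_a (A : SU11) : ‖A.a‖ = √(1 + ‖A.b‖ ^ 2) := by
  rw [← norm_sq, Real.sqrt_sq (norm_nonneg _)]

theorem continuous_coe : Continuous fun A : SU11 => (A.1.1 : Matrix (Fin 2) (Fin 2) ℂ) :=
  Continuous.comp (g := fun A : Matrix.SpecialLinearGroup (Fin 2) ℂ => A.1)
    continuous_subtype_val continuous_subtype_val

theorem continuous_a : Continuous SU11.a := continuous_coe.matrix_elem 0 0

theorem continuous_b : Continuous SU11.b := continuous_coe.matrix_elem 0 1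

/-- The point `z / |z|` of the circle. -/
noncomputable def phase (z : ℂ) (hz : z ≠ 0) : Circle :=
  ⟨z / ‖z‖, by simp [Submonoid.unitSphere, hz]⟩

theorem coe_phase (z : ℂ) (hz : z ≠ 0) : (phase z hz : ℂ) = z / ‖z‖ := rfl

/-- Global coordinates `A ↦ (a / |a|, b)`. -/
noncomputable def coords : SU11 ≃ₜ Circle × ℂ where
  toFun A := (phase A.a A.a_ne_zero, A.b)
  invFun x := mk (x.1 * (√(1 + ‖x.2‖ ^ 2) : ℝ)) x.2 (by
    rw [norm_mul, Circle.norm_coe, one_mul, Complex.norm_real, Real.norm_eq_abs, sq_abs,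
      Real.sq_sqrt (by positivity)]; ring)
  left_inv A := by
    have h : ((‖A.a‖ : ℝ) : ℂ) ≠ 0 := by simpa using A.a_ne_zero
    apply SU11.ext
    · simp only [mk_a, ← norm_a, coe_phase]
      field_simp
    · rfl
  right_inv x := by
    have h : 0 < √(1 + ‖x.2‖ ^ 2) := by positivity
    refine Prod.ext (Circle.ext ?_) rfl
    have h' : ((√(1 + ‖x.2‖ ^ 2) : ℝ) : ℂ) ≠ 0 := by exact_mod_cast h.ne'
    change (mk _ _ _).a / ((‖(mk _ _ _).a‖ : ℝ) : ℂ) = (x.1 : ℂ)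
    rw [mk_a, norm_mul, Circle.norm_coe, one_mul, Complex.norm_real, Real.norm_eq_abs,
      abs_of_pos h, mul_div_assoc, div_self h', mul_one]
  continuous_toFun := by
    refine Continuous.prodMk (Continuous.subtype_mk ?_ _) continuous_b
    refine continuous_a.div (by have := continuous_a; fun_prop) fun A => ?_
    simpa using A.a_ne_zero
  continuous_invFun := by
    refine Continuous.subtype_mk (Continuous.subtype_mk ?_ _) _
    refine continuous_matrix fun i j => ?_
    fin_cases i <;> fin_cases j <;> simp <;> fun_prop

end SU11

/-- The model of the three-dimensional manifolds below. -/
abbrev GroupModel : Type := ModelProd (EuclideanSpace ℝ (Fin 1)) ℂ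

/-- The model with corners of the three-dimensional manifolds below. -/
noncomputable abbrev 𝓘G : ModelWithCorners ℝ (EuclideanSpace ℝ (Fin 1) × ℂ) GroupModel := (𝓡 1).prod 𝓘(ℝ, ℂ)

noncomputable instance : ChartedSpace GroupModel SU11 := transportCharts SU11.coords

instance : IsManifold 𝓘G ∞ SU11 := transport_isManifold 𝓘G ∞ SU11.coords

/-- A map into the circle is smooth when it is smooth as a map into the plane. -/
theorem contMDiff_circle {V H M : Type*} [NormedAddCommGroup V] [NormedSpace ℝ V]
    [TopologicalSpace H] {I : ModelWithCorners ℝ V H} [TopologicalSpace M] [ChartedSpace H M]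
    [IsManifold I ∞ M] {f : M → Circle} (hf : ContMDiff I 𝓘(ℝ, ℂ) ∞ fun x => (f x : ℂ)) :
    ContMDiff I (𝓡 1) ∞ f := by
  have : Fact (Module.finrank ℝ ℂ = 1 + 1) := Complex.finrank_real_complex_fact
  have h : ∀ x, (f x : ℂ) ∈ Metric.sphere (0 : ℂ) 1 := fun x => (f x).2
  exact ContMDiff.codRestrict_sphere (n := 1) hf h

theorem contMDiff_mul_complex {V H M : Type*} [NormedAddCommGroup V] [NormedSpace ℝ V]
    [TopologicalSpace H] {I : ModelWithCorners ℝ V H} [TopologicalSpace M] [ChartedSpace H M]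
    {f g : M → ℂ} (hf : ContMDiff I 𝓘(ℝ, ℂ) ∞ f) (hg : ContMDiff I 𝓘(ℝ, ℂ) ∞ g) :
    ContMDiff I 𝓘(ℝ, ℂ) ∞ fun x => f x * g x :=
  (contDiff_fst.mul contDiff_snd : ContDiff ℝ ∞ fun p : ℂ × ℂ => p.1 * p.2).contMDiff.comp
    (hf.prodMk_space hg)

theorem contMDiff_circle_coe : ContMDiff (𝓡 1) 𝓘(ℝ, ℂ) ∞ fun z : Circle => (z : ℂ) := by
  have : Fact (Module.finrank ℝ ℂ = 1 + 1) := Complex.finrank_real_complex_fact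
  exact contMDiff_coe_sphere

theorem contDiff_sqrt_one_add : ContDiff ℝ ∞ fun z : ℂ => √(1 + ‖z‖ ^ 2) := by
  have : ContDiff ℝ ∞ fun z : ℂ => 1 + ‖z‖ ^ 2 := contDiff_const.add (contDiff_norm_sq ℝ)
  exact this.sqrt fun z => by positivity

theorem contMDiff_ofReal : ContDiff ℝ ∞ ((↑) : ℝ → ℂ) := Complex.ofRealCLM.contDiff

namespace SU11

theorem contMDiff_b : ContMDiff 𝓘G 𝓘(ℝ, ℂ) ∞ SU11.b :=
  contMDiff_snd.comp (transport_contMDiff 𝓘G ∞ SU11.coords)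

theorem contMDiff_a : ContMDiff 𝓘G 𝓘(ℝ, ℂ) ∞ SU11.a := by
  have h : ∀ A : SU11, ((coords A).1 : ℂ) * (√(1 + ‖A.b‖ ^ 2) : ℝ) = A.a := fun A =>
    congrArg SU11.a (coords.left_inv A)
  have h1 : ContMDiff 𝓘G 𝓘(ℝ, ℂ) ∞ fun A : SU11 => ((coords A).1 : ℂ) :=
    contMDiff_circle_coe.comp (contMDiff_fst.comp (transport_contMDiff 𝓘G ∞ SU11.coords))
  have h2 : ContMDiff 𝓘G 𝓘(ℝ, ℂ) ∞ fun A : SU11 => ((√(1 + ‖A.b‖ ^ 2) : ℝ) : ℂ) :=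
    (contMDiff_ofReal.comp contDiff_sqrt_one_add).contMDiff.comp contMDiff_b
  exact (contMDiff_mul_complex h1 h2).congr fun A => (h A).symm

theorem contDiffAt_div_norm {z : ℂ} (hz : z ≠ 0) :
    ContDiffAt ℝ ∞ (fun w : ℂ => w / ((‖w‖ : ℝ) : ℂ)) z := by
  have h1 : ContDiffAt ℝ ∞ (fun w : ℂ => ((‖w‖ : ℝ) : ℂ)) z :=
    contMDiff_ofReal.contDiffAt.comp z (contDiffAt_norm ℝ hz)
  have h2 : ((‖z‖ : ℝ) : ℂ) ≠ 0 := by simpa using hz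
  simp only [div_eq_mul_inv]
  exact contDiffAt_id.mul (h1.inv h2)

/-- A map into `SU(1,1)` is smooth when its matrix entries are smooth. -/
theorem contMDiff_of_entries {V H M : Type*} [NormedAddCommGroup V] [NormedSpace ℝ V]
    [TopologicalSpace H] {I : ModelWithCorners ℝ V H} [TopologicalSpace M] [ChartedSpace H M]
    [IsManifold I ∞ M] {f : M → SU11} (ha : ContMDiff I 𝓘(ℝ, ℂ) ∞ fun x => (f x).a)
    (hb : ContMDiff I 𝓘(ℝ, ℂ) ∞ fun x => (f x).b) : ContMDiff I 𝓘G ∞ f := by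
  have h1 : ContMDiff I (𝓡 1) ∞ fun x => (coords (f x)).1 := by
    apply contMDiff_circle
    intro x
    exact ContMDiffAt.comp (f := fun x => (f x).a) x
        (contDiffAt_div_norm (f x).a_ne_zero).contMDiffAt (ha x)
  have h2 : ContMDiff I 𝓘G ∞ fun x => coords (f x) := h1.prodMk hb
  have h3 := (transport_contMDiff_symm 𝓘G ∞ SU11.coords).comp h2
  exact h3.congr fun x => (coords.left_inv (f x)).symm

end SU11

theorem contDiff_conj : ContDiff ℝ ∞ fun z : ℂ => conj z := Complex.conjCLE.contDiff

instance : LieGroup 𝓘G ∞ SU11 where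
  contMDiff_mul := by
    have a1 := SU11.contMDiff_a.comp (contMDiff_fst (I := 𝓘G) (J := 𝓘G) (M := SU11) (N := SU11))
    have a2 := SU11.contMDiff_a.comp (contMDiff_snd (I := 𝓘G) (J := 𝓘G) (M := SU11) (N := SU11))
    have b1 := SU11.contMDiff_b.comp (contMDiff_fst (I := 𝓘G) (J := 𝓘G) (M := SU11) (N := SU11))
    have b2 := SU11.contMDiff_b.comp (contMDiff_snd (I := 𝓘G) (J := 𝓘G) (M := SU11) (N := SU11))
    refine SU11.contMDiff_of_entries ?_ ?_
    · simp only [SU11.mul_a]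
      exact (contMDiff_mul_complex a1 a2).add (contMDiff_mul_complex b1 (contDiff_conj.contMDiff.comp b2))
    · simp only [SU11.mul_b]
      exact (contMDiff_mul_complex a1 b2).add (contMDiff_mul_complex b1 (contDiff_conj.contMDiff.comp a2))
  contMDiff_inv := by
    refine SU11.contMDiff_of_entries ?_ ?_
    · simp only [SU11.inv_a]
      exact contDiff_conj.contMDiff.comp SU11.contMDiff_a
    · simp only [SU11.inv_b]
      exact contDiff_neg.contMDiff.comp SU11.contMDiff_b

/-! ### The action of `SU(1,1)` on the circle -/

namespace SU11

theorem norm_b_lt (A : SU11) : ‖A.b‖ < ‖A.a‖ := by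
  have := A.norm_sq
  nlinarith [norm_nonneg A.a, norm_nonneg A.b]

theorem denom_ne_zero (A : SU11) (u : Circle) : conj A.b * u + conj A.a ≠ 0 := by
  intro h
  have h1 : conj A.a = -(conj A.b * u) := by linear_combination h
  have h2 := congrArg norm h1
  rw [norm_neg, norm_mul, Circle.norm_coe, mul_one, RCLike.norm_conj, RCLike.norm_conj] at h2
  exact absurd h2 A.norm_b_lt.ne'

theorem circle_mul_conj (u : Circle) : (u : ℂ) * conj (u : ℂ) = 1 := by
  rw [Complex.mul_conj, Circle.normSq_coe, Complex.ofReal_one]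

theorem norm_num_eq (A : SU11) (u : Circle) :
    ‖A.a * u + A.b‖ = ‖conj A.b * u + conj A.a‖ := by
  have h : conj A.b * u + conj A.a = u * conj (A.a * u + A.b) := by
    have := circle_mul_conj u
    simp only [map_add, map_mul]
    linear_combination (- conj A.a) * this
  rw [h, norm_mul, Circle.norm_coe, one_mul, RCLike.norm_conj]

/-- The Möbius action `A · u = (a u + b) / (conj b u + conj a)` on the circle. -/
noncomputable instance : MulAction SU11 Circle where
  smul A u := ⟨(A.a * u + A.b) / (conj A.b * u + conj A.a), by
    refine mem_sphere_zero_iff_norm.2 ?_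
    rw [norm_div, A.norm_num_eq u, div_self (by simpa using A.denom_ne_zero u)]⟩
  one_smul u := by
    apply Circle.ext
    change (_ / _ : ℂ) = _
    simp
  mul_smul A B u := by
    apply Circle.ext
    change (_ / _ : ℂ) = (A.a * (_ / _) + A.b) / (conj A.b * (_ / _) + conj A.a)
    have h1 := B.denom_ne_zero u
    have h2 := (A * B).denom_ne_zero u
    rw [mul_a, mul_b] at *
    simp only [map_add, map_mul, Complex.conj_conj] at *
    generalize hD : conj B.b * (u : ℂ) + conj B.a = D at *
    have e1 : A.a * ((B.a * u + B.b) / D) + A.b =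
        ((A.a * B.a + A.b * conj B.b) * u + (A.a * B.b + A.b * conj B.a)) / D := by
      field_simp; rw [← hD]; ring
    have e2 : conj A.b * ((B.a * u + B.b) / D) + conj A.a =
        ((conj A.a * conj B.b + conj A.b * B.a) * u +
          (conj A.a * conj B.a + conj A.b * B.b)) / D := by
      field_simp; rw [← hD]; ring
    rw [e1, e2, div_div_div_cancel_right₀ h1]

theorem coe_smul (A : SU11) (u : Circle) :
    ((A • u : Circle) : ℂ) = (A.a * u + A.b) / (conj A.b * u + conj A.a) := rfl

end SU11

/-! ### The Möbius group of the circle -/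

/-- The group `M₀(S¹)` of the Möbius transformations that preserve the circle and its orientation,
as a group of transformations of the circle. A transformation of the circle preserves the
orientation when it lifts to an increasing bijection of the universal cover. -/
def mobiusGroup : Subgroup (Equiv.Perm Circle) where
  carrier := {f | (∃ a b c d : ℂ, a * d - b * c ≠ 0 ∧
      ∀ u : Circle, (f u : ℂ) = (a * u + b) / (c * u + d)) ∧
    ∃ φ : ℝ ≃o ℝ, ∀ t : ℝ, f (Circle.exp t) = Circle.exp (φ t)}
  one_mem' := ⟨⟨1, 0, 0, 1, by simp, by simp⟩, OrderIso.refl ℝ, by simp⟩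
  mul_mem' := by
    rintro f g ⟨⟨a, b, c, d, h, hf⟩, φ, hφ⟩ ⟨⟨a', b', c', d', h', hg⟩, ψ, hψ⟩
    refine ⟨⟨a * a' + b * c', a * b' + b * d', c * a' + d * c', c * b' + d * d', ?_, ?_⟩,
      ψ.trans φ, ?_⟩
    · have := mul_ne_zero h h'
      intro h0
      apply this
      linear_combination h0
    · intro u
      have h1 : c' * u + d' ≠ 0 := fun h0 => by
        have := hg u
        rw [h0, div_zero] at this
        exact (g u).coe_ne_zero this
      have h2 := hf (g u)
      rw [hg u] at h2
      change (f (g u) : ℂ) = _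
      generalize hD : c' * (u : ℂ) + d' = D at *
      have h3 : a * ((a' * u + b') / D) + b =
          ((a * a' + b * c') * u + (a * b' + b * d')) / D := by
        field_simp; rw [← hD]; ring
      have h4 : c * ((a' * u + b') / D) + d =
          ((c * a' + d * c') * u + (c * b' + d * d')) / D := by
        field_simp; rw [← hD]; ring
      rw [h2, h3, h4, div_div_div_cancel_right₀ h1]
    · intro t
      simp [hφ, hψ]
  inv_mem' := by
    rintro f ⟨⟨a, b, c, d, h, hf⟩, φ, hφ⟩
    refine ⟨⟨d, -b, -c, a, by intro h0; apply h; linear_combination h0, ?_⟩, φ.symm, ?_⟩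
    · intro u
      obtain ⟨v, rfl⟩ := f.surjective u
      have hv := hf v
      have hinv : f⁻¹ (f v) = v := f.symm_apply_apply v
      rw [hinv]
      have h1 : c * v + d ≠ 0 := fun h0 => by
        rw [h0, div_zero] at hv
        exact (f v).coe_ne_zero hv
      generalize hD : c * (v : ℂ) + d = D at *
      have h2 : -c * ((a * v + b) / D) + a = (a * d - b * c) / D := by
        field_simp; rw [← hD]; ring
      have h3 : d * ((a * v + b) / D) + -b = (a * d - b * c) * v / D := by
        field_simp; rw [← hD]; ring
      rw [hv, h2, h3, div_div_div_cancel_right₀ h1, mul_div_cancel_left₀ _ h]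
    · intro t
      rw [Equiv.Perm.inv_eq_iff_eq, hφ, OrderIso.apply_symm_apply]

/-- `M₀(S¹)` as a type. -/
abbrev M0 : Type := mobiusGroup

theorem exp_conj_arg (z : ℂ) (hz : z ≠ 0) :
    Complex.exp ((2 * z.arg : ℝ) * Complex.I) = z / conj z := by
  have h := Complex.norm_mul_exp_arg_mul_I z
  have hc : conj z = ‖z‖ * Complex.exp (-(z.arg * Complex.I)) := by
    conv_lhs => rw [← h]
    rw [map_mul, Complex.conj_ofReal, ← Complex.exp_conj]
    simp
  have hn : ((‖z‖ : ℝ) : ℂ) ≠ 0 := by simpa using hz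
  have hz' : conj z ≠ 0 := by simpa using hz
  rw [eq_div_iff hz', hc]
  conv_rhs => rw [← h]
  rw [mul_left_comm, ← Complex.exp_add]
  congr 2
  push_cast
  ring

/-- The action of an element of `SU(1,1)` on the circle lifts to an increasing bijection. -/
theorem exists_orderIso (A : SU11) :
    ∃ φ : ℝ ≃o ℝ, ∀ t : ℝ, A • Circle.exp t = Circle.exp (φ t) := by
  have ha := A.a_ne_zero
  set v : ℝ → ℂ := fun t => 1 + A.b / A.a * Complex.exp (-(t * Complex.I)) with hv
  have hslit : ∀ t, v t ∈ Complex.slitPlane := fun t => by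
    apply Complex.mem_slitPlane_of_norm_lt_one
    have : ‖Complex.exp (-(t * Complex.I))‖ = 1 := by
      rw [← neg_mul, ← Complex.ofReal_neg, Complex.norm_exp_ofReal_mul_I]
    rw [norm_mul, this, mul_one, norm_div, div_lt_one (by simpa using ha)]
    exact A.norm_b_lt
  set φ : ℝ → ℝ := fun t => t + 2 * A.a.arg + 2 * (v t).arg with hφ
  have hcont : Continuous φ := by
    have h1 : Continuous fun t => (v t).arg := by
      rw [continuous_iff_continuousAt]
      intro t
      exact (Complex.continuousAt_arg (hslit t)).comp (by fun_prop : Continuous v).continuousAt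
    fun_prop
  have hlift : ∀ t, A • Circle.exp t = Circle.exp (φ t) := by
    intro t
    apply Circle.ext
    rw [SU11.coe_smul, Circle.coe_exp, Circle.coe_exp]
    have hv0 := Complex.slitPlane_ne_zero (hslit t)
    have e1 : Complex.exp ((φ t : ℝ) * Complex.I) =
        Complex.exp (t * Complex.I) * (A.a / conj A.a) * (v t / conj (v t)) := by
      rw [← exp_conj_arg _ ha, ← exp_conj_arg _ hv0, ← Complex.exp_add, ← Complex.exp_add]
      congr 1
      simp only [hφ]; push_cast; ring
    have hE : Complex.exp (-(t * Complex.I)) = (Complex.exp (t * Complex.I))⁻¹ :=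
      Complex.exp_neg _
    have hE0 := Complex.exp_ne_zero (t * Complex.I)
    have hcE : conj (Complex.exp (-(t * Complex.I))) = Complex.exp (t * Complex.I) := by
      rw [← Complex.exp_conj]; simp
    have hca : conj A.a ≠ 0 := by simpa using ha
    have e2 : A.a * v t = A.a + A.b * Complex.exp (-(t * Complex.I)) := by
      simp only [hv]; field_simp
    have e3 : conj A.a * conj (v t) = conj A.b * Complex.exp (t * Complex.I) + conj A.a := by
      rw [← map_mul, e2, map_add, map_mul, hcE]; ring
    rw [e1, ← e3, mul_assoc, div_mul_div_comm, e2, hE, ← mul_div_assoc]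
    congr 1
    field_simp
  have hper : ∀ t (k : ℤ), φ (t + k * (2 * Real.pi)) = φ t + k * (2 * Real.pi) := by
    intro t k
    have : v (t + k * (2 * Real.pi)) = v t := by
      simp only [hv]
      congr 2
      rw [Complex.exp_eq_exp_iff_exists_int]
      exact ⟨-k, by push_cast; ring⟩
    simp only [hφ, this]; ring
  have hinj : Function.Injective φ := by
    intro s t hst
    have h1 : A • Circle.exp s = A • Circle.exp t := by rw [hlift, hlift, hst]
    obtain ⟨k, hk⟩ := Circle.exp_eq_exp.1 (MulAction.injective A h1)
    rw [hk, hper] at hst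
    have : (k : ℝ) * (2 * Real.pi) = 0 := by linarith
    rw [hk, this, add_zero]
  have hmono : StrictMono φ := by
    refine (hcont.strictMono_of_inj hinj).resolve_right fun h => ?_
    have h1 := hper 0 1
    have h2 := @h 0 (0 + (1 : ℤ) * (2 * Real.pi)) (by simp [Real.pi_pos])
    rw [h1] at h2
    have := Real.pi_pos
    simp at h2
    linarith
  have hbd : ∀ t, |(v t).arg| ≤ Real.pi := fun t => Complex.abs_arg_le_pi _
  have hsurj : Function.Surjective φ := by
    refine hcont.surjective ?_ ?_
    · refine Filter.tendsto_atTop_mono (fun t => ?_)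
        (Filter.tendsto_atTop_add_const_right _ (2 * A.a.arg - 2 * Real.pi) Filter.tendsto_id)
      have := (abs_le.1 (hbd t)).1
      simp only [hφ, id]; linarith
    · refine Filter.tendsto_atBot_mono (fun t => ?_)
        (Filter.tendsto_atBot_add_const_right _ (2 * A.a.arg + 2 * Real.pi) Filter.tendsto_id)
      have := (abs_le.1 (hbd t)).2
      simp only [hφ, id]; linarith
  exact ⟨hmono.orderIsoOfSurjective φ hsurj, hlift⟩

/-- The double cover `SU(1,1) → M₀(S¹)`, sending a matrix to its Möbius transformation. -/
noncomputable def toM0 : SU11 →* M0 :=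
  (MulAction.toPermHom SU11 Circle).codRestrict mobiusGroup fun A =>
    ⟨⟨A.a, A.b, conj A.b, conj A.a, by
      have h := A.norm_sq
      rw [Complex.mul_conj, Complex.mul_conj, Complex.normSq_eq_norm_sq,
        Complex.normSq_eq_norm_sq, h]
      push_cast
      simp, fun u => rfl⟩, exists_orderIso A⟩

theorem toM0_smul (A : SU11) (u : Circle) : toM0 A • u = A • u := rfl

/-- Complex conjugation does not preserve the orientation of the circle. -/
theorem not_orderIso_inv (φ : ℝ ≃o ℝ) (c : Circle)
    (h : ∀ t : ℝ, c * (Circle.exp t)⁻¹ = Circle.exp (φ t)) : False := by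
  obtain ⟨x, rfl⟩ := Circle.exp_surjective c
  have h1 : ∀ t, ∃ k : ℤ, φ t + t - x = k * (2 * Real.pi) := fun t => by
    have : Circle.exp (φ t + t - x) = 1 := by
      rw [Circle.exp_sub, Circle.exp_add, ← h t]; simp
    exact Circle.exp_eq_one.1 this
  choose k hk using h1
  have hpi := Real.pi_pos
  have hkm : StrictMono k := fun s t hst => by
    have := φ.strictMono hst
    have h2 : (k s : ℝ) * (2 * Real.pi) < k t * (2 * Real.pi) := by
      rw [← hk, ← hk]; linarith
    exact_mod_cast lt_of_mul_lt_mul_right h2 (by positivity)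
  have : Countable ℝ := hkm.injective.countable
  exact not_countable_iff.2 inferInstance this



/-- Every element of `M₀(S¹)` comes from `SU(1,1)`. -/
theorem toM0_surjective : Function.Surjective toM0 := by
  rintro ⟨f, ⟨a, b, c, d, hdet, hf⟩, φ, hφ⟩
  -- the moduli of numerator and denominator agree on the circle
  have hnorm : ∀ u : Circle, (a * u + b) * conj (a * u + b) = (c * u + d) * conj (c * u + d) := by
    intro u
    have h0 : c * u + d ≠ 0 := fun h0 => by
      have := hf u
      rw [h0, div_zero] at this
      exact (f u).coe_ne_zero this
    have h1 : (f u : ℂ) * (c * u + d) = a * u + b := by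
      rw [hf u, div_mul_cancel₀ _ h0]
    have h2 := SU11.circle_mul_conj (f u)
    rw [← h1, map_mul]
    linear_combination ((c * u + d) * conj (c * u + d)) * h2
  have e1 := hnorm 1
  have e2 := hnorm (-1)
  have e3 := hnorm ⟨Complex.I, by simp [Submonoid.unitSphere]⟩
  simp only [Circle.coe_one, Circle.coe_neg, map_add, map_mul, map_neg, map_one,
    Complex.conj_I] at e1 e2 e3
  have hI := Complex.I_mul_I
  have s1 : a * conj a + b * conj b = c * conj c + d * conj d := by
    linear_combination (e1 + e2) / 2
  have s2 : a * conj b + b * conj a = c * conj d + d * conj c := by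
    linear_combination (e1 - e2) / 2
  have s3 : a * conj b - b * conj a = c * conj d - d * conj c := by
    linear_combination (-Complex.I) * e3 + Complex.I * s1 +
      (a * conj b - b * conj a - c * conj d + d * conj c -
        Complex.I * (a * conj a - c * conj c)) * hI
  have s4 : a * conj b = c * conj d := by linear_combination (s2 + s3) / 2
  have s5 : b * conj a = d * conj c := by linear_combination (s2 - s3) / 2
  have hcases : (a * conj a - c * conj c) * (a * conj a - d * conj d) = 0 := by
    linear_combination (a * conj a) * s1 - (conj a * b) * s4 - (c * conj d) * s5
  have hxr : a * conj a = d * conj d := by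
    rcases mul_eq_zero.1 hcases with h | h
    · exfalso
      have h1 : conj a * (a * d - b * c) = 0 := by linear_combination d * h - c * s5
      rcases mul_eq_zero.1 h1 with h2 | h2
      · have ha : a = 0 := by simpa using h2
        have hc : c = 0 := by simpa [ha] using h
        apply hdet; rw [ha, hc]; ring
      · exact hdet h2
    · linear_combination h
  have hyp : b * conj b = c * conj c := by linear_combination s1 - hxr
  set Δ := a * d - b * c with hΔ
  -- the real number `|a|² - |b|²`
  set D : ℝ := ‖a‖ ^ 2 - ‖b‖ ^ 2 with hD
  have hDc : (D : ℂ) = a * conj a - b * conj b := by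
    rw [Complex.mul_conj, Complex.mul_conj, Complex.normSq_eq_norm_sq, Complex.normSq_eq_norm_sq,
      hD]; push_cast; rfl
  have t1 : Δ * conj a = D * d := by
    rw [hDc, hΔ]; linear_combination (-c) * s5 + d * hyp
  have t2 : Δ * conj b = D * c := by
    rw [hDc, hΔ]; linear_combination d * s4 - c * hxr
  have hD0 : (D : ℂ) ≠ 0 := by
    intro h0
    rw [h0, zero_mul] at t1 t2
    have ha : a = 0 := by simpa using (mul_eq_zero.1 t1).resolve_left hdet
    have hb : b = 0 := by simpa using (mul_eq_zero.1 t2).resolve_left hdet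
    apply hdet; rw [hΔ, ha, hb]; ring
  set μ := Δ / D with hμ
  have hd : d = μ * conj a := by rw [hμ]; field_simp; linear_combination -t1
  have hc : c = μ * conj b := by rw [hμ]; field_simp; linear_combination -t2
  have hμ1 : μ * conj μ = 1 := by
    have h1 : D * (μ * conj μ) = (D : ℂ) := by
      have h2 : a * conj a = μ * conj μ * (a * conj a) := by
        conv_lhs => rw [hxr, hd]
        simp only [map_mul, Complex.conj_conj]; ring
      have h3 : b * conj b = μ * conj μ * (b * conj b) := by
        conv_lhs => rw [hyp, hc]
        simp only [map_mul, Complex.conj_conj]; ring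
      rw [hDc]; linear_combination h3 - h2
    exact mul_left_cancel₀ hD0 (by rw [h1, mul_one])
  have hμn : ‖μ‖ = 1 := by
    have h1 := congrArg norm hμ1
    rw [norm_mul, RCLike.norm_conj, norm_one] at h1
    nlinarith [norm_nonneg μ]
  obtain ⟨s, hs⟩ := Circle.exp_surjective ⟨conj μ, by simp [Submonoid.unitSphere, hμn]⟩
  set ν : Circle := Circle.exp (s / 2) with hν
  have hν2 : (ν : ℂ) * ν = conj μ := by
    rw [← Circle.coe_mul, hν, ← Circle.exp_add, add_halves, hs]
  have hνc := SU11.circle_mul_conj ν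
  -- the elements of `SU(1,1)` built from a pair of entries
  have build : ∀ x y : ℂ, 0 < ‖x‖ ^ 2 - ‖y‖ ^ 2 → ∃ A : SU11, ∀ u : Circle,
      ((A • u : Circle) : ℂ) = conj μ * ((x * u + y) / (conj y * u + conj x)) := by
    intro x y hxy
    set r : ℝ := √(‖x‖ ^ 2 - ‖y‖ ^ 2) with hr
    have hr0 : 0 < r := Real.sqrt_pos.2 hxy
    have hr2 : r ^ 2 = ‖x‖ ^ 2 - ‖y‖ ^ 2 := Real.sq_sqrt hxy.le
    have hrc : (r : ℂ) ≠ 0 := by exact_mod_cast hr0.ne'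
    have hn : ∀ z : ℂ, ‖(ν : ℂ) * z / r‖ = ‖z‖ / r := fun z => by
      rw [norm_div, norm_mul, Circle.norm_coe, one_mul, Complex.norm_real, Real.norm_eq_abs,
        abs_of_pos hr0]
    refine ⟨SU11.mk (ν * x / r) (ν * y / r) ?_, fun u => ?_⟩
    · rw [hn, hn, div_pow, div_pow, ← sub_div, ← hr2, div_self (by positivity)]
    · have hden := SU11.denom_ne_zero (SU11.mk (ν * x / r) (ν * y / r) (by
        rw [hn, hn, div_pow, div_pow, ← sub_div, ← hr2, div_self (by positivity)])) u
      rw [SU11.coe_smul]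
      simp only [SU11.mk_a, SU11.mk_b, map_mul, map_div₀, Complex.conj_ofReal] at hden ⊢
      have e1 : conj (ν : ℂ) * conj y / r * u + conj (ν : ℂ) * conj x / r =
          conj (ν : ℂ) / r * (conj y * u + conj x) := by ring
      have e2 : (ν : ℂ) * x / r * u + ν * y / r = ν / r * (x * u + y) := by ring
      rw [e1] at hden
      have hden' := right_ne_zero_of_mul hden
      have hν0 : conj (ν : ℂ) ≠ 0 := by simp
      rw [e1, e2, ← hν2, ← mul_div_assoc, div_eq_div_iff hden hden']
      linear_combination (-(ν : ℂ) / r * (x * u + y) * (conj y * u + conj x)) * hνc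
  have hfμ : ∀ u : Circle, (f u : ℂ) = conj μ * ((a * u + b) / (conj b * u + conj a)) := by
    intro u
    have hμ0 : μ ≠ 0 := left_ne_zero_of_mul_eq_one hμ1
    rw [hf u, hc, hd, eq_inv_of_mul_eq_one_right hμ1, mul_assoc, ← mul_add, ← div_div,
      div_right_comm, div_eq_mul_inv, mul_comm]
  rcases lt_or_gt_of_ne (show D ≠ 0 by exact_mod_cast hD0) with h | h
  · exfalso
    obtain ⟨B, hB⟩ := build b a (by rw [hD] at h; linarith)
    have hBf : ∀ u : Circle, B • u⁻¹ = f u := by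
      intro u
      apply Circle.ext
      rw [hB, hfμ, Circle.coe_inv]
      have hu := u.coe_ne_zero
      have e1 : b * (u : ℂ)⁻¹ + a = (a * u + b) / u := by field_simp; ring
      have e2 : conj a * (u : ℂ)⁻¹ + conj b = (conj b * u + conj a) / u := by field_simp; ring
      rw [e1, e2, div_div_div_cancel_right₀ hu]
    obtain ⟨ψ, hψ⟩ := exists_orderIso B⁻¹
    refine not_orderIso_inv (φ.trans ψ) 1 fun t => ?_
    rw [OrderIso.trans_apply, ← hψ, ← hφ, ← hBf, inv_smul_smul, one_mul]
  · obtain ⟨A, hA⟩ := build a b (by rw [hD] at h; linarith)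
    refine ⟨A, Subtype.ext (Equiv.ext fun u => Circle.ext ?_)⟩
    rw [hfμ u]
    exact hA u

/-- Two elements of `SU(1,1)` have the same Möbius transformation iff they agree up to sign. -/
theorem toM0_eq_iff (A B : SU11) :
    toM0 A = toM0 B ↔ A.a ^ 2 = B.a ^ 2 ∧ A.a * A.b = B.a * B.b := by
  constructor
  · intro h
    obtain ⟨C, rfl⟩ : ∃ C, A = B * C := ⟨B⁻¹ * A, by group⟩
    have hC : ∀ u : Circle, C.a * u + C.b = u * (conj C.b * u + conj C.a) := by
      intro u
      have h1 : (B * C) • u = B • u := by rw [← toM0_smul, h, toM0_smul]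
      rw [mul_smul] at h1
      have h2 : ((C • u : Circle) : ℂ) = u := congrArg _ (MulAction.injective B h1)
      rw [SU11.coe_smul, div_eq_iff (C.denom_ne_zero u)] at h2
      exact h2
    have e1 := hC 1
    have e2 := hC (-1)
    have e3 := hC ⟨Complex.I, by simp [Submonoid.unitSphere]⟩
    simp only [Circle.coe_one, Circle.coe_neg] at e1 e2 e3
    have ha : conj C.a = C.a := by linear_combination (e2 - e1) / 2
    have hb' : conj C.b = C.b := by linear_combination (-e1 - e2) / 2
    have hb : C.b = 0 := by
      rw [ha, hb'] at e3
      linear_combination e3 / 2 + C.b / 2 * Complex.I_mul_I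
    have h1 : C.a * C.a = 1 := by
      have := C.norm_sq
      rw [hb, norm_zero, zero_pow two_ne_zero, add_zero, ← Complex.normSq_eq_norm_sq] at this
      have h2 := Complex.mul_conj C.a
      rw [ha, this] at h2
      simpa using h2
    rw [SU11.mul_a, SU11.mul_b, hb, ha, map_zero]
    constructor
    · linear_combination B.a ^ 2 * h1
    · linear_combination (B.a * B.b) * h1
  · rintro ⟨h1, h2⟩
    have key : ∀ ε : ℂ, A.a = ε * B.a → A.b = ε * B.b → ε ≠ 0 → conj ε = ε → toM0 A = toM0 B := by
      intro ε ha hb h0 hc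
      apply Subtype.ext
      apply Equiv.ext
      intro u
      apply Circle.ext
      change (A.a * u + A.b) / (conj A.b * u + conj A.a) =
        (B.a * u + B.b) / (conj B.b * u + conj B.a)
      rw [ha, hb, map_mul, map_mul, hc, mul_assoc, mul_assoc, ← mul_add, ← mul_add,
        mul_div_mul_left _ _ h0]
    rcases sq_eq_sq_iff_eq_or_eq_neg.1 h1 with h | h
    · refine key 1 (by simp [h]) ?_ one_ne_zero (by simp)
      rw [h] at h2
      simpa using mul_left_cancel₀ B.a_ne_zero h2
    · refine key (-1) (by simp [h]) ?_ (by simp) (by simp)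
      rw [h] at h2
      apply mul_left_cancel₀ (neg_ne_zero.2 B.a_ne_zero)
      linear_combination h2

namespace M0

/-- `M₀(S¹)` carries the quotient topology of `SU(1,1)`. -/
noncomputable instance : TopologicalSpace M0 := TopologicalSpace.coinduced toM0 inferInstance

theorem continuous_toM0 : Continuous toM0 := continuous_coinduced_rng

/-- One of the two elements of `SU(1,1)` over an element of `M₀(S¹)`. -/
noncomputable def lift (f : M0) : SU11 := (toM0_surjective f).choose

theorem toM0_lift (f : M0) : toM0 (lift f) = f := (toM0_surjective f).choose_spec

/-- The square of the entry `a` of a lift. -/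
noncomputable def sqA (f : M0) : ℂ := (lift f).a ^ 2

/-- The product of the entries `a` and `b` of a lift. -/
noncomputable def mulAB (f : M0) : ℂ := (lift f).a * (lift f).b

theorem sqA_toM0 (A : SU11) : sqA (toM0 A) = A.a ^ 2 :=
  ((toM0_eq_iff _ _).1 (toM0_lift (toM0 A))).1

theorem mulAB_toM0 (A : SU11) : mulAB (toM0 A) = A.a * A.b :=
  ((toM0_eq_iff _ _).1 (toM0_lift (toM0 A))).2

theorem ext {f g : M0} (h1 : sqA f = sqA g) (h2 : mulAB f = mulAB g) : f = g := by
  rw [← toM0_lift f, ← toM0_lift g]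
  exact (toM0_eq_iff _ _).2 ⟨h1, h2⟩

theorem sqA_ne_zero (f : M0) : sqA f ≠ 0 := pow_ne_zero 2 (lift f).a_ne_zero

theorem continuous_sqA : Continuous sqA := by
  refine continuous_coinduced_dom.2 ?_
  exact (SU11.continuous_a.pow 2).congr fun A => (sqA_toM0 A).symm

theorem continuous_mulAB : Continuous mulAB := by
  refine continuous_coinduced_dom.2 ?_
  exact (SU11.continuous_a.mul SU11.continuous_b).congr fun A => (mulAB_toM0 A).symm

/-- The element of `SU(1,1)` with `a = s √(1 + |w|²)` and `b = w / s`. -/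
noncomputable def sec (s : Circle) (w : ℂ) : SU11 := SU11.coords.symm (s, w * conj (s : ℂ))

theorem sec_a (s : Circle) (w : ℂ) : (sec s w).a = s * (√(1 + ‖w‖ ^ 2) : ℝ) := by
  change (s : ℂ) * (√(1 + ‖w * conj (s : ℂ)‖ ^ 2) : ℝ) = _
  rw [norm_mul, RCLike.norm_conj, Circle.norm_coe, mul_one]

theorem sec_b (s : Circle) (w : ℂ) : (sec s w).b = w * conj (s : ℂ) := rfl

theorem sq_sqrt (w : ℂ) : ((√(1 + ‖w‖ ^ 2) : ℝ) : ℂ) ^ 2 = 1 + (‖w‖ : ℂ) ^ 2 := by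
  rw [← Complex.ofReal_pow, Real.sq_sqrt (by positivity)]; push_cast; rfl

theorem toM0_sec_eq_iff (s : Circle) (w : ℂ) (f : M0) :
    toM0 (sec s w) = f ↔ (s : ℂ) ^ 2 * (1 + (‖w‖ : ℂ) ^ 2) = sqA f ∧
      w * (√(1 + ‖w‖ ^ 2) : ℝ) = mulAB f := by
  have h1 : (sec s w).a ^ 2 = (s : ℂ) ^ 2 * (1 + (‖w‖ : ℂ) ^ 2) := by
    rw [sec_a, mul_pow, sq_sqrt]
  have h2 : (sec s w).a * (sec s w).b = w * (√(1 + ‖w‖ ^ 2) : ℝ) := by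
    rw [sec_a, sec_b]
    linear_combination (w * (√(1 + ‖w‖ ^ 2) : ℝ)) * SU11.circle_mul_conj s
  rw [← h1, ← h2, ← sqA_toM0, ← mulAB_toM0]
  exact ⟨by rintro rfl; exact ⟨rfl, rfl⟩, fun h => ext h.1 h.2⟩

theorem continuous_sec : Continuous fun x : Circle × ℂ => sec x.1 x.2 := by
  refine SU11.coords.symm.continuous.comp ?_
  have := Complex.continuous_conj
  fun_prop

/-- A square root on the circle. -/
noncomputable def root (u : Circle) : Circle := Circle.exp ((u : ℂ).arg / 2)

theorem root_sq (u : Circle) : root u ^ 2 = u := by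
  rw [root, sq, ← Circle.exp_add, add_halves, Circle.exp_arg]

theorem norm_sqA (f : M0) : ‖sqA f‖ = 1 + ‖(lift f).b‖ ^ 2 := by
  rw [sqA, norm_pow, SU11.norm_sq]

/-- Global coordinates on `M₀(S¹)`: the transformation of `[[a, b], [conj b, conj a]]` has the
coordinates `(a² / |a|², a b / |a|)`. -/
noncomputable def coords : M0 ≃ₜ Circle × ℂ where
  toFun f := (SU11.phase (sqA f) (sqA_ne_zero f),
    mulAB f / (√‖sqA f‖ : ℝ))
  invFun x := toM0 (sec (root x.1) x.2)
  left_inv f := by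
    have hn : ‖mulAB f / (√‖sqA f‖ : ℝ)‖ = ‖(lift f).b‖ := by
      have h0 : ‖(lift f).a‖ ≠ 0 := by simpa using (lift f).a_ne_zero
      rw [norm_div, mulAB, sqA, norm_pow, Real.sqrt_sq (norm_nonneg _), norm_mul,
        Complex.norm_real, norm_norm]
      field_simp
    have h0 : ((‖sqA f‖ : ℝ) : ℂ) ≠ 0 := by simpa using sqA_ne_zero f
    have hr : ((√‖sqA f‖ : ℝ) : ℂ) ≠ 0 := by
      have : 0 < ‖sqA f‖ := by simpa using sqA_ne_zero f
      exact_mod_cast (Real.sqrt_pos.2 this).ne'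
    rw [toM0_sec_eq_iff]
    dsimp only
    rw [hn, ← norm_sqA, ← Circle.coe_pow, root_sq]
    constructor
    · rw [SU11.coe_phase]
      have : (1 + (‖(lift f).b‖ : ℂ) ^ 2) = ((‖sqA f‖ : ℝ) : ℂ) := by
        rw [norm_sqA]; push_cast; rfl
      rw [this, div_mul_cancel₀ _ h0]
    · rw [div_mul_cancel₀ _ hr]
  right_inv x := by
    obtain ⟨h1, h2⟩ := (toM0_sec_eq_iff (root x.1) x.2 _).1 rfl
    have hp : 0 < 1 + ‖x.2‖ ^ 2 := by positivity
    have hn : ‖sqA (toM0 (sec (root x.1) x.2))‖ = 1 + ‖x.2‖ ^ 2 := by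
      rw [← h1, norm_mul, norm_pow, Circle.norm_coe, one_pow, one_mul, ← Complex.ofReal_pow,
        ← Complex.ofReal_one, ← Complex.ofReal_add, Complex.norm_real, Real.norm_eq_abs,
        abs_of_pos hp]
    have hp' : (1 + (‖x.2‖ : ℂ) ^ 2) ≠ 0 := by exact_mod_cast hp.ne'
    have hr : ((√(1 + ‖x.2‖ ^ 2) : ℝ) : ℂ) ≠ 0 := by exact_mod_cast (Real.sqrt_pos.2 hp).ne'
    refine Prod.ext (Circle.ext ?_) ?_
    · change sqA _ / ((‖sqA _‖ : ℝ) : ℂ) = x.1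
      rw [hn, ← h1, ← Circle.coe_pow, root_sq]
      push_cast
      field_simp
    · change mulAB _ / ((√‖sqA _‖ : ℝ) : ℂ) = x.2
      rw [hn, ← h2, mul_div_cancel_right₀ _ hr]
  continuous_toFun := by
    have h1 := continuous_sqA
    have h2 := continuous_mulAB
    refine Continuous.prodMk (Continuous.subtype_mk ?_ _) ?_
    · exact h1.div (by fun_prop) fun f => by simpa using sqA_ne_zero f
    · refine h2.div (by fun_prop) fun f => ?_
      have : 0 < ‖sqA f‖ := by simpa using sqA_ne_zero f
      exact_mod_cast (Real.sqrt_pos.2 this).ne'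
  continuous_invFun := by
    rw [continuous_iff_continuousAt]
    intro x
    have hloc : ∀ y : Circle × ℂ, toM0 (sec (root y.1) y.2) =
        toM0 (sec (root x.1 * root (y.1 / x.1)) y.2) := by
      intro y
      rw [toM0_sec_eq_iff, ← (toM0_sec_eq_iff (root x.1 * root (y.1 / x.1)) y.2 _).1 rfl |>.1,
        ← (toM0_sec_eq_iff (root x.1 * root (y.1 / x.1)) y.2 _).1 rfl |>.2]
      refine ⟨?_, rfl⟩
      rw [← Circle.coe_pow, ← Circle.coe_pow, mul_pow, root_sq, root_sq, root_sq]
      simp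
    rw [funext hloc]
    refine continuous_toM0.continuousAt.comp (continuous_sec.continuousAt.comp
      (f := fun y : Circle × ℂ => (root x.1 * root (y.1 / x.1), y.2)) ?_)
    refine ContinuousAt.prodMk (continuousAt_const.mul ?_) continuousAt_snd
    refine Circle.exp.continuous.continuousAt.comp ?_
    refine ContinuousAt.div_const ?_ 2
    refine ContinuousAt.comp (g := Complex.arg) (f := fun y : Circle × ℂ => ((y.1 / x.1 : Circle) : ℂ))
      (Complex.continuousAt_arg ?_) ?_
    · simp
    · have : Continuous fun y : Circle × ℂ => y.1 / x.1 := by fun_prop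
      exact ((continuous_subtype_val : Continuous fun z : Circle => (z : ℂ)).comp this).continuousAt

noncomputable instance : ChartedSpace GroupModel M0 := transportCharts coords

instance : IsManifold 𝓘G ∞ M0 := transport_isManifold 𝓘G ∞ coords

/-- The squared modulus of the entry `a` of a lift. -/
noncomputable def normSqA (f : M0) : ℂ := (lift f).a * conj (lift f).a

theorem normSqA_eq (f : M0) : normSqA f = 1 + ‖(coords f).2‖ ^ 2 := by
  have h := (toM0_sec_eq_iff (root (coords f).1) (coords f).2 f).1 (coords.left_inv f)
  have h1 := congrArg norm h.1
  have hp : 0 < 1 + ‖(coords f).2‖ ^ 2 := by positivity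
  rw [norm_mul, norm_pow, Circle.norm_coe, one_pow, one_mul, ← Complex.ofReal_pow,
    ← Complex.ofReal_one, ← Complex.ofReal_add, Complex.norm_real, Real.norm_eq_abs,
    abs_of_pos hp, sqA, norm_pow] at h1
  rw [normSqA, Complex.mul_conj, Complex.normSq_eq_norm_sq, ← h1]
  push_cast; rfl

theorem normSqA_ne_zero (f : M0) : normSqA f ≠ 0 := by
  have := (lift f).a_ne_zero
  simp [normSqA, this]

theorem contMDiff_coords_snd : ContMDiff 𝓘G 𝓘(ℝ, ℂ) ∞ fun f : M0 => (coords f).2 :=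
  contMDiff_snd.comp (transport_contMDiff 𝓘G ∞ coords)

theorem contMDiff_normSqA : ContMDiff 𝓘G 𝓘(ℝ, ℂ) ∞ normSqA := by
  have h : ContDiff ℝ ∞ fun z : ℂ => (1 + (‖z‖ : ℂ) ^ 2 : ℂ) := by
    have : ContDiff ℝ ∞ fun z : ℂ => ((1 + ‖z‖ ^ 2 : ℝ) : ℂ) :=
      contMDiff_ofReal.comp (contDiff_const.add (contDiff_norm_sq ℝ))
    simpa using this
  exact (h.contMDiff.comp contMDiff_coords_snd).congr normSqA_eq

theorem contMDiff_sqA : ContMDiff 𝓘G 𝓘(ℝ, ℂ) ∞ sqA := by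
  have h1 : ContMDiff 𝓘G 𝓘(ℝ, ℂ) ∞ fun f : M0 => ((coords f).1 : ℂ) :=
    contMDiff_circle_coe.comp (contMDiff_fst.comp (transport_contMDiff 𝓘G ∞ coords))
  refine (contMDiff_mul_complex h1 contMDiff_normSqA).congr fun f => ?_
  have h := (toM0_sec_eq_iff (root (coords f).1) (coords f).2 f).1 (coords.left_inv f)
  rw [normSqA_eq, ← h.1, ← Circle.coe_pow, root_sq]

theorem contMDiff_mulAB : ContMDiff 𝓘G 𝓘(ℝ, ℂ) ∞ mulAB := by
  have h2 : ContMDiff 𝓘G 𝓘(ℝ, ℂ) ∞ fun f : M0 => ((√(1 + ‖(coords f).2‖ ^ 2) : ℝ) : ℂ) :=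
    (contMDiff_ofReal.comp contDiff_sqrt_one_add).contMDiff.comp contMDiff_coords_snd
  refine (contMDiff_mul_complex contMDiff_coords_snd h2).congr fun f => ?_
  exact ((toM0_sec_eq_iff (root (coords f).1) (coords f).2 f).1 (coords.left_inv f)).2.symm

theorem contMDiff_inv_complex {V H M : Type*} [NormedAddCommGroup V] [NormedSpace ℝ V]
    [TopologicalSpace H] {I : ModelWithCorners ℝ V H} [TopologicalSpace M] [ChartedSpace H M]
    {g : M → ℂ} (hg : ContMDiff I 𝓘(ℝ, ℂ) ∞ g) (h0 : ∀ x, g x ≠ 0) :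
    ContMDiff I 𝓘(ℝ, ℂ) ∞ fun x => (g x)⁻¹ := fun x =>
  ContMDiffAt.comp (f := g) x ((contDiffAt_id (𝕜 := ℝ)).inv (h0 x)).contMDiffAt (hg x)

/-- A map into `M₀(S¹)` is smooth when the functions `a²` and `a b` along it are smooth. -/
theorem contMDiff_of_entries {V H M : Type*} [NormedAddCommGroup V] [NormedSpace ℝ V]
    [TopologicalSpace H] {I : ModelWithCorners ℝ V H} [TopologicalSpace M] [ChartedSpace H M]
    [IsManifold I ∞ M] {f : M → M0} (ha : ContMDiff I 𝓘(ℝ, ℂ) ∞ fun x => sqA (f x))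
    (hb : ContMDiff I 𝓘(ℝ, ℂ) ∞ fun x => mulAB (f x)) : ContMDiff I 𝓘G ∞ f := by
  have h1 : ContMDiff I (𝓡 1) ∞ fun x => (coords (f x)).1 := by
    apply contMDiff_circle
    intro x
    exact ContMDiffAt.comp (f := fun x => sqA (f x)) x
      (SU11.contDiffAt_div_norm (sqA_ne_zero (f x))).contMDiffAt (ha x)
  have hs : ContMDiff I 𝓘(ℝ, ℂ) ∞ fun x => ((√‖sqA (f x)‖ : ℝ) : ℂ) := by
    intro x
    have hc : ContDiffAt ℝ ∞ (fun z : ℂ => ((√‖z‖ : ℝ) : ℂ)) (sqA (f x)) :=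
      contMDiff_ofReal.contDiffAt.comp _
        ((contDiffAt_norm ℝ (sqA_ne_zero (f x))).sqrt (by simpa using sqA_ne_zero (f x)))
    exact ContMDiffAt.comp (f := fun x => sqA (f x)) x hc.contMDiffAt (ha x)
  have h2 : ContMDiff I 𝓘(ℝ, ℂ) ∞ fun x => (coords (f x)).2 := by
    refine (contMDiff_mul_complex hb (contMDiff_inv_complex hs fun x => ?_)).congr fun x => ?_
    · have : 0 < ‖sqA (f x)‖ := by simpa using sqA_ne_zero (f x)
      exact_mod_cast (Real.sqrt_pos.2 this).ne'
    · rw [← div_eq_mul_inv]; rfl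
  have h3 := (transport_contMDiff_symm 𝓘G ∞ coords).comp (h1.prodMk h2)
  exact h3.congr fun x => (coords.left_inv (f x)).symm

/-- The double cover `SU(1,1) → M₀(S¹)` is smooth. -/
theorem contMDiff_toM0 : ContMDiff 𝓘G 𝓘G ∞ toM0 := by
  refine contMDiff_of_entries ?_ ?_
  · exact (contMDiff_mul_complex SU11.contMDiff_a SU11.contMDiff_a).congr fun A => by
      rw [sqA_toM0, sq]
  · exact (contMDiff_mul_complex SU11.contMDiff_a SU11.contMDiff_b).congr fun A => mulAB_toM0 A

theorem mul_formulas (f g : M0) :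
    sqA (f * g) = sqA f * sqA g + 2 * (mulAB f * (conj (mulAB g) * sqA g * (normSqA g)⁻¹)) +
      mulAB f * mulAB f * (sqA f)⁻¹ * conj (mulAB g * mulAB g * (sqA g)⁻¹) ∧
    mulAB (f * g) = sqA f * mulAB g + mulAB f * normSqA g + mulAB f * (normSqA g - 1) +
      mulAB f * mulAB f * (sqA f)⁻¹ * conj (mulAB g) := by
  have h1 : f * g = toM0 (lift f * lift g) := by rw [map_mul, toM0_lift, toM0_lift]
  have ha := (lift f).a_ne_zero
  have hc := (lift g).a_ne_zero
  have hc' : conj (lift g).a ≠ 0 := by simpa using hc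
  have hn : (lift g).b * conj (lift g).b = (lift g).a * conj (lift g).a - 1 := by
    rw [Complex.mul_conj, Complex.mul_conj, Complex.normSq_eq_norm_sq, Complex.normSq_eq_norm_sq,
      (lift g).norm_sq]; push_cast; ring
  rw [h1, sqA_toM0, mulAB_toM0, SU11.mul_a, SU11.mul_b]
  simp only [sqA, mulAB, normSqA, map_mul, map_inv₀, map_pow]
  constructor
  · field_simp
    ring
  · field_simp
    linear_combination ((lift f).a * (lift f).b) * hn

theorem inv_formulas (f : M0) :
    sqA f⁻¹ = conj (sqA f) ∧ mulAB f⁻¹ = -(mulAB f * conj (sqA f) * (normSqA f)⁻¹) := by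
  have h1 : f⁻¹ = toM0 (lift f)⁻¹ := by rw [map_inv, toM0_lift]
  have ha := (lift f).a_ne_zero
  have ha' : conj (lift f).a ≠ 0 := by simpa using ha
  rw [h1, sqA_toM0, mulAB_toM0, SU11.inv_a, SU11.inv_b]
  simp only [sqA, mulAB, normSqA, map_pow]
  refine ⟨trivial, ?_⟩
  field_simp

instance : LieGroup 𝓘G ∞ M0 where
  contMDiff_mul := by
    have hf := contMDiff_fst (I := 𝓘G) (J := 𝓘G) (M := M0) (N := M0) (n := ∞)
    have hg := contMDiff_snd (I := 𝓘G) (J := 𝓘G) (M := M0) (N := M0) (n := ∞)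
    have a1 := contMDiff_sqA.comp hf
    have a2 := contMDiff_sqA.comp hg
    have b1 := contMDiff_mulAB.comp hf
    have b2 := contMDiff_mulAB.comp hg
    have n2 := contMDiff_normSqA.comp hg
    have i1 := contMDiff_inv_complex a1 fun x => sqA_ne_zero x.1
    have i2 := contMDiff_inv_complex a2 fun x => sqA_ne_zero x.2
    have j2 := contMDiff_inv_complex n2 fun x => normSqA_ne_zero x.2
    have cb2 := contDiff_conj.contMDiff.comp b2
    have two : ContMDiff (𝓘G.prod 𝓘G) 𝓘(ℝ, ℂ) ∞ fun _ : M0 × M0 => (2 : ℂ) := contMDiff_const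
    have one : ContMDiff (𝓘G.prod 𝓘G) 𝓘(ℝ, ℂ) ∞ fun _ : M0 × M0 => (1 : ℂ) := contMDiff_const
    have q1 := contMDiff_mul_complex (contMDiff_mul_complex b1 b1) i1
    have q2 := contDiff_conj.contMDiff.comp
      (contMDiff_mul_complex (contMDiff_mul_complex b2 b2) i2)
    refine contMDiff_of_entries ?_ ?_
    · exact (((contMDiff_mul_complex a1 a2).add (contMDiff_mul_complex two
        (contMDiff_mul_complex b1 (contMDiff_mul_complex (contMDiff_mul_complex cb2 a2) j2)))).add
        (contMDiff_mul_complex q1 q2)).congr fun x => (mul_formulas x.1 x.2).1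
    · exact ((((contMDiff_mul_complex a1 b2).add (contMDiff_mul_complex b1 n2)).add
        (contMDiff_mul_complex b1 (n2.sub one))).add
        (contMDiff_mul_complex q1 cb2)).congr fun x => (mul_formulas x.1 x.2).2
  contMDiff_inv := by
    have ca := contDiff_conj.contMDiff.comp contMDiff_sqA
    have j := contMDiff_inv_complex contMDiff_normSqA normSqA_ne_zero
    refine contMDiff_of_entries ?_ ?_
    · exact ca.congr fun f => (inv_formulas f).1
    · exact (contDiff_neg.contMDiff.comp (contMDiff_mul_complex
        (contMDiff_mul_complex contMDiff_mulAB ca) j)).congr fun f => (inv_formulas f).2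

end M0

/-! ### The structure groups -/

/-- A Lie group covered by `SU(1,1)` and acting on the circle by Möbius transformations. -/
structure StructureGroup where
  carrier : Type
  [group : Group carrier]
  [topology : TopologicalSpace carrier]
  [charts : ChartedSpace GroupModel carrier]
  [lieGroup : LieGroup 𝓘G ∞ carrier]
  [action : MulAction carrier Circle]
  /-- The covering homomorphism from `SU(1,1)`. -/
  cover : SU11 →* carrier
  cover_surjective : Function.Surjective cover
  cover_smooth : ContMDiff 𝓘G 𝓘G ∞ cover
  cover_smul : ∀ (A : SU11) (u : Circle), cover A • u = A • u

namespace StructureGroup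

instance : CoeSort StructureGroup Type := ⟨carrier⟩

attribute [instance] group topology charts lieGroup action

/-- The structure group `M₀(S¹)`. -/
noncomputable abbrev mobius : StructureGroup where
  carrier := M0
  cover := toM0
  cover_surjective := toM0_surjective
  cover_smooth := M0.contMDiff_toM0
  cover_smul := toM0_smul

/-- The structure group `SU(1,1)`. -/
noncomputable abbrev specialUnitary : StructureGroup where
  carrier := SU11
  cover := MonoidHom.id SU11
  cover_surjective := Function.surjective_id
  cover_smooth := contMDiff_id
  cover_smul _ _ := rfl

end StructureGroup

/-- The Lie algebra `su(1,1)` of `SU(1,1)`, and of its quotient `M₀(S¹)`. -/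
def su11 : Submodule ℝ (Matrix (Fin 2) (Fin 2) ℂ) where
  carrier := {X | ∃ (γ : ℝ) (β : ℂ), X = !![γ * Complex.I, β; conj β, -(γ * Complex.I)]}
  zero_mem' := ⟨0, 0, by ext i j; fin_cases i <;> fin_cases j <;> simp⟩
  add_mem' := by
    rintro _ _ ⟨γ, β, rfl⟩ ⟨γ', β', rfl⟩
    refine ⟨γ + γ', β + β', ?_⟩
    ext i j
    fin_cases i <;> fin_cases j <;> simp <;> ring
  smul_mem' := by
    rintro r _ ⟨γ, β, rfl⟩
    refine ⟨r * γ, r * β, ?_⟩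
    ext i j
    fin_cases i <;> fin_cases j <;> simp <;> ring

/-! ### The bundles

The plane `ℝ²` is identified with `ℂ`. -/

/-- The configuration space `E = ℝ² × S¹`: the position of the tracer point and the direction of
the planimeter. It is a bundle over the plane by the first projection. -/
abbrev Config : Type := ℂ × Circle

/-- The model with corners of `E`. -/
noncomputable abbrev 𝓘E : ModelWithCorners ℝ (ℂ × EuclideanSpace ℝ (Fin 1))
    (ModelProd ℂ (EuclideanSpace ℝ (Fin 1))) := 𝓘(ℝ, ℂ).prod (𝓡 1)

/-- The total space of the trivial principal bundle `P = ℝ² × G → ℝ²`, on which `G` acts on the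
right by `(q, A) · g = (q, A g)`. -/
abbrev Principal (G : StructureGroup) : Type := ℂ × G

/-- The model with corners of `P`. -/
noncomputable abbrev 𝓘P : ModelWithCorners ℝ (ℂ × (EuclideanSpace ℝ (Fin 1) × ℂ))
    (ModelProd ℂ GroupModel) := 𝓘(ℝ, ℂ).prod 𝓘G

/-- The orbit relation of the right action `(p, u) · g = (p g, g⁻¹ u)` of `G` on `P × S¹`. -/
def associatedSetoid (G : StructureGroup) : Setoid (Principal G × Circle) where
  r x y := ∃ g : G, y = ((x.1.1, x.1.2 * g), g⁻¹ • x.2)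
  iseqv :=
    { refl := fun x => ⟨1, by simp⟩
      symm := by
        rintro x y ⟨g, rfl⟩
        exact ⟨g⁻¹, by simp⟩
      trans := by
        rintro x y z ⟨g, rfl⟩ ⟨h, rfl⟩
        exact ⟨g * h, by simp [mul_assoc, mul_smul]⟩ }

/-- The associated bundle `P ×_G S¹ = (P × S¹) / G`. -/
def AssociatedBundle (G : StructureGroup) : Type := Quotient (associatedSetoid G)

/-- The associated bundle carries the quotient topology. -/
instance (G : StructureGroup) : TopologicalSpace (AssociatedBundle G) :=
  inferInstanceAs (TopologicalSpace (Quotient (associatedSetoid G)))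

namespace AssociatedBundle

variable {G : StructureGroup}

/-- The class of `(p, u)` in the associated bundle. -/
def mk (p : Principal G) (u : Circle) : AssociatedBundle G := Quotient.mk (associatedSetoid G) (p, u)

/-- The projection of the associated bundle to the plane. -/
def proj : AssociatedBundle G → ℂ :=
  Quotient.lift (fun x : Principal G × Circle => x.1.1) (by rintro _ _ ⟨g, rfl⟩; rfl)

/-- `Ψ` is an isomorphism of smooth fiber bundles over the plane: it covers the identity, and its
composition with the quotient map `P × S¹ → P ×_G S¹` is a smooth submersion. (Its fibers are then
the orbits of `G`, so that `Ψ` is a diffeomorphism for the quotient smooth structure.) -/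
structure IsBundleIso (Ψ : AssociatedBundle G ≃ₜ Config) : Prop where
  fst_apply : ∀ x, (Ψ x).1 = proj x
  smooth : ContMDiff (𝓘P.prod (𝓡 1)) 𝓘E ∞ fun x : Principal G × Circle => Ψ (mk x.1 x.2)
  submersion : ∀ x : Principal G × Circle, Function.Surjective
    (mfderiv (𝓘P.prod (𝓡 1)) 𝓘E (fun x : Principal G × Circle => Ψ (mk x.1 x.2)) x)

end AssociatedBundle

/-! ### Curves, horizontal curves and parallel transport -/

section Curves

variable {V H M : Type*} [NormedAddCommGroup V] [NormedSpace ℝ V] [TopologicalSpace H]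
  [TopologicalSpace M] [ChartedSpace H M]

/-- A piecewise `C¹` curve `[0,1] → M`; the values of `c` outside of `[0,1]` are irrelevant. -/
def IsPiecewiseC1 (I : ModelWithCorners ℝ V H) (c : ℝ → M) : Prop :=
  ∃ (n : ℕ) (s : ℕ → ℝ), Monotone s ∧ s 0 = 0 ∧ s n = 1 ∧
    ∀ i < n, ContMDiffOn 𝓘(ℝ, ℝ) I 1 c (Set.Icc (s i) (s (i + 1)))

/-- A piecewise `C¹` curve on `[0,1]` that is tangent to the distribution `D`. -/
def IsHorizontal (I : ModelWithCorners ℝ V H) (D : ∀ x : M, Submodule ℝ (TangentSpace I x))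
    (c : ℝ → M) : Prop :=
  IsPiecewiseC1 I c ∧ ∀ t ∈ Set.Ioo (0 : ℝ) 1, MDifferentiableAt 𝓘(ℝ, ℝ) I c t →
    mfderiv 𝓘(ℝ, ℝ) I c t (1 : ℝ) ∈ D (c t)

/-- `c` is a horizontal lift of the curve `γ`, starting at `x`. -/
def IsHorizontalLift (I : ModelWithCorners ℝ V H) (D : ∀ x : M, Submodule ℝ (TangentSpace I x))
    (π : M → ℂ) (γ : ℝ → ℂ) (x : M) (c : ℝ → M) : Prop :=
  IsHorizontal I D c ∧ (∀ t ∈ Set.Icc (0 : ℝ) 1, π (c t) = γ t) ∧ c 0 = x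

/-- The parallel transport along `γ` takes `x` to `y`. -/
def ParallelTransport (I : ModelWithCorners ℝ V H) (D : ∀ x : M, Submodule ℝ (TangentSpace I x))
    (π : M → ℂ) (γ : ℝ → ℂ) (x y : M) : Prop :=
  ∃ c, IsHorizontalLift I D π γ x c ∧ c 1 = y

end Curves

/-- A piecewise `C¹` loop in the plane, based at `q`. -/
def IsLoop (q : ℂ) (γ : ℝ → ℂ) : Prop :=
  IsPiecewiseC1 𝓘(ℝ, ℂ) γ ∧ γ 0 = q ∧ γ 1 = q

/-! ### The planimeter -/

/-- The chisel edge of a planimeter of length `ℓ`. -/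
noncomputable def chisel (ℓ : ℝ) (e : Config) : ℂ := e.1 + ℓ * e.2

/-- The unit normal of the planimeter: the direction from the chisel edge to the tracer point and
the normal form a positively oriented frame. -/
noncomputable def normal (e : Config) : ℂ := -Complex.I * e.2

/-- A motion of the planimeter of length `ℓ`: the velocity of the chisel edge has no component in
the direction of the normal. -/
def IsPlanimeterMotion (ℓ : ℝ) (c : ℝ → Config) : Prop :=
  IsPiecewiseC1 𝓘E c ∧ ∀ t ∈ Set.Ioo (0 : ℝ) 1, MDifferentiableAt 𝓘(ℝ, ℝ) 𝓘E c t →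
    inner ℝ (normal (c t)) (deriv (fun s => chisel ℓ (c s)) t) = 0

/-! ### Connections on `E → ℝ²` -/

/-- A connection on the fiber bundle `E → ℝ²`: a smooth field of projections of the tangent spaces
onto the vertical subspaces. -/
structure BundleConnection where
  form : ∀ e : Config, TangentSpace 𝓘E e →L[ℝ] TangentSpace 𝓘E e
  smooth : ContMDiff 𝓘E.tangent 𝓘E.tangent ∞ fun w : TangentBundle 𝓘E Config =>
    (⟨w.proj, form w.proj w.2⟩ : TangentBundle 𝓘E Config)
  idempotent : ∀ e w, form e (form e w) = form e w
  range_eq : ∀ e, LinearMap.range (form e).toLinearMap =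
    LinearMap.ker (mfderiv 𝓘E 𝓘(ℝ, ℂ) (Prod.fst : Config → ℂ) e).toLinearMap

namespace BundleConnection

/-- The horizontal subspaces. -/
noncomputable def horizontal (Φ : BundleConnection) (e : Config) : Submodule ℝ (TangentSpace 𝓘E e) :=
  LinearMap.ker (Φ.form e).toLinearMap

/-- Every piecewise `C¹` curve has a unique horizontal lift from every point over its start. -/
def IsComplete (Φ : BundleConnection) : Prop :=
  ∀ γ : ℝ → ℂ, IsPiecewiseC1 𝓘(ℝ, ℂ) γ → ∀ e : Config, e.1 = γ 0 →
    ∃ c, IsHorizontalLift 𝓘E Φ.horizontal Prod.fst γ e c ∧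
      ∀ c', IsHorizontalLift 𝓘E Φ.horizontal Prod.fst γ e c' → Set.EqOn c' c (Set.Icc 0 1)

/-- The holonomy group at `q`: the transformations of the fiber `{q} × S¹`, identified with `S¹`,
that are parallel transports along loops at `q`. -/
def holonomy (Φ : BundleConnection) (q : ℂ) : Set (Equiv.Perm Circle) :=
  {f | ∃ γ, IsLoop q γ ∧
    ∀ u : Circle, ParallelTransport 𝓘E Φ.horizontal Prod.fst γ (q, u) (q, f u)}

end BundleConnection

/-! ### Principal connections on `P → ℝ²` -/

/-- A principal connection on `P → ℝ²`, given by its `su(1,1)`-valued connection form. -/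
structure PrincipalConnection (G : StructureGroup) where
  form : ∀ p : Principal G, TangentSpace 𝓘P p →ₗ[ℝ] su11
  /-- The matrix entries of the form are smooth. -/
  smooth : ∀ i j : Fin 2, ContMDiff 𝓘P.tangent 𝓘(ℝ, ℂ) ∞
    fun w : TangentBundle 𝓘P (Principal G) => (form w.proj w.2 : Matrix (Fin 2) (Fin 2) ℂ) i j
  /-- The form takes the fundamental vertical vector field of an element of the Lie algebra to this
  element; the tangent vectors `ξ` of `SU(1,1)` at the identity are identified with matrices by
  the differentials of the matrix entries. -/
  vertical : ∀ (q : ℂ) (g : G) (ξ : TangentSpace 𝓘G (1 : SU11)) (i j : Fin 2),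
    (form (q, g) (mfderiv 𝓘G 𝓘P (fun A : SU11 => ((q, g * G.cover A) : Principal G)) 1 ξ) :
      Matrix (Fin 2) (Fin 2) ℂ) i j =
    mfderiv 𝓘G 𝓘(ℝ, ℂ) (fun A : SU11 => A.1.1 i j) 1 ξ
  /-- The form is equivariant: its pull-back by the right translation by `A` is `Ad(A⁻¹)` of it. -/
  equivariant : ∀ (A : SU11) (p : Principal G) (w : TangentSpace 𝓘P p),
    (form (p.1, p.2 * G.cover A)
      (mfderiv 𝓘P 𝓘P (fun p' : Principal G => ((p'.1, p'.2 * G.cover A) : Principal G)) p w) :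
      Matrix (Fin 2) (Fin 2) ℂ) =
    (A⁻¹).1.1 * (form p w : Matrix (Fin 2) (Fin 2) ℂ) * A.1.1

namespace PrincipalConnection

variable {G : StructureGroup}

/-- The horizontal subspaces. -/
noncomputable def horizontal (θ : PrincipalConnection G) (p : Principal G) : Submodule ℝ (TangentSpace 𝓘P p) :=
  LinearMap.ker (θ.form p)

/-- The connection form with respect to the standard frame: the pull-back `ω` of the connection
form by the section `q ↦ (q, 1)`. -/
noncomputable def localForm (θ : PrincipalConnection G) (q v : ℂ) : Matrix (Fin 2) (Fin 2) ℂ :=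
  θ.form (q, 1) (mfderiv 𝓘(ℝ, ℂ) 𝓘P (fun x : ℂ => ((x, 1) : Principal G)) q v)

/-- The curvature form `Ω = dω + ω ∧ ω` with respect to the standard frame, where
`dω (v, w) = ∂_v (ω w) - ∂_w (ω v)`, entry by entry, and
`(ω ∧ ω) (v, w) = ω v * ω w - ω w * ω v`. -/
noncomputable def localCurvature (θ : PrincipalConnection G) (q v w : ℂ) :
    Matrix (Fin 2) (Fin 2) ℂ :=
  Matrix.of (fun i j => fderiv ℝ (fun x => θ.localForm x w i j) q v -
      fderiv ℝ (fun x => θ.localForm x v i j) q w) +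
    (θ.localForm q v * θ.localForm q w - θ.localForm q w * θ.localForm q v)

/-- The holonomy group at `p`: the elements `g` of `G` for which `p` is taken to `p g` by the
parallel transport along a loop. -/
def holonomy (θ : PrincipalConnection G) (p : Principal G) : Set G :=
  {g | ∃ γ, IsLoop p.1 γ ∧
    ParallelTransport 𝓘P θ.horizontal Prod.fst γ p (p.1, p.2 * g)}

/-- The connection `Φ` on `E` is induced by the principal connection `θ`, when `E` is identified
with the associated bundle by `Ψ`: the horizontal subspaces of `Φ` are the images of those of `θ`
under the maps `P → E`, `p ↦ Ψ [p, u]`. -/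
def Induces (θ : PrincipalConnection G) (Ψ : AssociatedBundle G ≃ₜ Config)
    (Φ : BundleConnection) : Prop :=
  ∀ (p : Principal G) (u : Circle),
    Φ.horizontal (Ψ (AssociatedBundle.mk p u)) = (θ.horizontal p).map
      (mfderiv 𝓘P 𝓘E (fun p' : Principal G => Ψ (AssociatedBundle.mk p' u)) p).toLinearMap

end PrincipalConnection

end Planimeter

/-!
# Parallel transport of the planimeter

A configuration moves with the rod's chisel edge free of normal velocity exactly when its tracer
point `γ` and its direction `u` satisfy the Riccati equation
`u' = (conj γ' u² - γ') / 2ℓ` (`inner_normal_eq_zero_iff`). This is the equation of the vector field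
on the circle that the matrix `-ω(γ')`, with `ω(v) = (1 / 2ℓ) [[0, v], [conj v, 0]]`, generates under
the Möbius action. So if `A' = -ω(γ') A` in `SU(1,1)` along `γ` (`IsFrame`), then `A t • u` is a
motion over `γ` (`IsFrame.isHorizontal_config`), and all motions over `γ` are of this form: the inverse
of `A` takes a motion to a constant (`IsFrame.eq_smul_of_isHorizontalLift`). The equation for `A` is
linear in its entries and keeps `|a|² - |b|²` constant, so that it can be solved along all of `γ`
(`exists_isFrame`). This gives completeness, and shows that parallel transports on `E` are Möbius
transformations.

Both connections are obtained by differentiating explicit maps. A chart-free smooth map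
`frameStep : ℂ → SU(1,1)` with differential `ω` at the origin moves nearby fibers, to first order, to
the fiber over a given point. The vertical projection on `E` is the differential at `e` of the map
`fiberShift` that moves nearby configurations to the fiber through `e`. The connection form on `P` is
the differential at `p` of the map `discrepancy`, which moves nearby points to the fiber of `p`,
compares them with `p`, and lifts the result from `G` to `SU(1,1)` near the identity
(`IsLocalInverse`). The axioms of a connection, the local form `ω` and the compatibility of the two
connections (`IsLocalInverse.induces_bundleConnection`) then follow by the chain rule from identities
between such maps, which hold near the point in question, for both structure groups at once.

For the holonomy, transport along a segment is a boost, that is, a hyperbolic element with axis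
through the center of the disc. The product of two boosts along orthogonal axes is another boost times
a nontrivial rotation, so that triangles with suitable sides give all small rotations
(`Reach.exists_rot_small`), hence all rotations, and by the polar decomposition all of `SU(1,1)` is
reached by polygons. To close these up, take a polygon with transport the half turn
`R = diag(i, -i)`: traversing it before and after a side, in opposite directions, turns the transport
along the side into its inverse and has no effect on the displacement. A boost is therefore the
transport along half of a side, followed by such a conjugate of the same half traversed backwards, in
total a loop (`Reach.boost_loop`). So every element of `SU(1,1)` is the transport along a loop
(`exists_loop`), which determines both holonomy groups.
-/

namespace Planimeter

open Set Filter Topology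

/-! ### Maps into `SU(1,1)` and its action on the circle -/

theorem coe_exp_arg {z : ℂ} (hz : z ≠ 0) : (Circle.exp z.arg : ℂ) = z / ‖z‖ := by
  have h : ((‖z‖ : ℝ) : ℂ) ≠ 0 := by simpa using hz
  rw [Circle.coe_exp, eq_div_iff h, mul_comm]
  exact Complex.norm_mul_exp_arg_mul_I z

theorem contDiffAt_arg {z : ℂ} (hz : z ∈ Complex.slitPlane) : ContDiffAt ℝ ∞ Complex.arg z := by
  have h : ContDiffAt ℝ ∞ (fun w : ℂ => Complex.imCLM (Complex.log w)) z :=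
    Complex.imCLM.contDiff.contDiffAt.comp z ((Complex.contDiffAt_log hz).restrict_scalars ℝ)
  exact h.congr_of_eventuallyEq (Eventually.of_forall fun w => (Complex.log_im w).symm)

/-- The phase `z ↦ z / |z|` is smooth as a map into the circle. -/
theorem contMDiffAt_exp_arg {z : ℂ} (hz : z ≠ 0) :
    ContMDiffAt 𝓘(ℝ, ℂ) (𝓡 1) ∞ (fun w : ℂ => Circle.exp w.arg) z := by
  have h1 : ContMDiffAt 𝓘(ℝ, ℂ) (𝓡 1) ∞ (fun w : ℂ => Circle.exp (w / z).arg) z := by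
    refine (contMDiff_circleExp (m := ∞)).contMDiffAt.comp z ?_
    refine ContDiffAt.contMDiffAt ?_
    refine ContDiffAt.comp (g := Complex.arg) z (contDiffAt_arg ?_) (by fun_prop)
    rw [div_self hz]
    exact Complex.one_mem_slitPlane
  have h2 : ContMDiffAt 𝓘(ℝ, ℂ) (𝓡 1) ∞
      (fun w : ℂ => Circle.exp z.arg * Circle.exp (w / z).arg) z :=
    contMDiffAt_const.mul h1
  refine h2.congr_of_eventuallyEq ?_
  filter_upwards [isOpen_ne.mem_nhds hz] with w hw
  apply Circle.ext
  have hz' : ((‖z‖ : ℝ) : ℂ) ≠ 0 := by simpa using hz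
  have hw' : ((‖w‖ : ℝ) : ℂ) ≠ 0 := by simpa using hw
  rw [Circle.coe_mul, coe_exp_arg hw, coe_exp_arg hz, coe_exp_arg (div_ne_zero hw hz), norm_div]
  push_cast
  field_simp

namespace SU11

/-- The element of `SU(1,1)` with the entry `b`, and with an entry `a` of the given phase: a
retraction of the pairs `(a, b)` with `a ≠ 0` onto `SU(1,1)`. -/
noncomputable def retract (x : ℂ × ℂ) : SU11 := coords.symm (Circle.exp x.1.arg, x.2)

theorem retract_entries (A : SU11) : retract (A.a, A.b) = A := by
  rw [retract, Homeomorph.symm_apply_eq]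
  refine Prod.ext (Circle.ext ?_) rfl
  exact coe_exp_arg A.a_ne_zero

theorem contMDiffAt_retract {x : ℂ × ℂ} (hx : x.1 ≠ 0) :
    ContMDiffAt (𝓘(ℝ, ℂ).prod 𝓘(ℝ, ℂ)) 𝓘G ∞ retract x := by
  refine (transport_contMDiff_symm 𝓘G ∞ SU11.coords).contMDiffAt.comp x ?_
  refine ContMDiffAt.prodMk ?_ contMDiffAt_snd
  exact ContMDiffAt.comp (f := fun x : ℂ × ℂ => x.1) x (contMDiffAt_exp_arg hx) contMDiffAt_fst

section

variable {V H M : Type*} [NormedAddCommGroup V] [NormedSpace ℝ V]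
    [TopologicalSpace H] {I : ModelWithCorners ℝ V H} [TopologicalSpace M] [ChartedSpace H M]
    {f : M → SU11} {x : M}

/-- `SU11.contMDiff_of_entries` within a set and of finite order, as piecewise `C¹` curves need it. -/
theorem contMDiffWithinAt_of_entries {s : Set M} {n : ℕ∞ω} (hn : n ≤ ∞)
    (ha : ContMDiffWithinAt I 𝓘(ℝ, ℂ) n (fun y => (f y).a) s x)
    (hb : ContMDiffWithinAt I 𝓘(ℝ, ℂ) n (fun y => (f y).b) s x) :
    ContMDiffWithinAt I 𝓘G n f s x := by
  have h := (contMDiffAt_retract (x := ((f x).a, (f x).b)) (f x).a_ne_zero).of_le hn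
  have h2 := ContMDiffAt.comp_contMDiffWithinAt (f := fun y => ((f y).a, (f y).b)) x h
    (ha.prodMk hb)
  exact h2.congr (fun y _ => (retract_entries (f y)).symm) (retract_entries (f x)).symm

/-- The matrix entries form an immersion. -/
theorem mfderiv_eq_zero_of_entries (hf : MDifferentiableAt I 𝓘G f x) {w : TangentSpace I x}
    (ha : mfderiv I 𝓘(ℝ, ℂ) (fun y => (f y).a) x w = 0)
    (hb : mfderiv I 𝓘(ℝ, ℂ) (fun y => (f y).b) x w = 0) :
    mfderiv I 𝓘G f x w = 0 := by
  have da : MDifferentiableAt I 𝓘(ℝ, ℂ) (fun y => (f y).a) x :=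
    ((contMDiff_a (f x)).mdifferentiableAt (by simp)).comp x hf
  have db : MDifferentiableAt I 𝓘(ℝ, ℂ) (fun y => (f y).b) x :=
    ((contMDiff_b (f x)).mdifferentiableAt (by simp)).comp x hf
  have hr := (contMDiffAt_retract (x := ((f x).a, (f x).b)) (f x).a_ne_zero).mdifferentiableAt
    (by simp)
  have h1 : f = retract ∘ fun y => ((f y).a, (f y).b) :=
    funext fun y => (retract_entries (f y)).symm
  have hd := da.hasMFDerivAt.prodMk db.hasMFDerivAt
  have h2 := (hr.hasMFDerivAt.comp x hd).mfderiv
  rw [← h1] at h2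
  rw [h2]
  exact (congrArg (mfderiv (𝓘(ℝ, ℂ).prod 𝓘(ℝ, ℂ)) 𝓘G retract ((f x).a, (f x).b))
    (Prod.ext ha hb)).trans (ContinuousLinearMap.map_zero _)

end

/-- The action of `SU(1,1)` on the circle is smooth. -/
theorem contMDiff_smul {V H M : Type*} [NormedAddCommGroup V] [NormedSpace ℝ V]
    [TopologicalSpace H] {I : ModelWithCorners ℝ V H} [TopologicalSpace M] [ChartedSpace H M]
    [IsManifold I ∞ M] {f : M → SU11} {g : M → Circle} (hf : ContMDiff I 𝓘G ∞ f)
    (hg : ContMDiff I (𝓡 1) ∞ g) : ContMDiff I (𝓡 1) ∞ fun x => f x • g x := by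
  have a := contMDiff_a.comp hf
  have b := contMDiff_b.comp hf
  have u := contMDiff_circle_coe.comp hg
  have a' := contDiff_conj.contMDiff.comp a
  have b' := contDiff_conj.contMDiff.comp b
  apply contMDiff_circle
  refine (contMDiff_mul_complex ((contMDiff_mul_complex a u).add b)
    (M0.contMDiff_inv_complex ((contMDiff_mul_complex b' u).add a')
      fun x => (f x).denom_ne_zero (g x))).congr fun x => ?_
  rw [coe_smul, div_eq_mul_inv]
  rfl

end SU11

/-! ### The infinitesimal transport -/

/-- A smooth map `ℂ → SU(1,1)` with value `1` and differential
`v ↦ (1 / 2ℓ) [[0, v], [conj v, 0]]` at the origin. To first order, it is the parallel transport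
from the fiber over `q + v` to the fiber over `q`. Any map with this value and differential would do;
this one has the entry `b` linear in `v`, and the entry `a` positive. -/
noncomputable def frameStep (ℓ : ℝ) (v : ℂ) : SU11 := SU11.coords.symm (1, v / (2 * ℓ))

theorem frameStep_a (ℓ : ℝ) (v : ℂ) : (frameStep ℓ v).a = (√(1 + ‖v / (2 * ℓ)‖ ^ 2) : ℝ) := by
  change ((1 : Circle) : ℂ) * (√(1 + ‖v / (2 * ℓ)‖ ^ 2) : ℝ) = _
  rw [Circle.coe_one, one_mul]

theorem frameStep_b (ℓ : ℝ) (v : ℂ) : (frameStep ℓ v).b = v / (2 * ℓ) := rfl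

theorem frameStep_zero (ℓ : ℝ) : frameStep ℓ 0 = 1 := by
  apply SU11.ext
  · rw [frameStep_a]; simp
  · rw [frameStep_b]; simp

theorem contMDiff_frameStep (ℓ : ℝ) : ContMDiff 𝓘(ℝ, ℂ) 𝓘G ∞ (frameStep ℓ) := by
  refine (transport_contMDiff_symm 𝓘G ∞ SU11.coords).comp ?_
  refine ContMDiff.prodMk contMDiff_const (ContDiff.contMDiff ?_)
  fun_prop

theorem hasFDerivAt_frameStep_a (ℓ : ℝ) :
    HasFDerivAt (fun v => (frameStep ℓ v).a) (0 : ℂ →L[ℝ] ℂ) 0 := by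
  have h1 : HasFDerivAt (fun v : ℂ => 1 + ‖v / (2 * ℓ)‖ ^ 2) (0 : ℂ →L[ℝ] ℝ) 0 := by
    have hd : HasFDerivAt (fun v : ℂ => v / (2 * ℓ)) _ 0 :=
      (by fun_prop : DifferentiableAt ℝ (fun v : ℂ => v / (2 * ℓ)) 0).hasFDerivAt
    have := (hd.norm_sq).const_add 1
    refine this.congr_fderiv ?_
    ext w
    simp
  have h2 := h1.sqrt (by simp)
  have h3 := Complex.ofRealCLM.hasFDerivAt.comp (0 : ℂ) h2
  refine (h3.congr_fderiv ?_).congr_of_eventuallyEq (Eventually.of_forall fun v => frameStep_a ℓ v)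
  simp

theorem hasFDerivAt_frameStep_b (ℓ : ℝ) :
    HasFDerivAt (fun v => (frameStep ℓ v).b)
      ((1 / (2 * ℓ) : ℂ) • ContinuousLinearMap.id ℝ ℂ) 0 := by
  have h := (hasFDerivAt_id (𝕜 := ℝ) (0 : ℂ)).const_smul (1 / (2 * ℓ) : ℂ)
  refine h.congr_of_eventuallyEq (Eventually.of_forall fun v => ?_)
  change v / (2 * ℓ) = (1 / (2 * ℓ) : ℂ) * v
  ring

/-! ### Differentiation along the diagonal -/

section Diagonal

variable {V H M V' H' M' : Type*} [NormedAddCommGroup V] [NormedSpace ℝ V] [TopologicalSpace H]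
  [TopologicalSpace M] [ChartedSpace H M] {I : ModelWithCorners ℝ V H} [IsManifold I ∞ M]
  [NormedAddCommGroup V'] [NormedSpace ℝ V'] [TopologicalSpace H']
  [TopologicalSpace M'] [ChartedSpace H' M'] {I' : ModelWithCorners ℝ V' H'} [IsManifold I' ∞ M']

/-- If `f` is smooth near the diagonal, then the differentials of `f x` at `x` depend smoothly
on `x`. -/
theorem contMDiff_mfderiv_diagonal {f : M → M → M'}
    (hf : ∀ x, ContMDiffAt (I.prod I) I' ∞ (Function.uncurry f) (x, x)) :
    ContMDiff I.tangent I'.tangent ∞ fun w : TangentBundle I M =>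
      (⟨f w.proj w.proj, mfderiv I I' (f w.proj) w.proj w.2⟩ : TangentBundle I' M') := by
  have : IsManifold I 1 M := IsManifold.of_le (n := ∞) (by simp)
  have : IsManifold I' 1 M' := IsManifold.of_le (n := ∞) (by simp)
  have : IsManifold I (∞ + 1) M := inferInstanceAs (IsManifold I ∞ M)
  have : IsManifold I' (∞ + 1) M' := inferInstanceAs (IsManifold I' ∞ M')
  intro x₀
  let b₁ : TangentBundle I M → M := fun p => p.1
  let v : ∀ y : TangentBundle I M, TangentSpace I (b₁ y) := fun y => y.2
  have hv : ContMDiffAt I.tangent I.tangent ∞ (fun y => (v y : TangentBundle I M)) x₀ :=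
    contMDiffAt_id
  let b₂ : TangentBundle I M → M' := fun y => f (b₁ y) (b₁ y)
  have hb₁ : ContMDiffAt I.tangent I ∞ b₁ x₀ := Bundle.contMDiff_proj (TangentSpace I) x₀
  have hb₂ : ContMDiffAt I.tangent I' ∞ b₂ x₀ :=
    ContMDiffAt.comp (g := Function.uncurry f) (f := fun y => (b₁ y, b₁ y)) x₀ (hf (b₁ x₀))
      (hb₁.prodMk hb₁)
  let ϕ : ∀ y : TangentBundle I M, TangentSpace I (b₁ y) →L[ℝ] TangentSpace I' (b₂ y) :=
    fun y => mfderiv I I' (f (b₁ y)) (b₁ y)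
  have hϕ : ContMDiffAt I.tangent 𝓘(ℝ, V →L[ℝ] V') ∞
      (fun y => ContinuousLinearMap.inCoordinates V (TangentSpace I (M := M)) V'
      (TangentSpace I' (M := M')) (b₁ x₀) (b₁ y) (b₂ x₀) (b₂ y) (ϕ y)) x₀ := by
    have A := ContMDiffAt.mfderiv (m := ∞) (n := ∞) f id (hf (b₁ x₀)) contMDiffAt_id (by simp)
    exact ContMDiffAt.comp x₀ A hb₁
  exact ContMDiffAt.clm_apply_of_inCoordinates hϕ hv hb₂

end Diagonal

/-! ### Local inverses of the covering homomorphism -/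

/-- `S` inverts the covering homomorphism `SU(1,1) → G` near the identity. -/
structure IsLocalInverse (G : StructureGroup) (S : G → SU11) : Prop where
  map_one : S 1 = 1
  smooth : ContMDiffAt 𝓘G 𝓘G ∞ S 1
  cover_apply : ∀ᶠ g in 𝓝 (1 : G), G.cover (S g) = g
  apply_cover : ∀ᶠ A in 𝓝 (1 : SU11), S (G.cover A) = A

theorem isLocalInverse_id : IsLocalInverse StructureGroup.specialUnitary id where
  map_one := rfl
  smooth := contMDiffAt_id
  cover_apply := Eventually.of_forall fun _ => rfl
  apply_cover := Eventually.of_forall fun _ => rfl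

namespace M0

/-- The lift of a Möbius transformation to the matrix whose entry `a` has an argument in
`(-π/2, π/2]`. It is smooth near the identity. -/
noncomputable def principalLift (f : M0) : SU11 := sec (root (coords f).1) (coords f).2

theorem toM0_principalLift (f : M0) : toM0 (principalLift f) = f := coords.left_inv f

theorem re_principalLift_a (f : M0) : 0 ≤ (principalLift f).a.re := by
  rw [principalLift, sec_a, Complex.re_mul_ofReal]
  refine mul_nonneg ?_ (Real.sqrt_nonneg _)
  rw [root, Circle.coe_exp, Complex.exp_ofReal_mul_I_re]
  have h := Complex.arg_mem_Ioc ((coords f).1 : ℂ)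
  exact Real.cos_nonneg_of_mem_Icc ⟨by linarith [h.1], by linarith [h.2]⟩

/-- The two lifts of a transformation differ by a sign, and the principal one has `re a ≥ 0`. -/
theorem principalLift_toM0 {A : SU11} (hA : 0 < A.a.re) : principalLift (toM0 A) = A := by
  obtain ⟨h1, h2⟩ := (toM0_eq_iff _ _).1 (toM0_principalLift (toM0 A))
  have ha : (principalLift (toM0 A)).a = A.a := by
    refine (sq_eq_sq_iff_eq_or_eq_neg.1 h1).resolve_right fun h => ?_
    have := re_principalLift_a (toM0 A)
    rw [h, Complex.neg_re] at this
    linarith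
  refine SU11.ext ha ?_
  rw [ha] at h2
  exact mul_left_cancel₀ A.a_ne_zero h2

theorem coords_one_fst : (coords 1).1 = 1 := by
  apply Circle.ext
  change sqA 1 / ((‖sqA 1‖ : ℝ) : ℂ) = 1
  have : sqA 1 = 1 := by
    rw [← map_one toM0, sqA_toM0]
    simp
  rw [this]
  simp

theorem contMDiffAt_principalLift : ContMDiffAt 𝓘G 𝓘G ∞ principalLift 1 := by
  have hc : ContMDiffAt 𝓘G 𝓘G ∞ coords 1 := transport_contMDiff 𝓘G ∞ coords 1
  have h1 : ContMDiffAt 𝓘G (𝓡 1) ∞ (fun f : M0 => (coords f).1) 1 := contMDiffAt_fst.comp 1 hc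
  have h2 : ContMDiffAt 𝓘G 𝓘(ℝ, ℂ) ∞ (fun f : M0 => (coords f).2) 1 := contMDiffAt_snd.comp 1 hc
  have h3 : ContMDiffAt 𝓘G (𝓡 1) ∞ (fun f : M0 => root (coords f).1) 1 := by
    have hs : ContDiffAt ℝ ∞ (fun z : ℂ => z.arg / 2) ((coords 1).1 : ℂ) := by
      refine (contDiffAt_arg ?_).div_const 2
      rw [coords_one_fst]
      exact Complex.one_mem_slitPlane
    exact contMDiff_circleExp.contMDiffAt.comp 1
      (ContMDiffAt.comp (f := fun f : M0 => ((coords f).1 : ℂ)) 1 hs.contMDiffAt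
        (contMDiff_circle_coe.contMDiffAt.comp 1 h1))
  have h4 : ContMDiffAt 𝓘G 𝓘(ℝ, ℂ) ∞
      (fun f : M0 => (coords f).2 * conj (root (coords f).1 : ℂ)) 1 := by
    have := h2.prodMk_space (contDiff_conj.contMDiff.contMDiffAt.comp 1
      (contMDiff_circle_coe.contMDiffAt.comp 1 h3))
    exact (contDiff_fst.mul contDiff_snd :
      ContDiff ℝ ∞ fun p : ℂ × ℂ => p.1 * p.2).contMDiff.contMDiffAt.comp 1 this
  exact (transport_contMDiff_symm 𝓘G ∞ SU11.coords).contMDiffAt.comp 1 (h3.prodMk h4)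

theorem isLocalInverse_principalLift : IsLocalInverse StructureGroup.mobius principalLift where
  map_one := by
    have := principalLift_toM0 (A := 1) (by simp)
    rwa [map_one] at this
  smooth := contMDiffAt_principalLift
  cover_apply := Eventually.of_forall toM0_principalLift
  apply_cover := by
    have h : Continuous fun A : SU11 => A.a.re := Complex.continuous_re.comp SU11.continuous_a
    filter_upwards [(isOpen_Ioi.preimage h).mem_nhds
        (show (1 : SU11) ∈ (fun A : SU11 => A.a.re) ⁻¹' Ioi 0 by simp)] with A hA
    exact principalLift_toM0 hA

end M0

/-! ### Differentials of complex functions on manifolds -/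

section

variable {V H M F F' : Type*} [NormedAddCommGroup V] [NormedSpace ℝ V] [TopologicalSpace H]
  [TopologicalSpace M] [ChartedSpace H M] {I : ModelWithCorners ℝ V H}
  [NormedAddCommGroup F] [NormedSpace ℝ F] [NormedAddCommGroup F'] [NormedSpace ℝ F']

theorem mfderiv_comp_hasFDerivAt {f : M → F} {x : M} {g : F → F'} {g' : F →L[ℝ] F'}
    (hg : HasFDerivAt g g' (f x)) (hf : MDifferentiableAt I 𝓘(ℝ, F) f x) (w : TangentSpace I x) :
    mfderiv I 𝓘(ℝ, F') (fun y => g (f y)) x w = g' (mfderiv I 𝓘(ℝ, F) f x w) := by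
  have h := (hg.hasMFDerivAt.comp x hf.hasMFDerivAt).mfderiv
  change mfderiv I 𝓘(ℝ, F') (g ∘ f) x w = _
  rw [h]
  rfl

/-- The chain rule for a real linear function of two complex functions. -/
theorem mfderiv_real_linear {f g : M → ℂ} {x : M} {f' g' : TangentSpace I x →L[ℝ] ℂ}
    (hf : HasMFDerivAt I 𝓘(ℝ, ℂ) f x f') (hg : HasMFDerivAt I 𝓘(ℝ, ℂ) g x g')
    (c₁ c₂ c₃ c₄ : ℂ) (w : TangentSpace I x) :
    mfderiv I 𝓘(ℝ, ℂ) (fun y => c₁ * f y + c₂ * conj (f y) + (c₃ * g y + c₄ * conj (g y))) x w =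
      c₁ * f' w + c₂ * conj (f' w) + (c₃ * g' w + c₄ * conj (g' w)) := by
  have hL : ∀ c d z : ℂ, HasFDerivAt (fun z => c * z + d * conj z)
      (c • ContinuousLinearMap.id ℝ ℂ + d • (Complex.conjCLE : ℂ →L[ℝ] ℂ)) z := fun c d z =>
    ((hasFDerivAt_id (𝕜 := ℝ) z).const_smul c).add
      ((Complex.conjCLE.hasFDerivAt (x := z)).const_smul d)
  have h1 := ((hL c₁ c₂ (f x)).hasMFDerivAt.comp x hf).add
    ((hL c₃ c₄ (g x)).hasMFDerivAt.comp x hg)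
  exact DFunLike.congr_fun h1.mfderiv w

theorem mfderiv_conj {f : M → ℂ} {x : M}
    (hf : MDifferentiableAt I 𝓘(ℝ, ℂ) f x) (w : TangentSpace I x) :
    mfderiv I 𝓘(ℝ, ℂ) (fun y => conj (f y)) x w =
      (starRingEnd ℂ) (mfderiv I 𝓘(ℝ, ℂ) f x w) :=
  mfderiv_comp_hasFDerivAt Complex.conjCLE.hasFDerivAt hf w

end

/-! ### The principal connection -/

namespace SU11

theorem conj_a (A X : SU11) : (A⁻¹ * X * A).a =
    conj A.a * A.a * X.a + (-A.b * conj A.b) * conj X.a +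
      (conj A.a * conj A.b * X.b + (-A.b * A.a) * conj X.b) := by
  simp only [mul_a, mul_b, inv_a, inv_b]
  ring

theorem conj_b (A X : SU11) : (A⁻¹ * X * A).b =
    conj A.a * A.b * X.a + (-A.b * conj A.a) * conj X.a +
      (conj A.a * conj A.a * X.b + (-A.b * A.b) * conj X.b) := by
  simp only [mul_a, mul_b, inv_a, inv_b]
  ring

/-- The tangent space of `SU(1,1)` at the identity: the entry `a` has an imaginary differential. -/
theorem re_mfderiv_a {V H M : Type*} [NormedAddCommGroup V] [NormedSpace ℝ V]
    [TopologicalSpace H] [TopologicalSpace M] [ChartedSpace H M] {I : ModelWithCorners ℝ V H}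
    {f : M → SU11} {x : M} (hf : MDifferentiableAt I 𝓘G f x) (hx : f x = 1)
    (w : TangentSpace I x) :
    Complex.re (mfderiv I 𝓘(ℝ, ℂ) (fun y => (f y).a) x w) = 0 := by
  have da : MDifferentiableAt I 𝓘(ℝ, ℂ) (fun y => (f y).a) x :=
    ((contMDiff_a (f x)).mdifferentiableAt (by simp)).comp x hf
  have db : MDifferentiableAt I 𝓘(ℝ, ℂ) (fun y => (f y).b) x :=
    ((contMDiff_b (f x)).mdifferentiableAt (by simp)).comp x hf
  have ga := mfderiv_comp_hasFDerivAt (f := fun y => (f y).a) (x := x)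
    (hasStrictFDerivAt_norm_sq (f x).a).hasFDerivAt da w
  have gb := mfderiv_comp_hasFDerivAt (f := fun y => (f y).b) (x := x)
    ((hasStrictFDerivAt_norm_sq (f x).b).hasFDerivAt.const_add 1) db w
  have hn : (fun y => ‖(f y).a‖ ^ 2) = fun y => 1 + ‖(f y).b‖ ^ 2 := funext fun y => (f y).norm_sq
  rw [hn] at ga
  have h := ga.symm.trans gb
  rw [hx] at h
  have key : ∀ α β : ℂ, (2 • innerSL ℝ (1 : ℂ)) α = (2 • innerSL ℝ (0 : ℂ)) β → α.re = 0 :=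
    fun α β h => by simpa using h
  exact key _ _ h

end SU11

section

variable {G : StructureGroup}

/-- For `p'` near `p`, the element of `SU(1,1)` near the identity by which the point to which `p'` is
transported in the fiber of `p`, to first order, differs from `p`. -/
noncomputable def discrepancy (ℓ : ℝ) (S : G → SU11) (p p' : Principal G) : SU11 :=
  S (p.2⁻¹ * G.cover (frameStep ℓ (p'.1 - p.1)) * p'.2)

variable {S : G → SU11} (ℓ : ℝ)

theorem contMDiff_discrepancy_arg : ContMDiff (𝓘P.prod 𝓘P) 𝓘G ∞
    fun x : Principal G × Principal G => x.1.2⁻¹ * G.cover (frameStep ℓ (x.2.1 - x.1.1)) * x.2.2 := by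
  have h1 : ContMDiff (𝓘P.prod 𝓘P) 𝓘P ∞ fun x : Principal G × Principal G => x.1 := contMDiff_fst
  have h2 : ContMDiff (𝓘P.prod 𝓘P) 𝓘P ∞ fun x : Principal G × Principal G => x.2 := contMDiff_snd
  have d : ContMDiff (𝓘P.prod 𝓘P) 𝓘(ℝ, ℂ) ∞ fun x : Principal G × Principal G => x.2.1 - x.1.1 :=
    (contMDiff_fst.comp h2).sub (contMDiff_fst.comp h1)
  exact ((contMDiff_snd.comp h1).inv.mul
    (G.cover_smooth.comp ((contMDiff_frameStep ℓ).comp d))).mul (contMDiff_snd.comp h2)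

theorem discrepancy_arg_self (p : Principal G) :
    p.2⁻¹ * G.cover (frameStep ℓ (p.1 - p.1)) * p.2 = 1 := by
  rw [sub_self, frameStep_zero, map_one, mul_one, inv_mul_cancel]

namespace IsLocalInverse

variable (hS : IsLocalInverse G S)
include hS

theorem discrepancy_self (p : Principal G) : discrepancy ℓ S p p = 1 := by
  rw [discrepancy, discrepancy_arg_self, hS.map_one]

theorem contMDiffAt_discrepancy (p : Principal G) :
    ContMDiffAt (𝓘P.prod 𝓘P) 𝓘G ∞ (Function.uncurry (discrepancy ℓ S)) (p, p) := by
  refine ContMDiffAt.comp (g := S) (p, p) ?_ (contMDiff_discrepancy_arg ℓ (p, p))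
  rw [discrepancy_arg_self]
  exact hS.smooth

theorem mdifferentiableAt_discrepancy (p : Principal G) :
    MDifferentiableAt 𝓘P 𝓘G (discrepancy ℓ S p) p := by
  have h : ContMDiffAt 𝓘P 𝓘G ∞ (discrepancy ℓ S p) p :=
    ContMDiffAt.comp (f := fun p' => (p, p')) p (hS.contMDiffAt_discrepancy ℓ p)
      (contMDiffAt_const.prodMk contMDiffAt_id)
  exact h.mdifferentiableAt (by simp)

theorem mdifferentiableAt_discrepancy_a (p : Principal G) :
    MDifferentiableAt 𝓘P 𝓘(ℝ, ℂ) (fun p' => (discrepancy ℓ S p p').a) p :=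
  ((SU11.contMDiff_a (discrepancy ℓ S p p)).mdifferentiableAt (by simp)).comp p
    (hS.mdifferentiableAt_discrepancy ℓ p)

theorem mdifferentiableAt_discrepancy_b (p : Principal G) :
    MDifferentiableAt 𝓘P 𝓘(ℝ, ℂ) (fun p' => (discrepancy ℓ S p p').b) p :=
  ((SU11.contMDiff_b (discrepancy ℓ S p p)).mdifferentiableAt (by simp)).comp p
    (hS.mdifferentiableAt_discrepancy ℓ p)

end IsLocalInverse

/-- The entry `a` of the connection form. -/
noncomputable def formA (S : G → SU11) (p : Principal G) : TangentSpace 𝓘P p →L[ℝ] ℂ :=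
  mfderiv 𝓘P 𝓘(ℝ, ℂ) (fun p' => (discrepancy ℓ S p p').a) p

/-- The entry `b` of the connection form. -/
noncomputable def formB (S : G → SU11) (p : Principal G) : TangentSpace 𝓘P p →L[ℝ] ℂ :=
  mfderiv 𝓘P 𝓘(ℝ, ℂ) (fun p' => (discrepancy ℓ S p p').b) p

/-- The connection form: the differential at `p` of the discrepancy from `p`. The real part of its
entry `a` vanishes (`SU11.re_mfderiv_a`); only the imaginary part is used here, so that the values lie
in `su(1,1)` by definition. -/
noncomputable def connectionForm (S : G → SU11) (p : Principal G) :
    TangentSpace 𝓘P p →ₗ[ℝ] su11 where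
  toFun w := ⟨!![(formA ℓ S p w).im * Complex.I, formB ℓ S p w;
    conj (formB ℓ S p w), -((formA ℓ S p w).im * Complex.I)], _, _, rfl⟩
  map_add' v w := by
    apply Subtype.ext
    ext i j
    fin_cases i <;> fin_cases j <;> simp <;> ring
  map_smul' r w := by
    apply Subtype.ext
    ext i j
    fin_cases i <;> fin_cases j <;> simp <;> ring

namespace IsLocalInverse

variable (hS : IsLocalInverse G S)
include hS

theorem coe_connectionForm (p : Principal G) (w : TangentSpace 𝓘P p) :
    (connectionForm ℓ S p w : Matrix (Fin 2) (Fin 2) ℂ) =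
      !![formA ℓ S p w, formB ℓ S p w; conj (formB ℓ S p w), conj (formA ℓ S p w)] := by
  have h : Complex.re (formA ℓ S p w) = 0 :=
    SU11.re_mfderiv_a (hS.mdifferentiableAt_discrepancy ℓ p) (hS.discrepancy_self ℓ p) w
  have h1 : ((formA ℓ S p w).im : ℂ) * Complex.I = formA ℓ S p w := by
    apply Complex.ext <;> simp [h]
  have h2 : conj (formA ℓ S p w) = -formA ℓ S p w := by
    apply Complex.ext <;> simp [h]
  change !![_, _; _, _] = _
  rw [h1, h2]

section

variable {V H N : Type*} [NormedAddCommGroup V] [NormedSpace ℝ V] [TopologicalSpace H]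
  [TopologicalSpace N] [ChartedSpace H N] {I : ModelWithCorners ℝ V H}
  {h : N → Principal G} {x : N} {p : Principal G} {f : N → SU11}

/-- The form on the image of a tangent vector under `h` is computed from any expression `f` for the
discrepancy along `h`. -/
theorem formA_mfderiv (hh : MDifferentiableAt I 𝓘P h x) (hx : h x = p)
    (hf : ∀ᶠ y in 𝓝 x, discrepancy ℓ S p (h y) = f y) (w : TangentSpace I x) :
    formA ℓ S p (mfderiv I 𝓘P h x w) = mfderiv I 𝓘(ℝ, ℂ) (fun y => (f y).a) x w := by
  subst hx
  have h2 : ((fun p' => (discrepancy ℓ S (h x) p').a) ∘ h) =ᶠ[𝓝 x] fun y => (f y).a :=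
    hf.mono fun y hy => congrArg SU11.a hy
  rw [← h2.mfderiv_eq, mfderiv_comp x (hS.mdifferentiableAt_discrepancy_a ℓ (h x)) hh]
  rfl

theorem formB_mfderiv (hh : MDifferentiableAt I 𝓘P h x) (hx : h x = p)
    (hf : ∀ᶠ y in 𝓝 x, discrepancy ℓ S p (h y) = f y) (w : TangentSpace I x) :
    formB ℓ S p (mfderiv I 𝓘P h x w) = mfderiv I 𝓘(ℝ, ℂ) (fun y => (f y).b) x w := by
  subst hx
  have h2 : ((fun p' => (discrepancy ℓ S (h x) p').b) ∘ h) =ᶠ[𝓝 x] fun y => (f y).b :=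
    hf.mono fun y hy => congrArg SU11.b hy
  rw [← h2.mfderiv_eq, mfderiv_comp x (hS.mdifferentiableAt_discrepancy_b ℓ (h x)) hh]
  rfl

end

end IsLocalInverse

end

section

variable {G : StructureGroup} {S : G → SU11} (ℓ : ℝ)

theorem tendsto_discrepancy_arg (p : Principal G) :
    Tendsto (fun p' : Principal G => p.2⁻¹ * G.cover (frameStep ℓ (p'.1 - p.1)) * p'.2)
      (𝓝 p) (𝓝 1) := by
  have h : Continuous fun p' : Principal G =>
      p.2⁻¹ * G.cover (frameStep ℓ (p'.1 - p.1)) * p'.2 :=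
    (contMDiff_discrepancy_arg (G := G) ℓ).continuous.comp
      (continuous_const.prodMk continuous_id : Continuous fun p' : Principal G => (p, p'))
  have h1 := h.tendsto p
  rwa [discrepancy_arg_self] at h1

namespace IsLocalInverse

variable (hS : IsLocalInverse G S)
include hS

theorem tendsto_one : Tendsto S (𝓝 1) (𝓝 1) := by
  have h := hS.smooth.continuousAt.tendsto
  rwa [hS.map_one] at h

theorem eventually_cover_discrepancy (p : Principal G) :
    ∀ᶠ p' in 𝓝 p, G.cover (discrepancy ℓ S p p') =
      p.2⁻¹ * G.cover (frameStep ℓ (p'.1 - p.1)) * p'.2 :=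
  (tendsto_discrepancy_arg ℓ p).eventually hS.cover_apply

/-- The discrepancy of the right translates by `A` is the conjugate by `A⁻¹`. -/
theorem eventually_discrepancy_translate (A : SU11) (p : Principal G) :
    ∀ᶠ p' : Principal G in 𝓝 p,
      discrepancy ℓ S (p.1, p.2 * G.cover A) (p'.1, p'.2 * G.cover A) =
        A⁻¹ * discrepancy ℓ S p p' * A := by
  have h1 : Tendsto (fun p' => A⁻¹ * discrepancy ℓ S p p' * A) (𝓝 p) (𝓝 1) := by
    have hc : Continuous fun X : SU11 => A⁻¹ * X * A :=
      ((contMDiff_mul_right (I := 𝓘G) (n := ∞) (a := A)).comp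
        (contMDiff_mul_left (I := 𝓘G) (n := ∞) (a := A⁻¹))).continuous
    have h2 := (hc.tendsto 1).comp (hS.tendsto_one.comp (tendsto_discrepancy_arg ℓ p))
    have h3 : A⁻¹ * 1 * A = 1 := by group
    rwa [h3] at h2
  filter_upwards [hS.eventually_cover_discrepancy ℓ p, h1.eventually hS.apply_cover] with p' h2 h3
  rw [map_mul, map_mul, h2] at h3
  rw [← h3, discrepancy]
  congr 1
  simp only [mul_inv_rev, map_inv, mul_assoc]

theorem contMDiff_formA : ContMDiff 𝓘P.tangent 𝓘(ℝ, ℂ) ∞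
    fun w : TangentBundle 𝓘P (Principal G) => formA ℓ S w.proj w.2 := by
  have h := contMDiff_mfderiv_diagonal (I := 𝓘P) (I' := 𝓘(ℝ, ℂ))
    (f := fun p p' : Principal G => (discrepancy ℓ S p p').a) fun p =>
      SU11.contMDiff_a.contMDiffAt.comp (p, p) (hS.contMDiffAt_discrepancy ℓ p)
  exact (contMDiff_snd_tangentBundle_modelSpace ℂ 𝓘(ℝ, ℂ)).comp h

theorem contMDiff_formB : ContMDiff 𝓘P.tangent 𝓘(ℝ, ℂ) ∞
    fun w : TangentBundle 𝓘P (Principal G) => formB ℓ S w.proj w.2 := by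
  have h := contMDiff_mfderiv_diagonal (I := 𝓘P) (I' := 𝓘(ℝ, ℂ))
    (f := fun p p' : Principal G => (discrepancy ℓ S p p').b) fun p =>
      SU11.contMDiff_b.contMDiffAt.comp (p, p) (hS.contMDiffAt_discrepancy ℓ p)
  exact (contMDiff_snd_tangentBundle_modelSpace ℂ 𝓘(ℝ, ℂ)).comp h

theorem contMDiff_connectionForm (i j : Fin 2) : ContMDiff 𝓘P.tangent 𝓘(ℝ, ℂ) ∞
    fun w : TangentBundle 𝓘P (Principal G) =>
      (connectionForm ℓ S w.proj w.2 : Matrix (Fin 2) (Fin 2) ℂ) i j := by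
  simp only [hS.coe_connectionForm ℓ]
  fin_cases i <;> fin_cases j
  · exact hS.contMDiff_formA ℓ
  · exact hS.contMDiff_formB ℓ
  · exact contDiff_conj.contMDiff.comp (hS.contMDiff_formB ℓ)
  · exact contDiff_conj.contMDiff.comp (hS.contMDiff_formA ℓ)

theorem connectionForm_vertical (q : ℂ) (g : G) (ξ : TangentSpace 𝓘G (1 : SU11)) (i j : Fin 2) :
    (connectionForm ℓ S (q, g)
      (mfderiv 𝓘G 𝓘P (fun A : SU11 => ((q, g * G.cover A) : Principal G)) 1 ξ) :
      Matrix (Fin 2) (Fin 2) ℂ) i j =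
    mfderiv 𝓘G 𝓘(ℝ, ℂ) (fun A : SU11 => A.1.1 i j) 1 ξ := by
  have hd : MDifferentiableAt 𝓘G 𝓘P (fun A : SU11 => ((q, g * G.cover A) : Principal G)) 1 := by
    have h : ContMDiff 𝓘G 𝓘P ∞ (fun A : SU11 => ((q, g * G.cover A) : Principal G)) :=
      contMDiff_const.prodMk (contMDiff_const.mul G.cover_smooth)
    exact (h 1).mdifferentiableAt (by simp)
  have h1 : ((q, g * G.cover 1) : Principal G) = (q, g) := by simp
  have he : ∀ᶠ A in 𝓝 (1 : SU11), discrepancy ℓ S (q, g) (q, g * G.cover A) = A := by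
    filter_upwards [hS.apply_cover] with A hA
    simpa [discrepancy, frameStep_zero] using hA
  have hA := hS.formA_mfderiv ℓ hd h1 he ξ
  have hB := hS.formB_mfderiv ℓ hd h1 he ξ
  have da := (SU11.contMDiff_a 1).mdifferentiableAt (by simp)
  have db := (SU11.contMDiff_b 1).mdifferentiableAt (by simp)
  have e10 : (fun A : SU11 => A.1.1 1 0) = fun A => conj A.b := by
    funext A; rw [SU11.coe_eq]; rfl
  have e11 : (fun A : SU11 => A.1.1 1 1) = fun A => conj A.a := by
    funext A; rw [SU11.coe_eq]; rfl
  refine (congrFun (congrFun (hS.coe_connectionForm ℓ (q, g) _) i) j).trans ?_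
  fin_cases i <;> fin_cases j
  · exact hA
  · exact hB
  · refine (congrArg (starRingEnd ℂ) hB).trans ((mfderiv_conj db ξ).symm.trans ?_)
    exact congrArg (fun f => mfderiv 𝓘G 𝓘(ℝ, ℂ) f 1 ξ) e10.symm
  · refine (congrArg (starRingEnd ℂ) hA).trans ((mfderiv_conj da ξ).symm.trans ?_)
    exact congrArg (fun f => mfderiv 𝓘G 𝓘(ℝ, ℂ) f 1 ξ) e11.symm

theorem connectionForm_equivariant (A : SU11) (p : Principal G) (w : TangentSpace 𝓘P p) :
    (connectionForm ℓ S (p.1, p.2 * G.cover A)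
      (mfderiv 𝓘P 𝓘P (fun p' : Principal G => ((p'.1, p'.2 * G.cover A) : Principal G)) p w) :
      Matrix (Fin 2) (Fin 2) ℂ) =
    (A⁻¹).1.1 * (connectionForm ℓ S p w : Matrix (Fin 2) (Fin 2) ℂ) * A.1.1 := by
  have hd : MDifferentiableAt 𝓘P 𝓘P
      (fun p' : Principal G => ((p'.1, p'.2 * G.cover A) : Principal G)) p := by
    have h : ContMDiff 𝓘P 𝓘P ∞
        (fun p' : Principal G => ((p'.1, p'.2 * G.cover A) : Principal G)) :=
      contMDiff_fst.prodMk (contMDiff_snd.mul contMDiff_const)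
    exact (h p).mdifferentiableAt (by simp)
  have he := hS.eventually_discrepancy_translate ℓ A p
  have hA := hS.formA_mfderiv ℓ hd rfl he w
  have hB := hS.formB_mfderiv ℓ hd rfl he w
  have da : HasMFDerivAt 𝓘P 𝓘(ℝ, ℂ) _ p (formA ℓ S p) :=
    (hS.mdifferentiableAt_discrepancy_a ℓ p).hasMFDerivAt
  have db : HasMFDerivAt 𝓘P 𝓘(ℝ, ℂ) _ p (formB ℓ S p) :=
    (hS.mdifferentiableAt_discrepancy_b ℓ p).hasMFDerivAt
  have ea : (fun p' => (A⁻¹ * discrepancy ℓ S p p' * A).a) = _ :=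
    funext fun p' => SU11.conj_a A (discrepancy ℓ S p p')
  have eb : (fun p' => (A⁻¹ * discrepancy ℓ S p p' * A).b) = _ :=
    funext fun p' => SU11.conj_b A (discrepancy ℓ S p p')
  have hA' := hA.trans ((congrArg (fun f => mfderiv 𝓘P 𝓘(ℝ, ℂ) f p w) ea).trans
    (mfderiv_real_linear da db _ _ _ _ w))
  have hB' := hB.trans ((congrArg (fun f => mfderiv 𝓘P 𝓘(ℝ, ℂ) f p w) eb).trans
    (mfderiv_real_linear da db _ _ _ _ w))
  refine (hS.coe_connectionForm ℓ (p.1, p.2 * G.cover A) _).trans ?_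
  rw [hA', hB', hS.coe_connectionForm ℓ, SU11.coe_eq A⁻¹, SU11.coe_eq A, SU11.inv_a, SU11.inv_b]
  generalize formA ℓ S p w = α
  generalize formB ℓ S p w = β
  ext i j
  fin_cases i <;> fin_cases j <;> simp <;> ring

/-- The principal connection of the planimeter. -/
noncomputable def principalConnection : PrincipalConnection G where
  form := connectionForm ℓ S
  smooth := hS.contMDiff_connectionForm ℓ
  vertical := hS.connectionForm_vertical ℓ
  equivariant := hS.connectionForm_equivariant ℓ

theorem localForm_principalConnection (q v : ℂ) :
    (hS.principalConnection ℓ).localForm q v =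
      (1 / (2 * ℓ : ℂ)) • !![0, v; conj v, 0] := by
  have hd : MDifferentiableAt 𝓘(ℝ, ℂ) 𝓘P (fun x : ℂ => ((x, 1) : Principal G)) q := by
    have h : ContMDiff 𝓘(ℝ, ℂ) 𝓘P ∞ (fun x : ℂ => ((x, 1) : Principal G)) :=
      contMDiff_id.prodMk contMDiff_const
    exact (h q).mdifferentiableAt (by simp)
  have he : ∀ᶠ x in 𝓝 q, discrepancy ℓ S (q, 1) (x, 1) = frameStep ℓ (x - q) := by
    have hc : Tendsto (fun x => frameStep ℓ (x - q)) (𝓝 q) (𝓝 1) := by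
      have h := ((contMDiff_frameStep ℓ).continuous.comp (continuous_sub_right q)).tendsto q
      simpa [Function.comp_def, frameStep_zero] using h
    filter_upwards [hc.eventually hS.apply_cover] with x hx
    simpa [discrepancy] using hx
  have hs : HasFDerivAt (fun x : ℂ => x - q) (ContinuousLinearMap.id ℝ ℂ) q :=
    (hasFDerivAt_id q).sub_const q
  have ha : HasFDerivAt (fun x => (frameStep ℓ (x - q)).a) (0 : ℂ →L[ℝ] ℂ) q := by
    have h0 := hasFDerivAt_frameStep_a ℓ
    rw [← sub_self q] at h0
    exact (HasFDerivAt.comp (g := fun v => (frameStep ℓ v).a) (f := fun x => x - q) q h0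
      hs).congr_fderiv (by simp)
  have hb : HasFDerivAt (fun x => (frameStep ℓ (x - q)).b)
      ((1 / (2 * ℓ) : ℂ) • ContinuousLinearMap.id ℝ ℂ) q := by
    have h0 := hasFDerivAt_frameStep_b ℓ
    rw [← sub_self q] at h0
    exact (HasFDerivAt.comp (g := fun v => (frameStep ℓ v).b) (f := fun x => x - q) q h0
      hs).congr_fderiv (by ext; simp)
  have hA := hS.formA_mfderiv ℓ hd rfl he v
  have hB := hS.formB_mfderiv ℓ hd rfl he v
  rw [mfderiv_eq_fderiv, ha.fderiv] at hA
  rw [mfderiv_eq_fderiv, hb.fderiv] at hB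
  refine (hS.coe_connectionForm ℓ _ _).trans ?_
  rw [hA, hB]
  change !![(0 : ℂ), (1 / (2 * ℓ) : ℂ) * v; conj ((1 / (2 * ℓ) : ℂ) * v), conj (0 : ℂ)] = _
  ext i j
  fin_cases i <;> fin_cases j <;> simp [map_ofNat]

theorem localCurvature_principalConnection (q v w : ℂ) :
    (hS.principalConnection ℓ).localCurvature q v w =
      (-(1 / (ℓ : ℂ) ^ 2) * ((v.re * w.im - v.im * w.re : ℝ) : ℂ)) •
        !![Complex.I / 2, 0; 0, -(Complex.I / 2)] := by
  -- the local form is constant, so that the curvature is the commutator term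
  have h1 : v * conj w - w * conj v = -2 * ((v.re * w.im - v.im * w.re : ℝ) : ℂ) * Complex.I := by
    apply Complex.ext <;> simp <;> ring
  rw [PrincipalConnection.localCurvature]
  simp only [hS.localForm_principalConnection ℓ, fderiv_fun_const]
  generalize ((v.re * w.im - v.im * w.re : ℝ) : ℂ) = D at h1
  ext i j
  fin_cases i <;> fin_cases j <;> simp
  · linear_combination ((ℓ : ℂ)⁻¹ * 2⁻¹) ^ 2 * h1
  · linear_combination -((ℓ : ℂ)⁻¹ * 2⁻¹) ^ 2 * h1

end IsLocalInverse

end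

/-! ### The connection on the configuration space -/

/-- The transport to first order of a configuration `e'` to the fiber through `e`. -/
noncomputable def fiberShift (ℓ : ℝ) (e e' : Config) : Config :=
  (e.1, frameStep ℓ (e'.1 - e.1) • e'.2)

section

variable (ℓ : ℝ)

theorem fiberShift_vertical (e : Config) (u : Circle) : fiberShift ℓ e (e.1, u) = (e.1, u) := by
  simp [fiberShift, frameStep_zero]

theorem fiberShift_self (e : Config) : fiberShift ℓ e e = e := fiberShift_vertical ℓ e e.2

theorem fiberShift_fiberShift (e : Config) : fiberShift ℓ e ∘ fiberShift ℓ e = fiberShift ℓ e :=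
  funext fun _ => fiberShift_vertical ℓ e _

theorem contMDiff_fiberShift :
    ContMDiff (𝓘E.prod 𝓘E) 𝓘E ∞ (Function.uncurry (fiberShift ℓ)) := by
  have h1 : ContMDiff (𝓘E.prod 𝓘E) 𝓘E ∞ fun x : Config × Config => x.1 := contMDiff_fst
  have h2 : ContMDiff (𝓘E.prod 𝓘E) 𝓘E ∞ fun x : Config × Config => x.2 := contMDiff_snd
  have d : ContMDiff (𝓘E.prod 𝓘E) 𝓘(ℝ, ℂ) ∞ fun x : Config × Config => x.2.1 - x.1.1 :=
    (contMDiff_fst.comp h2).sub (contMDiff_fst.comp h1)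
  have hB : ContMDiff (𝓘E.prod 𝓘E) (𝓡 1) ∞
      fun x : Config × Config => frameStep ℓ (x.2.1 - x.1.1) • x.2.2 :=
    SU11.contMDiff_smul ((contMDiff_frameStep ℓ).comp d) (contMDiff_snd.comp h2)
  have hC : ContMDiff (𝓘E.prod 𝓘E) 𝓘(ℝ, ℂ) ∞ fun x : Config × Config => x.1.1 :=
    contMDiff_fst.comp h1
  exact hC.prodMk hB

theorem mdifferentiableAt_fiberShift (e e' : Config) :
    MDifferentiableAt 𝓘E 𝓘E (fiberShift ℓ e) e' := by
  have h : ContMDiff 𝓘E 𝓘E ∞ (fiberShift ℓ e) :=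
    (contMDiff_fiberShift ℓ).comp (contMDiff_const.prodMk contMDiff_id)
  exact (h e').mdifferentiableAt (by simp)

/-- The projection of the tangent space at `e` onto the vertical vectors: the differential of
`fiberShift ℓ e`, which is idempotent and fixes the fiber through `e`. -/
noncomputable def fiberForm (e : Config) : TangentSpace 𝓘E e →L[ℝ] TangentSpace 𝓘E e :=
  mfderiv 𝓘E 𝓘E (fiberShift ℓ e) e

theorem fiberForm_mfderiv {V H N : Type*} [NormedAddCommGroup V] [NormedSpace ℝ V]
    [TopologicalSpace H] [TopologicalSpace N] [ChartedSpace H N] {I : ModelWithCorners ℝ V H}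
    {h : N → Config} {x : N} (hh : MDifferentiableAt I 𝓘E h x) (w : TangentSpace I x) :
    fiberForm ℓ (h x) (mfderiv I 𝓘E h x w) =
      mfderiv I 𝓘E (fun y => fiberShift ℓ (h x) (h y)) x w :=
  (mfderiv_comp_apply x (mdifferentiableAt_fiberShift ℓ (h x) (h x)) hh w).symm

theorem fiberForm_fiberForm (e : Config) (w : TangentSpace 𝓘E e) :
    fiberForm ℓ e (fiberForm ℓ e w) = fiberForm ℓ e w := by
  have h := mfderiv_comp_apply_of_eq e (mdifferentiableAt_fiberShift ℓ e e)
    (mdifferentiableAt_fiberShift ℓ e e) (fiberShift_self ℓ e) w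
  rw [fiberShift_fiberShift] at h
  exact h.symm

theorem fiberForm_of_fst_eq_zero (e : Config) (w : TangentSpace 𝓘E e)
    (hw : mfderiv 𝓘E 𝓘(ℝ, ℂ) (Prod.fst : Config → ℂ) e w = 0) : fiberForm ℓ e w = w := by
  obtain ⟨q, v⟩ := e
  have hi := (hasMFDerivAt_const (I := 𝓡 1) (I' := 𝓘(ℝ, ℂ)) q v).prodMk
    (hasMFDerivAt_id (I := 𝓡 1) v)
  rw [mfderiv_fst] at hw
  have h1 : mfderiv (𝓡 1) 𝓘E (fun u : Circle => ((q, u) : Config)) v w.2 = w :=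
    (DFunLike.congr_fun hi.mfderiv w.2).trans (Prod.ext hw.symm rfl)
  have h2 := fiberForm_mfderiv ℓ (h := fun u : Circle => ((q, u) : Config)) (x := v)
    hi.mdifferentiableAt w.2
  have h3 : (fun u : Circle => fiberShift ℓ (q, v) (q, u)) = fun u => (q, u) :=
    funext fun u => fiberShift_vertical ℓ (q, v) u
  rw [h3] at h2
  exact (congrArg (fiberForm ℓ (q, v)) h1).symm.trans (h2.trans h1)

theorem mfderiv_fst_fiberForm (e : Config) (w : TangentSpace 𝓘E e) :
    mfderiv 𝓘E 𝓘(ℝ, ℂ) (Prod.fst : Config → ℂ) e (fiberForm ℓ e w) = 0 := by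
  have h := mfderiv_comp_apply_of_eq e (mdifferentiableAt_fst (I := 𝓘(ℝ, ℂ)) (I' := 𝓡 1) (x := e))
    (mdifferentiableAt_fiberShift ℓ e e) (fiberShift_self ℓ e) w
  have h1 : (Prod.fst : Config → ℂ) ∘ fiberShift ℓ e = fun _ => e.1 := rfl
  rw [h1, mfderiv_const] at h
  exact h.symm

/-- The connection of the planimeter. -/
noncomputable def bundleConnection : BundleConnection where
  form := fiberForm ℓ
  smooth := by
    have h := contMDiff_mfderiv_diagonal (I := 𝓘E) (I' := 𝓘E) (f := fiberShift ℓ)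
      fun x => contMDiff_fiberShift ℓ (x, x)
    have key : ∀ x y : Config, x = y → ∀ v : ℂ × EuclideanSpace ℝ (Fin 1),
        (⟨x, v⟩ : TangentBundle 𝓘E Config) = ⟨y, v⟩ := by
      rintro x _ rfl v
      rfl
    exact h.congr fun w => key _ _ (fiberShift_self ℓ w.proj).symm _
  idempotent := fiberForm_fiberForm ℓ
  range_eq e := by
    ext w
    constructor
    · rintro ⟨v, rfl⟩
      exact mfderiv_fst_fiberForm ℓ e v
    · intro hw
      exact ⟨w, fiberForm_of_fst_eq_zero ℓ e w hw⟩

theorem mem_horizontal_bundleConnection (e : Config) (w : TangentSpace 𝓘E e) :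
    w ∈ (bundleConnection ℓ).horizontal e ↔ fiberForm ℓ e w = 0 := Iff.rfl

/-! ### Motions of the planimeter -/

/-- The velocity of the curve `(γ, u)`, moved to the fiber over `γ t`: it vanishes when `u` solves the
Riccati equation. -/
theorem hasDerivAt_frameStep_smul {γ : ℝ → ℂ} {u : ℝ → Circle} {t : ℝ} {γ' u' : ℂ}
    (hγ : HasDerivAt γ γ' t) (hu : HasDerivAt (fun s => (u s : ℂ)) u' t) :
    HasDerivAt (fun s => ((frameStep ℓ (γ s - γ t) • u s : Circle) : ℂ))
      (u' + 1 / (2 * ℓ) * (γ' - conj γ' * u t ^ 2)) t := by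
  have hs : HasDerivAt (fun s => γ s - γ t) γ' t := hγ.sub_const _
  have ha : HasDerivAt (fun s => (frameStep ℓ (γ s - γ t)).a) 0 t := by
    have h0 := hasFDerivAt_frameStep_a ℓ
    rw [← sub_self (γ t)] at h0
    exact HasFDerivAt.comp_hasDerivAt (l := fun v => (frameStep ℓ v).a) t h0 hs
  have hb : HasDerivAt (fun s => (frameStep ℓ (γ s - γ t)).b) (1 / (2 * ℓ) * γ') t := by
    have h0 := hasFDerivAt_frameStep_b ℓ
    rw [← sub_self (γ t)] at h0
    exact HasFDerivAt.comp_hasDerivAt (l := fun v => (frameStep ℓ v).b) t h0 hs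
  have ha' : HasDerivAt (fun s => conj (frameStep ℓ (γ s - γ t)).a) (conj 0) t := ha.star
  have hb' : HasDerivAt (fun s => conj (frameStep ℓ (γ s - γ t)).b)
    (conj (1 / (2 * ℓ) * γ')) t := hb.star
  have h := ((ha.mul hu).add hb).div ((hb'.mul hu).add ha') (SU11.denom_ne_zero _ _)
  refine h.congr_deriv ?_
  simp [frameStep_zero, map_ofNat]
  ring

theorem mfderiv_eq_zero_iff_circle {f : ℝ → Circle} {t : ℝ}
    (hf : MDifferentiableAt 𝓘(ℝ, ℝ) (𝓡 1) f t) :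
    mfderiv 𝓘(ℝ, ℝ) (𝓡 1) f t (1 : ℝ) = 0 ↔ deriv (fun s => (f s : ℂ)) t = 0 := by
  have hc : MDifferentiableAt (𝓡 1) 𝓘(ℝ, ℂ) (fun z : Circle => (z : ℂ)) (f t) :=
    (contMDiff_circle_coe (f t)).mdifferentiableAt (by simp)
  have h : deriv (fun s => (f s : ℂ)) t =
      mfderiv (𝓡 1) 𝓘(ℝ, ℂ) (fun z : Circle => (z : ℂ)) (f t)
        (mfderiv 𝓘(ℝ, ℝ) (𝓡 1) f t (1 : ℝ)) := by
    have h1 := mfderiv_comp_apply t hc hf (1 : ℝ)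
    rw [mfderiv_eq_fderiv] at h1
    exact fderiv_apply_one_eq_deriv.symm.trans h1
  constructor
  · intro h0
    rw [h, h0]
    exact (mfderiv (𝓡 1) 𝓘(ℝ, ℂ) (fun z : Circle => (z : ℂ)) (f t)).map_zero
  · intro h0
    -- the phase `z ↦ z / |z|` retracts a neighborhood of the circle onto the circle
    have hr := (contMDiffAt_exp_arg (f t).coe_ne_zero).mdifferentiableAt (by simp)
    have h1 := mfderiv_comp_apply t (f := fun s => (f s : ℂ)) hr (hc.comp t hf) (1 : ℝ)
    have h2 : (fun z : ℂ => Circle.exp z.arg) ∘ (fun s => (f s : ℂ)) = f :=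
      funext fun s => Circle.exp_arg (f s)
    rw [h2, mfderiv_eq_fderiv] at h1
    refine h1.trans ((congrArg _ (fderiv_apply_one_eq_deriv.trans h0)).trans ?_)
    exact (mfderiv 𝓘(ℝ, ℂ) (𝓡 1) (fun z : ℂ => Circle.exp z.arg) (f t)).map_zero

section

variable {c : ℝ → Config} {t : ℝ} (hc : MDifferentiableAt 𝓘(ℝ, ℝ) 𝓘E c t)
include hc

theorem hasDerivAt_fst_of_mdifferentiableAt :
    HasDerivAt (fun s => (c s).1) (deriv (fun s => (c s).1) t) t :=
  (mdifferentiableAt_iff_differentiableAt.1 (hc.fst)).hasDerivAt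

theorem hasDerivAt_coe_snd_of_mdifferentiableAt :
    HasDerivAt (fun s => ((c s).2 : ℂ)) (deriv (fun s => ((c s).2 : ℂ)) t) t := by
  have h : MDifferentiableAt 𝓘(ℝ, ℝ) 𝓘(ℝ, ℂ) (fun s => ((c s).2 : ℂ)) t :=
    ((contMDiff_circle_coe (c t).2).mdifferentiableAt (by simp)).comp t hc.snd
  exact (mdifferentiableAt_iff_differentiableAt.1 h).hasDerivAt

/-- The Riccati equation of the horizontal curves. -/
theorem mfderiv_mem_horizontal_iff :
    mfderiv 𝓘(ℝ, ℝ) 𝓘E c t (1 : ℝ) ∈ (bundleConnection ℓ).horizontal (c t) ↔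
      deriv (fun s => ((c s).2 : ℂ)) t = 1 / (2 * ℓ) *
        (conj (deriv (fun s => (c s).1) t) * (c t).2 ^ 2 - deriv (fun s => (c s).1) t) := by
  have hd := hasDerivAt_frameStep_smul ℓ (hasDerivAt_fst_of_mdifferentiableAt hc)
    (hasDerivAt_coe_snd_of_mdifferentiableAt hc)
  have hm : MDifferentiableAt 𝓘(ℝ, ℝ) 𝓘E (fun s => fiberShift ℓ (c t) (c s)) t :=
    (mdifferentiableAt_fiberShift ℓ (c t) (c t)).comp t hc
  have hp := (hasMFDerivAt_const (I := 𝓘(ℝ, ℝ)) (I' := 𝓘(ℝ, ℂ)) (c t).1 t).prodMk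
    hm.snd.hasMFDerivAt
  have h1 := (fiberForm_mfderiv ℓ hc (1 : ℝ)).trans (DFunLike.congr_fun hp.mfderiv (1 : ℝ))
  rw [mem_horizontal_bundleConnection, h1]
  have h2 : ∀ x : EuclideanSpace ℝ (Fin 1),
      ((0, x) : ℂ × EuclideanSpace ℝ (Fin 1)) = 0 ↔ x = 0 := fun x => by simp
  refine (h2 _).trans ((mfderiv_eq_zero_iff_circle hm.snd).trans ?_)
  rw [show deriv (fun s => ((fiberShift ℓ (c t) (c s)).2 : ℂ)) t = _ from hd.deriv]
  constructor <;> intro h <;> linear_combination h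

/-- The condition on the velocity of the chisel edge is the Riccati equation. -/
theorem inner_normal_eq_zero_iff (hℓ : 0 < ℓ) :
    inner ℝ (normal (c t)) (deriv (fun s => chisel ℓ (c s)) t) = 0 ↔
      deriv (fun s => ((c s).2 : ℂ)) t = 1 / (2 * ℓ) *
        (conj (deriv (fun s => (c s).1) t) * (c t).2 ^ 2 - deriv (fun s => (c s).1) t) := by
  have hγ := hasDerivAt_fst_of_mdifferentiableAt hc
  have hu := hasDerivAt_coe_snd_of_mdifferentiableAt hc
  have hd : deriv (fun s => chisel ℓ (c s)) t = _ := (hγ.add (hu.const_mul (ℓ : ℂ))).deriv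
  rw [hd]
  have huc : (fun s => ((c s).2 : ℂ) * conj ((c s).2 : ℂ)) = fun _ => 1 :=
    funext fun s => SU11.circle_mul_conj _
  have h1 := (hu.mul (hu.star : HasDerivAt (fun s => conj ((c s).2 : ℂ)) _ t)).deriv
  have h1' : deriv (fun s => ((c s).2 : ℂ) * conj ((c s).2 : ℂ)) t = _ := h1
  rw [huc, deriv_const] at h1'
  have h2 := SU11.circle_mul_conj (c t).2
  have hℓ' : (ℓ : ℂ) ≠ 0 := by exact_mod_cast hℓ.ne'
  rw [normal]
  rw [Complex.star_def] at h1'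
  clear hd h1 huc hu hγ
  generalize deriv (fun s => ((c s).2 : ℂ)) t = u' at *
  generalize deriv (fun s => (c s).1) t = γ' at *
  generalize ((c t).2 : ℂ) = u at *
  have hX : ∀ X : ℂ, X.re = 0 ↔ X + conj X = 0 := fun X => by
    rw [Complex.add_conj]
    norm_cast
    simp
  have hin : inner ℝ (-Complex.I * u) (γ' + ℓ * u') =
      (conj (-Complex.I * u) * (γ' + ℓ * u')).re := by
    rw [Complex.inner, mul_comm]
  rw [hin, hX]
  simp only [map_mul, map_neg, map_add, Complex.conj_I, Complex.conj_ofReal, Complex.conj_conj,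
    neg_neg]
  constructor
  · intro h
    have h3 : conj u * (γ' + ℓ * u') - u * (conj γ' + ℓ * conj u') = 0 := by
      linear_combination (-Complex.I) * h +
        (conj u * (γ' + ℓ * u') - u * (conj γ' + ℓ * conj u')) * Complex.I_mul_I
    field_simp
    linear_combination u * h3 - (γ' + 2 * ℓ * u') * h2 - ℓ * u * h1'
  · intro h
    have h3 : 2 * ℓ * u' - conj γ' * u ^ 2 + γ' = 0 := by
      rw [h]
      field_simp
      ring
    linear_combination Complex.I * (conj u * (h3 + (γ' + 2 * ℓ * u') * h2 + ℓ * u * h1') -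
      (conj u * (γ' + ℓ * u') - u * (conj γ' + ℓ * conj u')) * h2)

end

end

theorem isPlanimeterMotion_iff {ℓ : ℝ} (hℓ : 0 < ℓ) (c : ℝ → Config) :
    IsPlanimeterMotion ℓ c ↔ IsHorizontal 𝓘E (bundleConnection ℓ).horizontal c := by
  refine and_congr_right fun _ => forall_congr' fun t => forall_congr' fun _ =>
    forall_congr' fun hc => ?_
  rw [mfderiv_mem_horizontal_iff ℓ hc, inner_normal_eq_zero_iff ℓ hc hℓ]

/-! ### The associated bundle -/

section

variable {G : StructureGroup} {S : G → SU11} (ℓ : ℝ)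

namespace IsLocalInverse

variable (hS : IsLocalInverse G S)
include hS

/-- The action of the structure group on the circle is smooth. -/
theorem contMDiff_group_smul {V H M : Type*} [NormedAddCommGroup V] [NormedSpace ℝ V]
    [TopologicalSpace H] {I : ModelWithCorners ℝ V H} [TopologicalSpace M] [ChartedSpace H M]
    [IsManifold I ∞ M] {f : M → G} {g : M → Circle} (hf : ContMDiff I 𝓘G ∞ f)
    (hg : ContMDiff I (𝓡 1) ∞ g) : ContMDiff I (𝓡 1) ∞ fun x => f x • g x := by
  have hsm : ContMDiff (𝓘G.prod (𝓡 1)) (𝓡 1) ∞ fun x : SU11 × Circle => x.1 • x.2 :=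
    SU11.contMDiff_smul contMDiff_fst contMDiff_snd
  intro x
  -- near `x`, the action of `f y` is that of `f x`, preceded by that of an element of `SU(1,1)`
  obtain ⟨A, hA⟩ := G.cover_surjective (f x)
  have h1 : ContMDiffAt I 𝓘G ∞ (fun y => (f x)⁻¹ * f y) x := contMDiffAt_const.mul (hf x)
  have h2 : ContMDiffAt I 𝓘G ∞ (fun y => S ((f x)⁻¹ * f y)) x := by
    refine ContMDiffAt.comp (g := S) x ?_ h1
    rw [inv_mul_cancel]
    exact hS.smooth
  have h3 : ContMDiffAt I 𝓘G ∞ (fun y => A * S ((f x)⁻¹ * f y)) x := contMDiffAt_const.mul h2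
  have h4 := ContMDiffAt.comp (g := fun z : SU11 × Circle => z.1 • z.2) x
    (hsm.contMDiffAt) (h3.prodMk (hg x))
  refine h4.congr_of_eventuallyEq ?_
  have ht : Tendsto (fun y => (f x)⁻¹ * f y) (𝓝 x) (𝓝 1) := by
    have := h1.continuousAt.tendsto
    rwa [inv_mul_cancel] at this
  filter_upwards [ht.eventually hS.cover_apply] with y hy
  change f y • g y = (A * S ((f x)⁻¹ * f y)) • g y
  rw [← G.cover_smul, map_mul, hy, hA, mul_inv_cancel_left]

end IsLocalInverse

/-- The map `[(q, A), u] ↦ (q, A u)`, as a bijection. -/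
noncomputable def associatedEquiv (G : StructureGroup) : AssociatedBundle G ≃ Config where
  toFun := Quotient.lift (fun x : Principal G × Circle => ((x.1.1, x.1.2 • x.2) : Config)) (by
    rintro x _ ⟨g, rfl⟩
    simp [mul_smul])
  invFun e := AssociatedBundle.mk (e.1, 1) e.2
  left_inv x := by
    induction x using Quotient.inductionOn with
    | h x =>
      refine Quotient.sound ⟨x.1.2, ?_⟩
      simp
  right_inv e := by
    change (e.1, (1 : G) • e.2) = e
    rw [one_smul]

namespace IsLocalInverse

variable (hS : IsLocalInverse G S)
include hS

theorem contMDiff_associatedEquiv_mk : ContMDiff (𝓘P.prod (𝓡 1)) 𝓘E ∞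
    fun x : Principal G × Circle => associatedEquiv G (AssociatedBundle.mk x.1 x.2) := by
  have h1 : ContMDiff (𝓘P.prod (𝓡 1)) 𝓘P ∞ fun x : Principal G × Circle => x.1 := contMDiff_fst
  have hA : ContMDiff (𝓘P.prod (𝓡 1)) (𝓡 1) ∞ fun x : Principal G × Circle => x.1.2 • x.2 :=
    hS.contMDiff_group_smul (contMDiff_snd.comp h1) contMDiff_snd
  have hC : ContMDiff (𝓘P.prod (𝓡 1)) 𝓘(ℝ, ℂ) ∞ fun x : Principal G × Circle => x.1.1 :=
    contMDiff_fst.comp h1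
  exact hC.prodMk hA

/-- The isomorphism of the associated bundle with the configuration space. -/
noncomputable def associatedHomeomorph : AssociatedBundle G ≃ₜ Config where
  toEquiv := associatedEquiv G
  continuous_toFun := continuous_quot_lift _ hS.contMDiff_associatedEquiv_mk.continuous
  continuous_invFun := by
    refine continuous_quot_mk.comp (?_ : Continuous fun e : Config =>
      (((e.1, 1), e.2) : Principal G × Circle))
    fun_prop

theorem associatedHomeomorph_mk (p : Principal G) (u : Circle) :
    hS.associatedHomeomorph (AssociatedBundle.mk p u) = (p.1, p.2 • u) := rfl

theorem isBundleIso_associatedHomeomorph :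
    AssociatedBundle.IsBundleIso hS.associatedHomeomorph where
  fst_apply x := by
    induction x using Quotient.inductionOn with
    | h x => rfl
  smooth := hS.contMDiff_associatedEquiv_mk
  submersion := by
    rintro ⟨⟨q, g⟩, u⟩ w
    -- the section `(x, v) ↦ ((x, g), g⁻¹ v)`
    have hs : ContMDiff 𝓘E (𝓘P.prod (𝓡 1)) ∞
        fun e : Config => (((e.1, g), g⁻¹ • e.2) : Principal G × Circle) :=
      (contMDiff_fst.prodMk contMDiff_const).prodMk
        (hS.contMDiff_group_smul contMDiff_const contMDiff_snd)
    have h1 := mfderiv_comp_apply_of_eq (x := ((q, g • u) : Config)) (y := ((q, g), u))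
      ((hS.contMDiff_associatedEquiv_mk ((q, g), u)).mdifferentiableAt (by simp))
      ((hs (q, g • u)).mdifferentiableAt (by simp)) (by simp) w
    have h2 : (fun x : Principal G × Circle => associatedEquiv G (AssociatedBundle.mk x.1 x.2)) ∘
        (fun e : Config => (((e.1, g), g⁻¹ • e.2) : Principal G × Circle)) = id := by
      funext e
      change (e.1, g • g⁻¹ • e.2) = e
      rw [smul_inv_smul]
    rw [h2, mfderiv_id] at h1
    exact ⟨_, h1.symm⟩

section

variable (u : Circle)

theorem mdifferentiableAt_orbit (p : Principal G) :
    MDifferentiableAt 𝓘P 𝓘E (fun p' : Principal G => ((p'.1, p'.2 • u) : Config)) p := by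
  have h : ContMDiff 𝓘P 𝓘E ∞ (fun p' : Principal G => ((p'.1, p'.2 • u) : Config)) :=
    contMDiff_fst.prodMk (hS.contMDiff_group_smul contMDiff_snd contMDiff_const)
  exact (h p).mdifferentiableAt (by simp)

theorem connectionForm_eq_zero_iff (p : Principal G) (w : TangentSpace 𝓘P p) :
    connectionForm ℓ S p w = 0 ↔ formA ℓ S p w = 0 ∧ formB ℓ S p w = 0 := by
  rw [← Subtype.coe_inj, hS.coe_connectionForm ℓ p w]
  constructor
  · intro h
    exact ⟨congrFun (congrFun h 0) 0, congrFun (congrFun h 0) 1⟩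
  · rintro ⟨h1, h2⟩
    rw [h1, h2]
    ext i j
    fin_cases i <;> fin_cases j <;> simp

/-- The images of horizontal vectors are horizontal. -/
theorem fiberForm_orbit (p : Principal G) {w : TangentSpace 𝓘P p}
    (hw : connectionForm ℓ S p w = 0) :
    fiberForm ℓ (p.1, p.2 • u)
      (mfderiv 𝓘P 𝓘E (fun p' : Principal G => ((p'.1, p'.2 • u) : Config)) p w) = 0 := by
  obtain ⟨hA, hB⟩ := (hS.connectionForm_eq_zero_iff ℓ p w).1 hw
  have h0 := SU11.mfderiv_eq_zero_of_entries (hS.mdifferentiableAt_discrepancy ℓ p) hA hB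
  have h1 := fiberForm_mfderiv ℓ (hS.mdifferentiableAt_orbit u p) w
  have hK : ContMDiff 𝓘G 𝓘E ∞ fun A : SU11 => ((p.1, p.2 • A • u) : Config) :=
    contMDiff_const.prodMk (hS.contMDiff_group_smul contMDiff_const
      (SU11.contMDiff_smul contMDiff_id contMDiff_const))
  have he : (fun p' : Principal G => fiberShift ℓ (p.1, p.2 • u) (p'.1, p'.2 • u)) =ᶠ[𝓝 p]
      (fun A : SU11 => ((p.1, p.2 • A • u) : Config)) ∘ discrepancy ℓ S p := by
    filter_upwards [hS.eventually_cover_discrepancy ℓ p] with p' hp'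
    refine Prod.ext rfl ?_
    change frameStep ℓ (p'.1 - p.1) • p'.2 • u = p.2 • discrepancy ℓ S p p' • u
    rw [← G.cover_smul, ← G.cover_smul, hp', ← mul_smul, ← mul_smul]
    congr 1
    group
  refine h1.trans ?_
  rw [he.mfderiv_eq, mfderiv_comp p ((hK _).mdifferentiableAt (by simp))
    (hS.mdifferentiableAt_discrepancy ℓ p)]
  exact (congrArg _ h0).trans
    (mfderiv 𝓘G 𝓘E (fun A : SU11 => ((p.1, p.2 • A • u) : Config)) _).map_zero

/-- The horizontal subspaces on the configuration space are the images of those on the principal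
bundle. A horizontal vector is the image of the horizontal lift of its projection to the plane, as
the difference is both vertical and horizontal. -/
theorem induces_bundleConnection :
    (hS.principalConnection ℓ).Induces hS.associatedHomeomorph (bundleConnection ℓ) := by
  intro p u
  ext w
  constructor
  · intro hw
    change TangentSpace 𝓘E ((p.1, p.2 • u) : Config) at w
    change fiberForm ℓ (p.1, p.2 • u) w = 0 at hw
    -- the horizontal lift of the projection of `w` to the plane
    have hl : ContMDiff 𝓘(ℝ, ℂ) 𝓘P ∞
        fun x : ℂ => ((x, (G.cover (frameStep ℓ (x - p.1)))⁻¹ * p.2) : Principal G) := by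
      have hd : ContMDiff 𝓘(ℝ, ℂ) 𝓘(ℝ, ℂ) ∞ fun x : ℂ => x - p.1 :=
        contMDiff_id.sub contMDiff_const
      exact contMDiff_id.prodMk
        ((G.cover_smooth.comp ((contMDiff_frameStep ℓ).comp hd)).inv.mul contMDiff_const)
    have hl' := (hl p.1).mdifferentiableAt (n := ∞) (by simp)
    have hlp : ((p.1, (G.cover (frameStep ℓ (p.1 - p.1)))⁻¹ * p.2) : Principal G) = p := by
      simp [frameStep_zero]
    have he : ∀ᶠ x in 𝓝 p.1,
        discrepancy ℓ S p (x, (G.cover (frameStep ℓ (x - p.1)))⁻¹ * p.2) = 1 := by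
      refine Eventually.of_forall fun x => ?_
      rw [discrepancy, ← hS.map_one]
      congr 1
      group
    have hA := hS.formA_mfderiv ℓ hl' hlp he w.1
    have hB := hS.formB_mfderiv ℓ hl' hlp he w.1
    rw [mfderiv_const] at hA hB
    have h1 := mfderiv_comp_apply_of_eq p.1
      (mdifferentiableAt_fst (I := 𝓘(ℝ, ℂ)) (I' := 𝓘G) (x := p)) hl' hlp w.1
    rw [show Prod.fst ∘ (fun x : ℂ => ((x, (G.cover (frameStep ℓ (x - p.1)))⁻¹ * p.2) :
      Principal G)) = id from rfl, mfderiv_id] at h1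
    generalize hv : mfderiv 𝓘(ℝ, ℂ) 𝓘P
      (fun x : ℂ => ((x, (G.cover (frameStep ℓ (x - p.1)))⁻¹ * p.2) : Principal G)) p.1 w.1 = v
      at hA hB h1
    have hv0 : connectionForm ℓ S p v = 0 := (hS.connectionForm_eq_zero_iff ℓ p v).2 ⟨hA, hB⟩
    have h2 := hS.fiberForm_orbit ℓ u p hv0
    have h3 := mfderiv_comp_apply p (mdifferentiableAt_fst (I := 𝓘(ℝ, ℂ)) (I' := 𝓡 1)
      (x := ((p.1, p.2 • u) : Config))) (hS.mdifferentiableAt_orbit u p) v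
    refine ⟨v, hv0, ?_⟩
    change mfderiv 𝓘P 𝓘E (fun p' : Principal G => ((p'.1, p'.2 • u) : Config)) p v = w
    generalize mfderiv 𝓘P 𝓘E (fun p' : Principal G => ((p'.1, p'.2 • u) : Config)) p v = w₂ at *
    have h4 : mfderiv 𝓘E 𝓘(ℝ, ℂ) (Prod.fst : Config → ℂ) (p.1, p.2 • u) (w - w₂) = 0 := by
      have h5 : mfderiv 𝓘E 𝓘(ℝ, ℂ) (Prod.fst : Config → ℂ) (p.1, p.2 • u) w = w.1 := by
        rw [mfderiv_fst]
        rfl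
      refine (ContinuousLinearMap.map_sub _ _ _).trans ?_
      rw [h5]
      exact sub_eq_zero.2 (h1.trans h3)
    have h6 := fiberForm_of_fst_eq_zero ℓ _ _ h4
    have h7 := (ContinuousLinearMap.map_sub (fiberForm ℓ (p.1, p.2 • u)) w w₂).symm.trans h6
    rw [hw, h2, sub_zero] at h7
    exact (sub_eq_zero.1 h7.symm).symm
  · rintro ⟨v, hv, rfl⟩
    exact hS.fiberForm_orbit ℓ u p hv

end

end IsLocalInverse

end

/-! ### Partitions -/

section Partition

variable {s : ℕ → ℝ}

/-- Curves that fit together at the points of a partition can be glued. -/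
theorem exists_glue {M : Type*} (hs : Monotone s) (f : ℕ → ℝ → M)
    (h : ∀ i, f i (s (i + 1)) = f (i + 1) (s (i + 1))) (n : ℕ) :
    ∃ g : ℝ → M, ∀ i ≤ n, EqOn g (f i) (Icc (s i) (s (i + 1))) := by
  induction n with
  | zero =>
    refine ⟨f 0, fun i hi => ?_⟩
    rw [Nat.le_zero.1 hi]
    exact fun _ _ => rfl
  | succ n ih =>
    obtain ⟨g, hg⟩ := ih
    refine ⟨fun t => if t ≤ s (n + 1) then g t else f (n + 1) t, fun i hi t ht => ?_⟩
    rcases Nat.lt_or_ge n i with hni | hni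
    · have hi' : i = n + 1 := by omega
      subst hi'
      dsimp only
      split_ifs with htn
      · have : t = s (n + 1) := le_antisymm htn ht.1
        rw [this, hg n le_rfl ⟨hs (Nat.le_succ n), le_rfl⟩, h]
      · rfl
    · have : t ≤ s (n + 1) := ht.2.trans (hs (by omega))
      dsimp only
      rw [if_pos this]
      exact hg i hni ht

theorem continuousOn_of_partition {X : Type*} [TopologicalSpace X] {f : ℝ → X} (hs : Monotone s)
    {n : ℕ} (hf : ∀ i < n, ContinuousOn f (Icc (s i) (s (i + 1)))) :
    ContinuousOn f (Icc (s 0) (s n)) := by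
  induction n with
  | zero => simp
  | succ n ih =>
    rw [← Icc_union_Icc_eq_Icc (hs (Nat.zero_le n)) (hs (Nat.le_succ n))]
    exact (ih fun i hi => hf i (by omega)).union_of_isClosed (hf n (by omega)) isClosed_Icc
      isClosed_Icc

theorem exists_mem_Ico_of_partition {n : ℕ} {t : ℝ} (h0 : s 0 ≤ t) (hn : t < s n) :
    ∃ i < n, t ∈ Ico (s i) (s (i + 1)) := by
  induction n with
  | zero => exact absurd hn (not_lt.2 h0)
  | succ n ih =>
    rcases lt_or_ge t (s n) with h | h
    · obtain ⟨i, hi, ht⟩ := ih h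
      exact ⟨i, by omega, ht⟩
    · exact ⟨n, by omega, h, hn⟩

end Partition

theorem IsPiecewiseC1.continuousOn {V H M : Type*} [NormedAddCommGroup V] [NormedSpace ℝ V]
    [TopologicalSpace H] [TopologicalSpace M] [ChartedSpace H M] {I : ModelWithCorners ℝ V H}
    {c : ℝ → M} (hc : IsPiecewiseC1 I c) : ContinuousOn c (Icc 0 1) := by
  obtain ⟨n, s, hs, h0, h1, h⟩ := hc
  have := continuousOn_of_partition hs fun i hi => (h i hi).continuousOn
  rwa [h0, h1] at this

theorem IsPiecewiseC1.exists_countable {V H M : Type*} [NormedAddCommGroup V] [NormedSpace ℝ V]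
    [TopologicalSpace H] [TopologicalSpace M] [ChartedSpace H M] {I : ModelWithCorners ℝ V H}
    {c : ℝ → M} (hc : IsPiecewiseC1 I c) : ∃ Z : Set ℝ, Z.Countable ∧
      ∀ t ∈ Ioo (0 : ℝ) 1, t ∉ Z → MDifferentiableAt 𝓘(ℝ, ℝ) I c t := by
  obtain ⟨n, s, hs, h0, h1, h⟩ := hc
  refine ⟨range s, countable_range s, fun t ht htZ => ?_⟩
  obtain ⟨i, hi, hti⟩ := exists_mem_Ico_of_partition (h0.trans_le ht.1.le) (ht.2.trans_eq h1.symm)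
  have hlt : s i < t := lt_of_le_of_ne hti.1 fun h => htZ ⟨i, h⟩
  exact ((h i hi).contMDiffAt (Icc_mem_nhds hlt hti.2)).mdifferentiableAt (by simp)

/-! ### Horizontal curves of frames -/

/-- On `J`, the curve `γ` is continuously differentiable, and the matrices `A t` solve the equation
`A' = -ω(γ') A` of the parallel frames along `γ`, which is written for the entries of `A`. -/
structure IsFrameOn (ℓ : ℝ) (γ : ℝ → ℂ) (A : ℝ → SU11) (J : Set ℝ) : Prop where
  contDiffOn : ContDiffOn ℝ 1 γ J
  deriv_a : ∀ t ∈ J, HasDerivWithinAt (fun s => (A s).a)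
    (-(1 / (2 * ℓ)) * derivWithin γ J t * conj (A t).b) J t
  deriv_b : ∀ t ∈ J, HasDerivWithinAt (fun s => (A s).b)
    (-(1 / (2 * ℓ)) * derivWithin γ J t * conj (A t).a) J t

/-- The matrices `A t`, for `t ∈ [0, 1]`, form a parallel frame along the piecewise `C¹`
curve `γ`. -/
def IsFrame (ℓ : ℝ) (γ : ℝ → ℂ) (A : ℝ → SU11) : Prop :=
  ∃ (n : ℕ) (s : ℕ → ℝ), Monotone s ∧ s 0 = 0 ∧ s n = 1 ∧
    ∀ i < n, IsFrameOn ℓ γ A (Icc (s i) (s (i + 1)))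

section

variable {ℓ : ℝ} {γ : ℝ → ℂ} {A : ℝ → SU11} {J : Set ℝ}

namespace IsFrameOn

theorem mul_right (h : IsFrameOn ℓ γ A J) (B : SU11) : IsFrameOn ℓ γ (fun t => A t * B) J where
  contDiffOn := h.contDiffOn
  deriv_a t ht := by
    simp only [SU11.mul_a, SU11.mul_b]
    refine (((h.deriv_a t ht).mul_const B.a).add
      ((h.deriv_b t ht).mul_const (conj B.b))).congr_deriv ?_
    simp only [map_add, map_mul, Complex.conj_conj]
    ring
  deriv_b t ht := by
    simp only [SU11.mul_a, SU11.mul_b]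
    refine (((h.deriv_a t ht).mul_const B.b).add
      ((h.deriv_b t ht).mul_const (conj B.a))).congr_deriv ?_
    simp only [map_add, map_mul, Complex.conj_conj]
    ring

theorem congr (h : IsFrameOn ℓ γ A J) {γ' : ℝ → ℂ} {A' : ℝ → SU11} (hγ : EqOn γ' γ J)
    (hA : EqOn A' A J) : IsFrameOn ℓ γ' A' J where
  contDiffOn := h.contDiffOn.congr hγ
  deriv_a t ht := by
    rw [derivWithin_congr hγ (hγ ht), hA ht]
    exact (h.deriv_a t ht).congr (fun s hs => congrArg SU11.a (hA hs))
      (congrArg SU11.a (hA ht))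
  deriv_b t ht := by
    rw [derivWithin_congr hγ (hγ ht), hA ht]
    exact (h.deriv_b t ht).congr (fun s hs => congrArg SU11.b (hA hs))
      (congrArg SU11.b (hA ht))

theorem contMDiffOn {x y : ℝ} (h : IsFrameOn ℓ γ A (Icc x y)) :
    ContMDiffOn 𝓘(ℝ, ℝ) 𝓘G 1 A (Icc x y) := by
  have hab : ContDiffOn ℝ 1 (fun s => (A s).a) (Icc x y) ∧
      ContDiffOn ℝ 1 (fun s => (A s).b) (Icc x y) := by
    rcases lt_or_ge x y with hxy | hxy
    · have hu := uniqueDiffOn_Icc hxy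
      have hγ := h.contDiffOn.continuousOn_derivWithin hu le_rfl
      have ha : ContinuousOn (fun s => (A s).a) (Icc x y) := fun t ht =>
        (h.deriv_a t ht).continuousWithinAt
      have hb : ContinuousOn (fun s => (A s).b) (Icc x y) := fun t ht =>
        (h.deriv_b t ht).continuousWithinAt
      have key : ∀ f f' : ℝ → ℂ, (∀ t ∈ Icc x y, HasDerivWithinAt f (f' t) (Icc x y) t) →
          ContinuousOn f' (Icc x y) → ContDiffOn ℝ 1 f (Icc x y) := by
        intro f f' hf hf'
        have h1 := (contDiffOn_succ_iff_derivWithin (n := 0) (f := f) hu).2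
          ⟨fun t ht => (hf t ht).differentiableWithinAt, by simp, by
            rw [contDiffOn_zero]
            exact hf'.congr fun t ht => (hf t ht).derivWithin (hu t ht)⟩
        simpa using h1
      exact ⟨key _ _ h.deriv_a ((continuousOn_const.mul hγ).mul
          (Complex.continuous_conj.comp_continuousOn hb)),
        key _ _ h.deriv_b ((continuousOn_const.mul hγ).mul
          (Complex.continuous_conj.comp_continuousOn ha))⟩
    · have key : ∀ f : ℝ → ℂ, ContDiffOn ℝ 1 f (Icc x y) := by
        intro f t ht
        rw [(subsingleton_Icc_of_ge hxy).eq_singleton_of_mem ht]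
        exact contDiffWithinAt_singleton
      exact ⟨key _, key _⟩
  exact fun t ht => SU11.contMDiffWithinAt_of_entries (by simp)
    (hab.1 t ht).contMDiffWithinAt (hab.2 t ht).contMDiffWithinAt

end IsFrameOn

namespace IsFrame

theorem mul_right (h : IsFrame ℓ γ A) (B : SU11) : IsFrame ℓ γ (fun t => A t * B) := by
  obtain ⟨n, s, hs, h0, h1, h⟩ := h
  exact ⟨n, s, hs, h0, h1, fun i hi => (h i hi).mul_right B⟩

theorem isPiecewiseC1_curve (h : IsFrame ℓ γ A) : IsPiecewiseC1 𝓘(ℝ, ℂ) γ := by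
  obtain ⟨n, s, hs, h0, h1, h⟩ := h
  exact ⟨n, s, hs, h0, h1, fun i hi => (h i hi).contDiffOn.contMDiffOn⟩

theorem isPiecewiseC1 (h : IsFrame ℓ γ A) : IsPiecewiseC1 𝓘G A := by
  obtain ⟨n, s, hs, h0, h1, h⟩ := h
  exact ⟨n, s, hs, h0, h1, fun i hi => (h i hi).contMDiffOn⟩

/-- The equation of a parallel frame holds at each point of `(0, 1)`, at least on one side. -/
theorem exists_isFrameOn (h : IsFrame ℓ γ A) {t : ℝ} (ht : t ∈ Ioo (0 : ℝ) 1) :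
    ∃ x y, t ∈ Ico x y ∧ IsFrameOn ℓ γ A (Icc x y) := by
  obtain ⟨n, s, hs, h0, h1, h⟩ := h
  obtain ⟨i, hi, hti⟩ := exists_mem_Ico_of_partition (h0.trans_le ht.1.le) (ht.2.trans_eq h1.symm)
  exact ⟨_, _, hti, h i hi⟩

theorem exists_countable (h : IsFrame ℓ γ A) : ∃ Z : Set ℝ, Z.Countable ∧
    ∀ t ∈ Ioo (0 : ℝ) 1, t ∉ Z →
      HasDerivAt (fun s => (A s).a) (-(1 / (2 * ℓ)) * deriv γ t * conj (A t).b) t ∧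
      HasDerivAt (fun s => (A s).b) (-(1 / (2 * ℓ)) * deriv γ t * conj (A t).a) t := by
  obtain ⟨n, s, hs, h0, h1, h⟩ := h
  refine ⟨range s, countable_range s, fun t ht htZ => ?_⟩
  obtain ⟨i, hi, hti⟩ := exists_mem_Ico_of_partition (h0.trans_le ht.1.le) (ht.2.trans_eq h1.symm)
  have hlt : s i < t := lt_of_le_of_ne hti.1 fun h => htZ ⟨i, h⟩
  have hn := Icc_mem_nhds hlt hti.2
  have ha := ((h i hi).deriv_a t ⟨hti.1, hti.2.le⟩).hasDerivAt hn
  have hb := ((h i hi).deriv_b t ⟨hti.1, hti.2.le⟩).hasDerivAt hn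
  rw [derivWithin_of_mem_nhds hn] at ha hb
  exact ⟨ha, hb⟩

end IsFrame

/-! ### Horizontal lifts -/

/-- The image of a point of the circle under a parallel frame solves the Riccati equation. -/
theorem hasDerivWithinAt_smul {t : ℝ} {g : ℂ} (u : Circle)
    (ha : HasDerivWithinAt (fun s => (A s).a) (-(1 / (2 * ℓ)) * g * conj (A t).b) J t)
    (hb : HasDerivWithinAt (fun s => (A s).b) (-(1 / (2 * ℓ)) * g * conj (A t).a) J t) :
    HasDerivWithinAt (fun s => ((A s • u : Circle) : ℂ))
      (1 / (2 * ℓ) * (conj g * (A t • u : Circle) ^ 2 - g)) J t := by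
  have ha' : HasDerivWithinAt (fun s => conj (A s).a) _ J t := ha.star
  have hb' : HasDerivWithinAt (fun s => conj (A s).b) _ J t := hb.star
  have h := ((ha.mul_const (u : ℂ)).add hb).div ((hb'.mul_const (u : ℂ)).add ha')
    ((A t).denom_ne_zero u)
  refine h.congr_deriv ?_
  have hd := (A t).denom_ne_zero u
  rw [SU11.coe_smul]
  simp only [Pi.add_apply, Complex.star_def, map_mul, map_neg, map_div₀, map_one, map_ofNat,
    Complex.conj_ofReal, Complex.conj_conj]
  generalize hD : conj (A t).b * (u : ℂ) + conj (A t).a = D at hd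
  generalize hN : (A t).a * (u : ℂ) + (A t).b = N
  have e1 : -(1 / (2 * (ℓ : ℂ))) * g * conj (A t).b * u + -(1 / (2 * ℓ)) * g * conj (A t).a =
      -(1 / (2 * ℓ)) * g * D := by rw [← hD]; ring
  have e2 : -(1 / (2 * (ℓ : ℂ))) * conj g * (A t).a * u + -(1 / (2 * ℓ)) * conj g * (A t).b =
      -(1 / (2 * ℓ)) * conj g * N := by rw [← hN]; ring
  rw [e1, e2]
  field_simp
  ring

theorem IsFrame.isHorizontal_config (h : IsFrame ℓ γ A) (u : Circle) :
    IsHorizontal 𝓘E (bundleConnection ℓ).horizontal fun t => ((γ t, A t • u) : Config) := by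
  refine ⟨?_, fun t ht hc => ?_⟩
  · obtain ⟨n, s, hs, h0, h1, h⟩ := h
    have hsm : ContMDiff 𝓘G (𝓡 1) 1 fun A : SU11 => A • u :=
      (SU11.contMDiff_smul contMDiff_id contMDiff_const).of_le (by simp)
    exact ⟨n, s, hs, h0, h1, fun i hi => (h i hi).contDiffOn.contMDiffOn.prodMk
      (hsm.comp_contMDiffOn (h i hi).contMDiffOn)⟩
  · obtain ⟨x, y, hxy, hf⟩ := h.exists_isFrameOn ht
    have htJ : t ∈ Icc x y := ⟨hxy.1, hxy.2.le⟩
    have hu := uniqueDiffOn_Icc (hxy.1.trans_lt hxy.2) t htJ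
    rw [mfderiv_mem_horizontal_iff ℓ hc]
    have hγ : DifferentiableAt ℝ γ t := (hasDerivAt_fst_of_mdifferentiableAt hc).differentiableAt
    have hd := hasDerivWithinAt_smul u (hf.deriv_a t htJ) (hf.deriv_b t htJ)
    rw [hγ.derivWithin hu] at hd
    exact hu.eq_deriv _ (hasDerivAt_coe_snd_of_mdifferentiableAt hc).hasDerivWithinAt hd

theorem IsFrame.isHorizontalLift_config (h : IsFrame ℓ γ A) (u : Circle) :
    IsHorizontalLift 𝓘E (bundleConnection ℓ).horizontal Prod.fst γ (γ 0, A 0 • u)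
      fun t => ((γ t, A t • u) : Config) :=
  ⟨h.isHorizontal_config u, fun _ _ => rfl, rfl⟩

/-- The horizontal lifts to the configuration space are given by the parallel frames: the inverse
of a parallel frame takes a horizontal lift to a constant. -/
theorem IsFrame.eq_smul_of_isHorizontalLift (h : IsFrame ℓ γ A) (hA : A 0 = 1) {e : Config}
    {c : ℝ → Config}
    (hc : IsHorizontalLift 𝓘E (bundleConnection ℓ).horizontal Prod.fst γ e c) {t : ℝ}
    (ht : t ∈ Icc (0 : ℝ) 1) : c t = (γ t, A t • e.2) := by
  obtain ⟨⟨hp, hh⟩, hπ, h0⟩ := hc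
  obtain ⟨Z, hZ, hZd⟩ := hp.exists_countable
  obtain ⟨Z', hZ', hZd'⟩ := h.exists_countable
  have hcont : ContinuousOn (fun s => (((A s)⁻¹ • (c s).2 : Circle) : ℂ)) (Icc 0 t) := by
    have hs : Continuous fun x : SU11 × Circle => ((x.1⁻¹ • x.2 : Circle) : ℂ) := by
      have h1 : ContMDiff (𝓘G.prod (𝓡 1)) (𝓡 1) ∞ fun x : SU11 × Circle => x.1⁻¹ • x.2 :=
        SU11.contMDiff_smul contMDiff_fst.inv contMDiff_snd
      exact continuous_subtype_val.comp h1.continuous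
    exact (hs.comp_continuousOn (h.isPiecewiseC1.continuousOn.prodMk
      (continuous_snd.comp_continuousOn hp.continuousOn))).mono (Icc_subset_Icc_right ht.2)
  have hderiv : ∀ s ∈ Ioo 0 t \ (Z ∪ Z'),
      HasDerivAt (fun s => (((A s)⁻¹ • (c s).2 : Circle) : ℂ)) 0 s := by
    rintro s ⟨hs, hsZ⟩
    have hs1 : s ∈ Ioo (0 : ℝ) 1 := ⟨hs.1, hs.2.trans_le ht.2⟩
    have hcd := hZd s hs1 fun h => hsZ (Or.inl h)
    obtain ⟨ha, hb⟩ := hZd' s hs1 fun h => hsZ (Or.inr h)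
    have hu := hasDerivAt_coe_snd_of_mdifferentiableAt hcd
    rw [(mfderiv_mem_horizontal_iff ℓ hcd).1 (hh s hs1 hcd)] at hu
    have hγ : deriv (fun s => (c s).1) s = deriv γ s := by
      apply Filter.EventuallyEq.deriv_eq
      filter_upwards [Ioo_mem_nhds hs1.1 hs1.2] with r hr
      exact hπ r ⟨hr.1.le, hr.2.le⟩
    rw [hγ] at hu
    have ha' : HasDerivAt (fun s => conj (A s).a) _ s := ha.star
    have hb' : HasDerivAt (fun s => conj (A s).b) _ s := hb.star
    have hd := ((A s)⁻¹).denom_ne_zero (c s).2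
    simp only [SU11.coe_smul, SU11.inv_a, SU11.inv_b, map_neg, Complex.conj_conj] at hd ⊢
    refine (((ha'.mul hu).add hb.neg).div ((hb'.neg.mul hu).add ha) hd).congr_deriv ?_
    rw [div_eq_zero_iff]
    left
    simp only [Pi.add_apply, Pi.mul_apply, Pi.neg_apply, Complex.star_def, map_mul, map_neg,
      map_div₀, map_one, map_ofNat, Complex.conj_ofReal, Complex.conj_conj]
    ring
  have hint := MeasureTheory.integral_eq_of_hasDerivAt_off_countable_of_le _ (fun _ => (0 : ℂ))
    ht.1 (hZ.union hZ') hcont hderiv intervalIntegrable_const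
  rw [intervalIntegral.integral_zero] at hint
  have h2 : (A t)⁻¹ • (c t).2 = (A 0)⁻¹ • (c 0).2 := Circle.ext (sub_eq_zero.1 hint.symm)
  rw [hA, h0, inv_one, one_smul, inv_smul_eq_iff] at h2
  exact Prod.ext (hπ t ht) h2

end

section

variable {ℓ : ℝ} {γ : ℝ → ℂ} {A : ℝ → SU11} {J : Set ℝ} {t : ℝ}

/-- To first order, a parallel frame is constant when it is moved to the fiber over `γ t`. -/
theorem hasDerivWithinAt_frameStep_mul (hγ : HasDerivWithinAt γ (derivWithin γ J t) J t)
    (ha : HasDerivWithinAt (fun s => (A s).a)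
      (-(1 / (2 * ℓ)) * derivWithin γ J t * conj (A t).b) J t)
    (hb : HasDerivWithinAt (fun s => (A s).b)
      (-(1 / (2 * ℓ)) * derivWithin γ J t * conj (A t).a) J t) (B : SU11) :
    HasDerivWithinAt (fun s => (B * frameStep ℓ (γ s - γ t) * A s).a) 0 J t ∧
      HasDerivWithinAt (fun s => (B * frameStep ℓ (γ s - γ t) * A s).b) 0 J t := by
  have h0 : γ t - γ t = 0 := sub_self _
  have hd := hγ.sub_const (γ t)
  have hFa : HasDerivWithinAt (fun s => (frameStep ℓ (γ s - γ t)).a) 0 J t := by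
    have h := hasFDerivAt_frameStep_a ℓ
    rw [← h0] at h
    exact h.comp_hasDerivWithinAt t hd
  have hFb : HasDerivWithinAt (fun s => (frameStep ℓ (γ s - γ t)).b)
      (1 / (2 * ℓ) * derivWithin γ J t) J t := by
    have h := hasFDerivAt_frameStep_b ℓ
    rw [← h0] at h
    exact h.comp_hasDerivWithinAt t hd
  have ha' : HasDerivWithinAt (fun s => conj (A s).a) _ J t := ha.star
  have hb' : HasDerivWithinAt (fun s => conj (A s).b) _ J t := hb.star
  have hVa : HasDerivWithinAt (fun s => (frameStep ℓ (γ s - γ t) * A s).a) 0 J t := by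
    simp only [SU11.mul_a]
    refine ((hFa.mul ha).add (hFb.mul hb')).congr_deriv ?_
    rw [h0, frameStep_zero, SU11.one_a, SU11.one_b]
    ring
  have hVb : HasDerivWithinAt (fun s => (frameStep ℓ (γ s - γ t) * A s).b) 0 J t := by
    simp only [SU11.mul_b]
    refine ((hFa.mul hb).add (hFb.mul ha')).congr_deriv ?_
    rw [h0, frameStep_zero, SU11.one_a, SU11.one_b]
    ring
  have hVa' : HasDerivWithinAt (fun s => conj (frameStep ℓ (γ s - γ t) * A s).a) _ J t := hVa.star
  have hVb' : HasDerivWithinAt (fun s => conj (frameStep ℓ (γ s - γ t) * A s).b) _ J t := hVb.star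
  simp only [mul_assoc B]
  constructor
  · simp only [SU11.mul_a B]
    refine ((hVa.const_mul B.a).add (hVb'.const_mul B.b)).congr_deriv ?_
    simp
  · simp only [SU11.mul_b B]
    refine ((hVb.const_mul B.a).add (hVa'.const_mul B.b)).congr_deriv ?_
    simp

variable {G : StructureGroup} {S : G → SU11}

/-- A parallel frame is a horizontal curve in the principal bundle. -/
theorem IsFrame.isHorizontal_principal (h : IsFrame ℓ γ A) (hS : IsLocalInverse G S) :
    IsHorizontal 𝓘P (hS.principalConnection ℓ).horizontal
      fun t => ((γ t, G.cover (A t)) : Principal G) := by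
  refine ⟨?_, fun t ht hc => ?_⟩
  · obtain ⟨n, s, hs, h0, h1, h⟩ := h
    exact ⟨n, s, hs, h0, h1, fun i hi => (h i hi).contDiffOn.contMDiffOn.prodMk
      ((G.cover_smooth.of_le (by simp)).comp_contMDiffOn (h i hi).contMDiffOn)⟩
  · obtain ⟨x, y, hxy, hf⟩ := h.exists_isFrameOn ht
    have htJ : t ∈ Icc x y := ⟨hxy.1, hxy.2.le⟩
    have hu := uniqueDiffOn_Icc (hxy.1.trans_lt hxy.2) t htJ
    have hγ : DifferentiableAt ℝ γ t := mdifferentiableAt_iff_differentiableAt.1 hc.fst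
    obtain ⟨hUa, hUb⟩ := hasDerivWithinAt_frameStep_mul
      hγ.differentiableWithinAt.hasDerivWithinAt (hf.deriv_a t htJ) (hf.deriv_b t htJ) (A t)⁻¹
    have hev : ∀ᶠ s in 𝓝[Icc x y] t, discrepancy ℓ S ((γ t, G.cover (A t)) : Principal G)
        (γ s, G.cover (A s)) = (A t)⁻¹ * frameStep ℓ (γ s - γ t) * A s := by
      have hcont : ContinuousWithinAt (fun s => (A t)⁻¹ * frameStep ℓ (γ s - γ t) * A s)
          (Icc x y) t := by
        have h2 : ContinuousWithinAt (fun s => frameStep ℓ (γ s - γ t)) (Icc x y) t :=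
          ((contMDiff_frameStep ℓ).continuous.continuousAt).comp_continuousWithinAt
            (hγ.continuousAt.continuousWithinAt.sub continuousWithinAt_const)
        exact (continuousWithinAt_const.mul h2).mul (hf.contMDiffOn.continuousOn t htJ)
      have h3 := hcont.tendsto
      rw [sub_self, frameStep_zero, mul_one, inv_mul_cancel] at h3
      filter_upwards [h3.eventually hS.apply_cover] with s hs
      rw [← hs, discrepancy, map_mul, map_mul, map_inv]
    have hda : MDifferentiableAt 𝓘(ℝ, ℝ) 𝓘(ℝ, ℂ) (fun s => (discrepancy ℓ S
        ((γ t, G.cover (A t)) : Principal G) (γ s, G.cover (A s))).a) t :=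
      (hS.mdifferentiableAt_discrepancy_a ℓ (γ t, G.cover (A t))).comp t hc
    have hdb : MDifferentiableAt 𝓘(ℝ, ℝ) 𝓘(ℝ, ℂ) (fun s => (discrepancy ℓ S
        ((γ t, G.cover (A t)) : Principal G) (γ s, G.cover (A s))).b) t :=
      (hS.mdifferentiableAt_discrepancy_b ℓ (γ t, G.cover (A t))).comp t hc
    refine (hS.connectionForm_eq_zero_iff ℓ _ _).2 ⟨?_, ?_⟩
    · refine (hS.formA_mfderiv ℓ hc rfl (Eventually.of_forall fun _ => rfl) (1 : ℝ)).trans ?_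
      have hd := (mdifferentiableAt_iff_differentiableAt.1 hda).hasDerivAt
      rw [mfderiv_eq_fderiv]
      refine hu.eq_deriv _ hd.hasDerivWithinAt (hUa.congr_of_eventuallyEq_of_mem ?_ htJ)
      exact hev.mono fun s hs => congrArg SU11.a hs
    · refine (hS.formB_mfderiv ℓ hc rfl (Eventually.of_forall fun _ => rfl) (1 : ℝ)).trans ?_
      have hd := (mdifferentiableAt_iff_differentiableAt.1 hdb).hasDerivAt
      rw [mfderiv_eq_fderiv]
      refine hu.eq_deriv _ hd.hasDerivWithinAt (hUb.congr_of_eventuallyEq_of_mem ?_ htJ)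
      exact hev.mono fun s hs => congrArg SU11.b hs

end

/-! ### Linear differential equations -/

section LinearODE

variable {E : Type*} [NormedAddCommGroup E] [NormedSpace ℝ E] [CompleteSpace E]

/-- The solutions of a linear differential equation exist on intervals of length at most
`1 / (2 (K + 1))`, where `K` bounds the coefficient: this length does not depend on the initial
value. -/
theorem exists_linear_solution_of_le {M : ℝ → E →L[ℝ] E} (hM : Continuous M) {K : NNReal}
    (hK : ∀ t, ‖M t‖ ≤ K) {α β : ℝ} (hαβ : α ≤ β) (hle : 2 * (K + 1) * (β - α) ≤ 1) (x₀ : E) :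
    ∃ f : ℝ → E, f α = x₀ ∧ ∀ t ∈ Icc α β, HasDerivWithinAt f (M t (f t)) (Icc α β) t := by
  have h : IsPicardLindelof (fun t x => M t x) (tmin := α) (tmax := β) ⟨α, le_rfl, hαβ⟩ x₀
      (‖x₀‖₊ + 1) 0 (K * (2 * ‖x₀‖₊ + 1)) K :=
    { lipschitzOnWith := fun t _ =>
        (((M t).lipschitz.weaken (by exact_mod_cast hK t))).lipschitzOnWith
      continuousOn := fun x _ => (hM.clm_apply continuous_const).continuousOn
      norm_le := fun t _ x hx => by
        have h1 := (M t).le_opNorm x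
        have h2 : ‖x‖ ≤ 2 * ‖x₀‖ + 1 := by
          have := norm_le_norm_add_norm_sub' x x₀
          have h3 := mem_closedBall_iff_norm.1 hx
          push_cast at h3
          linarith
        push_cast
        exact h1.trans (mul_le_mul (hK t) h2 (norm_nonneg _) K.2)
      mul_max_le := by
        rw [sub_self, max_eq_left (sub_nonneg.2 hαβ)]
        push_cast
        have hK0 : (0 : ℝ) ≤ K := K.2
        have h0 := norm_nonneg x₀
        have h1 := sub_nonneg.2 hαβ
        have h2 : K * (β - α) ≤ 1 / 2 := by nlinarith
        nlinarith }
  exact h.exists_eq_forall_mem_Icc_hasDerivWithinAt₀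

/-- The solutions of a linear differential equation with continuous coefficient exist on every
interval. -/
theorem exists_linear_solution {M : ℝ → E →L[ℝ] E} {α β : ℝ} (hαβ : α ≤ β)
    (hM : ContinuousOn M (Icc α β)) (x₀ : E) :
    ∃ f : ℝ → E, f α = x₀ ∧ ∀ t ∈ Icc α β, HasDerivWithinAt f (M t (f t)) (Icc α β) t := by
  obtain ⟨C, hC⟩ := isCompact_Icc.exists_bound_of_continuousOn hM
  have hN : Continuous (IccExtend hαβ ((Icc α β).domRestrict M)) :=
    (continuousOn_iff_continuous_domRestrict.1 hM).Icc_extend'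
  have hK : ∀ t, ‖IccExtend hαβ ((Icc α β).domRestrict M) t‖ ≤ C.toNNReal := fun t =>
    (hC _ (projIcc α β hαβ t).2).trans (Real.le_coe_toNNReal C)
  have hNM : ∀ t ∈ Icc α β, IccExtend hαβ ((Icc α β).domRestrict M) t = M t := fun t ht =>
    IccExtend_of_mem hαβ _ ht
  generalize IccExtend hαβ ((Icc α β).domRestrict M) = N at hN hK hNM
  generalize C.toNNReal = K at hK
  have key : ∀ (n : ℕ) (δ : ℝ), α ≤ δ → 2 * (K + 1) * (δ - α) ≤ n → ∃ f : ℝ → E, f α = x₀ ∧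
      ∀ t ∈ Icc α δ, HasDerivWithinAt f (N t (f t)) (Icc α δ) t := by
    intro n
    induction n with
    | zero =>
      intro δ h1 h2
      refine exists_linear_solution_of_le hN hK h1 (h2.trans (by simp)) x₀
    | succ n ih =>
      intro δ h1 h2
      have hK1 : (0 : ℝ) < 2 * (K + 1) := by positivity
      set μ := max α (δ - 1 / (2 * (K + 1))) with hμ
      have hαμ : α ≤ μ := le_max_left _ _
      have hμδ : μ ≤ δ := max_le h1 (sub_le_self _ (by positivity))
      obtain ⟨f, hf0, hf⟩ := ih μ hαμ (by
        rcases max_cases α (δ - 1 / (2 * ((K : ℝ) + 1))) with h | h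
        · rw [hμ, h.1]; simp
        · rw [hμ, h.1]
          push_cast at h2
          have : 2 * ((K : ℝ) + 1) * (1 / (2 * (K + 1))) = 1 := by field_simp
          linarith)
      obtain ⟨g, hg0, hg⟩ := exists_linear_solution_of_le hN hK hμδ (by
        have h3 : δ - 1 / (2 * (K + 1)) ≤ μ := le_max_right _ _
        have : 2 * ((K : ℝ) + 1) * (1 / (2 * (K + 1))) = 1 := by field_simp
        nlinarith) (f μ)
      have hfe : EqOn (fun t => if t ≤ μ then f t else g t) f (Icc α μ) := fun t ht => if_pos ht.2
      have hge : EqOn (fun t => if t ≤ μ then f t else g t) g (Icc μ δ) := fun t ht => by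
        rcases ht.1.eq_or_lt with h | h
        · simp [← h, hg0]
        · exact if_neg (not_le.2 h)
      generalize (fun t => if t ≤ μ then f t else g t) = u at hfe hge
      refine ⟨u, (hfe ⟨le_rfl, hαμ⟩).trans hf0, fun t ht => ?_⟩
      rw [← Icc_union_Icc_eq_Icc hαμ hμδ]
      refine HasDerivWithinAt.union ?_ ?_
      · by_cases h : t ∈ Icc α μ
        · rw [hfe h]
          exact (hf t h).congr hfe (hfe h)
        · exact hasDerivWithinAt_iff_hasFDerivWithinAt.2
            (HasFDerivWithinAt.of_notMem_closure (by rwa [isClosed_Icc.closure_eq]))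
      · by_cases h : t ∈ Icc μ δ
        · rw [hge h]
          exact (hg t h).congr hge (hge h)
        · exact hasDerivWithinAt_iff_hasFDerivWithinAt.2
            (HasFDerivWithinAt.of_notMem_closure (by rwa [isClosed_Icc.closure_eq]))
  obtain ⟨n, hn⟩ := exists_nat_ge (2 * (K + 1) * (β - α))
  obtain ⟨f, hf0, hf⟩ := key n β hαβ hn
  exact ⟨f, hf0, fun t ht => hNM t ht ▸ hf t ht⟩

end LinearODE

/-! ### Existence of parallel frames -/

section

variable {ℓ : ℝ} {γ : ℝ → ℂ}

/-- There is a parallel frame along a `C¹` curve; on an interval with one point, derivatives are not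
determined and the equation holds trivially. -/
theorem exists_isFrameOn_Icc {x y : ℝ} (hxy : x ≤ y) (hγ : ContDiffOn ℝ 1 γ (Icc x y)) :
    ∃ A : ℝ → SU11, A x = 1 ∧ IsFrameOn ℓ γ A (Icc x y) := by
  rcases hxy.eq_or_lt with rfl | hlt
  · exact ⟨fun _ => 1, rfl, hγ,
      fun t _ => hasDerivWithinAt_iff_hasFDerivWithinAt.2
        (HasFDerivWithinAt.of_subsingleton (subsingleton_Icc_of_ge le_rfl)),
      fun t _ => hasDerivWithinAt_iff_hasFDerivWithinAt.2
        (HasFDerivWithinAt.of_subsingleton (subsingleton_Icc_of_ge le_rfl))⟩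
  · have hu := uniqueDiffOn_Icc hlt
    have hg := hγ.continuousOn_derivWithin hu le_rfl
    generalize hgd : derivWithin γ (Icc x y) = g at hg
    -- the linear equation for the entry `a` and the conjugate of the entry `b`
    let M : ℝ → ℂ × ℂ →L[ℝ] ℂ × ℂ := fun t =>
      ((-(1 / (2 * ℓ)) * g t : ℂ) • ContinuousLinearMap.snd ℝ ℂ ℂ).prod
        ((-(1 / (2 * ℓ)) * conj (g t) : ℂ) • ContinuousLinearMap.fst ℝ ℂ ℂ)
    have hM : ContinuousOn M (Icc x y) := by
      have h1 : ContinuousOn (fun t => (-(1 / (2 * ℓ)) * g t : ℂ) •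
          ContinuousLinearMap.snd ℝ ℂ ℂ) (Icc x y) :=
        (continuousOn_const.mul hg).smul continuousOn_const
      have h2 : ContinuousOn (fun t => (-(1 / (2 * ℓ)) * conj (g t) : ℂ) •
          ContinuousLinearMap.fst ℝ ℂ ℂ) (Icc x y) :=
        (continuousOn_const.mul (Complex.continuous_conj.comp_continuousOn hg)).smul
          continuousOn_const
      exact (ContinuousLinearMap.prodₗᵢ ℝ).continuous.comp_continuousOn (h1.prodMk h2)
    obtain ⟨f, hf0, hf⟩ := exists_linear_solution hxy hM (1, 0)
    have h1 : ∀ t ∈ Icc x y, HasDerivWithinAt (fun s => (f s).1)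
        (-(1 / (2 * ℓ)) * g t * (f t).2) (Icc x y) t := fun t ht =>
      (ContinuousLinearMap.fst ℝ ℂ ℂ).hasFDerivAt.comp_hasDerivWithinAt t (hf t ht)
    have h2 : ∀ t ∈ Icc x y, HasDerivWithinAt (fun s => (f s).2)
        (-(1 / (2 * ℓ)) * conj (g t) * (f t).1) (Icc x y) t := fun t ht =>
      (ContinuousLinearMap.snd ℝ ℂ ℂ).hasFDerivAt.comp_hasDerivWithinAt t (hf t ht)
    have h1' : ∀ t ∈ Icc x y, HasDerivWithinAt (fun s => conj (f s).1) _ (Icc x y) t :=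
      fun t ht => (h1 t ht).star
    have h2' : ∀ t ∈ Icc x y, HasDerivWithinAt (fun s => conj (f s).2) _ (Icc x y) t :=
      fun t ht => (h2 t ht).star
    -- the equation preserves the determinant
    have hd : ∀ t ∈ Icc x y, HasDerivWithinAt
        (fun s => (f s).1 * conj (f s).1 - (f s).2 * conj (f s).2) 0 (Icc x y) t := by
      intro t ht
      refine (((h1 t ht).mul (h1' t ht)).sub ((h2 t ht).mul (h2' t ht))).congr_deriv ?_
      simp only [Complex.star_def, map_mul, map_neg, map_div₀, map_one, map_ofNat,
        Complex.conj_ofReal, Complex.conj_conj]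
      ring
    have hconst : ∀ t ∈ Icc x y, (f t).1 * conj (f t).1 - (f t).2 * conj (f t).2 = 1 := by
      intro t ht
      have h := constant_of_derivWithin_zero (fun t ht => (hd t ht).differentiableWithinAt)
        (fun t ht => (hd t (Ico_subset_Icc_self ht)).derivWithin (hu t (Ico_subset_Icc_self ht))) t ht
      rw [h, hf0]
      simp
    have hnorm : ∀ t ∈ Icc x y, ‖(f t).1‖ ^ 2 - ‖conj (f t).2‖ ^ 2 = 1 := by
      intro t ht
      have h := hconst t ht
      rw [Complex.mul_conj, Complex.mul_conj, Complex.normSq_eq_norm_sq,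
        Complex.normSq_eq_norm_sq] at h
      rw [RCLike.norm_conj]
      exact_mod_cast h
    classical
    let A : ℝ → SU11 := fun t => if h : t ∈ Icc x y then SU11.mk _ _ (hnorm t h) else 1
    have hAa : ∀ t ∈ Icc x y, (A t).a = (f t).1 := fun t ht => by simp only [A, dif_pos ht]; rfl
    have hAb : ∀ t ∈ Icc x y, (A t).b = conj (f t).2 := fun t ht => by
      simp only [A, dif_pos ht]; rfl
    have hx : x ∈ Icc x y := left_mem_Icc.2 hxy
    refine ⟨A, SU11.ext ?_ ?_, hγ, fun t ht => ?_, fun t ht => ?_⟩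
    · rw [hAa x hx, hf0]; rfl
    · rw [hAb x hx, hf0]; simp
    · refine ((h1 t ht).congr hAa (hAa t ht)).congr_deriv ?_
      rw [hgd, hAb t ht, Complex.conj_conj]
    · refine ((h2' t ht).congr hAb (hAb t ht)).congr_deriv ?_
      rw [hgd, hAa t ht]
      simp only [Complex.star_def, map_mul, map_neg, map_div₀, map_one, map_ofNat,
        Complex.conj_ofReal, Complex.conj_conj]

/-- There is a parallel frame along every piecewise `C¹` curve. -/
theorem exists_isFrame (hγ : IsPiecewiseC1 𝓘(ℝ, ℂ) γ) : ∃ A, IsFrame ℓ γ A ∧ A 0 = 1 := by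
  obtain ⟨n, s, hs, h0, h1, hγ⟩ := hγ
  have hloc : ∀ i, ∃ A : ℝ → SU11, A (s i) = 1 ∧
      (i < n → IsFrameOn ℓ γ A (Icc (s i) (s (i + 1)))) := by
    intro i
    by_cases hi : i < n
    · obtain ⟨A, hA, hA'⟩ := exists_isFrameOn_Icc (ℓ := ℓ) (hs (Nat.le_succ i))
        (hγ i hi).contDiffOn
      exact ⟨A, hA, fun _ => hA'⟩
    · exact ⟨fun _ => 1, rfl, fun h => absurd h hi⟩
  choose C hC1 hC using hloc
  let P : ℕ → SU11 := fun i => Nat.rec 1 (fun i B => C i (s (i + 1)) * B) i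
  obtain ⟨A, hA⟩ := exists_glue hs (fun i t => C i t * P i)
    (fun i => by rw [hC1, one_mul]) n
  refine ⟨A, ⟨n, s, hs, h0, h1, fun i hi => ?_⟩, ?_⟩
  · exact ((hC i hi).mul_right (P i)).congr (fun _ _ => rfl) (hA i hi.le)
  · have := hA 0 (Nat.zero_le n) (left_mem_Icc.2 (hs (Nat.le_succ 0)))
    rw [← h0, this]
    exact (congrArg (· * P 0) (hC1 0)).trans (one_mul 1)

end

/-! ### Boosts and rotations -/

namespace SU11

/-- For `τ ≠ 0`, the hyperbolic element with fixed points `x` and `-x` on the circle that moves the center of the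
disc to `-x tanh τ`. -/
noncomputable def boost (x : Circle) (τ : ℝ) : SU11 :=
  mk (Real.cosh τ) (-(x * Real.sinh τ)) (by
    rw [norm_neg, norm_mul, Circle.norm_coe, one_mul, Complex.norm_real, Complex.norm_real,
      Real.norm_eq_abs, Real.norm_eq_abs, sq_abs, sq_abs, Real.cosh_sq_sub_sinh_sq])

theorem boost_a (x : Circle) (τ : ℝ) : (boost x τ).a = (Real.cosh τ : ℝ) := rfl

theorem boost_b (x : Circle) (τ : ℝ) : (boost x τ).b = -(x * (Real.sinh τ : ℝ)) := rfl

/-- The diagonal elements of `SU(1,1)`, which act on the circle by rotations. -/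
noncomputable def rot : Circle →* SU11 where
  toFun z := mk z 0 (by rw [Circle.norm_coe, norm_zero]; norm_num)
  map_one' := by apply SU11.ext <;> simp
  map_mul' y z := by apply SU11.ext <;> simp [mul_a, mul_b]

theorem rot_a (z : Circle) : (rot z).a = z := rfl

theorem rot_b (z : Circle) : (rot z).b = 0 := rfl

theorem boost_zero (x : Circle) : boost x 0 = 1 := by
  apply SU11.ext <;> simp [boost_a, boost_b]

theorem boost_mul_boost (x : Circle) (σ τ : ℝ) : boost x σ * boost x τ = boost x (σ + τ) := by
  have hx := circle_mul_conj x
  apply SU11.ext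
  · rw [mul_a]
    simp only [boost_a, boost_b, Real.cosh_add, map_neg, map_mul, Complex.conj_ofReal]
    push_cast
    linear_combination (Complex.sinh σ * Complex.sinh τ) * hx
  · rw [mul_b]
    simp only [boost_a, boost_b, Real.sinh_add, Complex.conj_ofReal]
    push_cast
    ring

theorem boost_inv (x : Circle) (τ : ℝ) : (boost x τ)⁻¹ = boost x (-τ) := by
  rw [inv_eq_iff_mul_eq_one, boost_mul_boost, add_neg_cancel, boost_zero]

theorem rot_mul_boost_mul_inv (z x : Circle) (τ : ℝ) :
    rot z * boost x τ * (rot z)⁻¹ = boost (z ^ 2 * x) τ := by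
  have hz := circle_mul_conj z
  apply SU11.ext
  · simp only [mul_a, mul_b, inv_a, inv_b, rot_a, rot_b, boost_a, boost_b]
    linear_combination (norm := (simp; ring)) ((Real.cosh τ : ℝ) : ℂ) * hz
  · simp only [mul_a, mul_b, inv_a, inv_b, rot_a, rot_b, boost_a, boost_b]
    push_cast
    simp
    ring

/-- The polar decomposition. If `b = 0`, then `τ = 0` and the direction `x` is irrelevant. -/
theorem exists_eq_boost_mul_rot (A : SU11) :
    ∃ (x : Circle) (τ : ℝ), A = boost x τ * rot (phase A.a A.a_ne_zero) := by
  have ha : ((‖A.a‖ : ℝ) : ℂ) ≠ 0 := by simpa using A.a_ne_zero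
  set z := phase A.a A.a_ne_zero with hz
  have hzz := circle_mul_conj z
  refine ⟨if hb : A.b = 0 then 1 else phase (-(A.b * z)) (by simpa using hb),
    Real.arsinh ‖A.b‖, ?_⟩
  apply SU11.ext
  · simp only [mul_a, boost_a, rot_a, rot_b, Real.cosh_arsinh, ← norm_a]
    rw [map_zero, mul_zero, add_zero]
    exact (mul_div_cancel₀ A.a ha).symm
  · simp only [mul_b, boost_a, boost_b, rot_a, rot_b, Real.sinh_arsinh]
    split_ifs with hb
    · simp [hb]
    · have hb' : ((‖A.b‖ : ℝ) : ℂ) ≠ 0 := by simpa using hb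
      rw [coe_phase, norm_neg, norm_mul, Circle.norm_coe, mul_one]
      field_simp
      linear_combination (-A.b) * hzz

end SU11

/-! ### Polygons -/

open SU11

/-- `Reach d A`: there is a polygon with total displacement `d`, in the unit `2ℓ`, whose parallel
frame is transported from `1` to `A`. -/
inductive Reach : ℂ → SU11 → Prop
  | one : Reach 0 1
  | step (x : Circle) (τ : ℝ) {d : ℂ} {A : SU11} (h : Reach d A) :
      Reach (τ * x + d) (boost x τ * A)

namespace Reach

theorem boost (x : Circle) (τ : ℝ) : Reach (τ * x) (boost x τ) := by
  simpa using step x τ one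

theorem mul {d d' : ℂ} {A A' : SU11} (h : Reach d A) (h' : Reach d' A') :
    Reach (d + d') (A * A') := by
  induction h with
  | one => simpa using h'
  | step x τ _ ih => rw [add_assoc, mul_assoc]; exact ih.step x τ

theorem inv {d : ℂ} {A : SU11} (h : Reach d A) : Reach (-d) A⁻¹ := by
  induction h with
  | one => simpa using one
  | step x τ _ ih =>
    have h := ih.mul (boost x (-τ))
    rw [mul_inv_rev, boost_inv]
    convert h using 1
    push_cast
    ring

theorem pow {d : ℂ} {A : SU11} (h : Reach d A) (n : ℕ) : Reach (n * d) (A ^ n) := by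
  induction n with
  | zero => simpa using one
  | succ n ih =>
    rw [pow_succ]
    convert ih.mul h using 1
    push_cast
    ring

/-- The product of two boosts along orthogonal axes, followed by the boost that makes it diagonal,
is a small rotation: the polygon is a triangle. -/
theorem exists_rot_small {φ : ℝ} (h0 : 0 ≤ φ) (h1 : φ < Real.pi / 4) :
    ∃ d, Reach d (rot (Circle.exp φ)) := by
  have hpi := Real.pi_pos
  have hcos : 0 < Real.cos φ := Real.cos_pos_of_mem_Ioo ⟨by linarith, by linarith⟩
  have hsin : 0 ≤ Real.sin φ := Real.sin_nonneg_of_nonneg_of_le_pi h0 (by linarith)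
  have hlt : Real.sin φ < Real.cos φ := by
    rw [← Real.cos_pi_div_two_sub]
    exact Real.cos_lt_cos_of_nonneg_of_le_pi h0 (by linarith) (by linarith)
  have hD : 0 < Real.cos φ - Real.sin φ := sub_pos.2 hlt
  -- with `sinh² τ = s`, the product of the boosts has the entry `a = 1 + s + i s`, with argument `φ`
  set s := Real.sin φ / (Real.cos φ - Real.sin φ) with hs
  have hs0 : 0 ≤ s := div_nonneg hsin hD.le
  have hs1 : 1 + s = Real.cos φ / (Real.cos φ - Real.sin φ) := by rw [hs]; field_simp; ring
  set τ := Real.arsinh √s with hτ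
  have hsinh : Real.sinh τ ^ 2 = s := by rw [hτ, Real.sinh_arsinh, Real.sq_sqrt hs0]
  have hcosh : Real.cosh τ ^ 2 = 1 + s := by rw [Real.cosh_sq, hsinh, add_comm]
  let x : Circle := ⟨Complex.I, by simp [Submonoid.unitSphere]⟩
  set C := SU11.boost x τ * SU11.boost 1 τ with hC
  have hCa : C.a = ((Real.cos φ - Real.sin φ)⁻¹ : ℝ) * Complex.exp (φ * Complex.I) := by
    have h1 : C.a = ((Real.cosh τ ^ 2 : ℝ) : ℂ) + ((Real.sinh τ ^ 2 : ℝ) : ℂ) * Complex.I := by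
      rw [hC, mul_a]
      simp only [boost_a, boost_b, map_neg, map_mul, Complex.conj_ofReal, Circle.coe_one, map_one]
      push_cast
      change _ + -(Complex.I * _) * _ = _
      ring
    rw [h1, hcosh, hsinh, hs1, hs, Complex.exp_mul_I]
    push_cast
    ring
  have hphase : phase C.a C.a_ne_zero = Circle.exp φ := by
    apply Circle.ext
    rw [coe_phase, hCa, norm_mul, Complex.norm_exp_ofReal_mul_I, Complex.norm_real,
      Real.norm_of_nonneg (inv_nonneg.2 hD.le), mul_one, Circle.coe_exp]
    have : (((Real.cos φ - Real.sin φ)⁻¹ : ℝ) : ℂ) ≠ 0 := by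
      exact_mod_cast (inv_pos.2 hD).ne'
    exact mul_div_cancel_left₀ _ this
  obtain ⟨y, σ, hy⟩ := exists_eq_boost_mul_rot C
  rw [hphase] at hy
  have h := (boost y σ).inv.mul ((boost x τ).mul (boost 1 τ))
  rw [← hC, inv_mul_eq_iff_eq_mul.2 hy] at h
  exact ⟨_, h⟩

theorem exists_rot (z : Circle) : ∃ d, Reach d (rot z) := by
  have h1 := Complex.neg_pi_lt_arg (z : ℂ)
  have h2 := Complex.arg_le_pi (z : ℂ)
  have hpi := Real.pi_pos
  obtain ⟨d, hd⟩ := exists_rot_small (φ := (Complex.arg z + 2 * Real.pi) / 16) (by linarith)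
    (by linarith)
  -- the sixteenth part of an argument in `(π, 3π]` is positive and less than `π / 4`
  have hz : Circle.exp ((Complex.arg z + 2 * Real.pi) / 16) ^ 16 = z := by
    rw [← Circle.exp_natCast_mul, Nat.cast_ofNat, mul_div_cancel₀ _ (by norm_num),
      Circle.periodic_exp, Circle.exp_arg]
  have h := hd.pow 16
  rw [← map_pow, hz] at h
  exact ⟨_, h⟩

/-- A boost is the product of two equal boosts. The right factor is transport along a side of a
polygon, and the left factor is obtained from transport along this side, traversed backwards, by
conjugation with the half turn, which inverts boosts. The displacements cancel. -/
theorem boost_loop (x : Circle) (τ : ℝ) : Reach 0 (SU11.boost x τ) := by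
  let z : Circle := ⟨Complex.I, by simp [Submonoid.unitSphere]⟩
  obtain ⟨d, hd⟩ := exists_rot z
  have h := ((hd.mul (boost x (-(τ / 2)))).mul hd.inv).mul (boost x (τ / 2))
  have hb : SU11.boost (z ^ 2 * x) (-(τ / 2)) = SU11.boost x (τ / 2) := by
    have hz : ((z ^ 2 * x : Circle) : ℂ) = -x := by
      push_cast
      change Complex.I ^ 2 * (x : ℂ) = -x
      rw [Complex.I_sq]; ring
    apply SU11.ext
    · rw [boost_a, boost_a, Real.cosh_neg]
    · rw [boost_b, boost_b, Real.sinh_neg, hz]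
      push_cast
      ring
  rw [rot_mul_boost_mul_inv, hb, boost_mul_boost, add_halves] at h
  convert h using 1
  push_cast
  ring

/-- Every element of `SU(1,1)` is the transport along a closed polygon. -/
theorem loop (A : SU11) : Reach 0 A := by
  have key : ∀ d (B : SU11), Reach d B → Reach 0 B := by
    intro d B h
    induction h with
    | one => exact one
    | step x τ _ ih => simpa using (boost_loop x τ).mul ih
  obtain ⟨x, τ, h⟩ := exists_eq_boost_mul_rot A
  obtain ⟨d, hd⟩ := exists_rot (phase A.a A.a_ne_zero)
  rw [h]
  exact key _ _ (hd.step x τ)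

end Reach

/-- The parallel frame along a segment. -/
theorem isFrameOn_segment {ℓ : ℝ} (hℓ : 0 < ℓ) (q : ℂ) (x : Circle) (v t₀ : ℝ) {α β : ℝ}
    (hαβ : α < β) : IsFrameOn ℓ (fun t => q + 2 * ℓ * (v * (t - t₀) : ℝ) * x)
      (fun t => boost x (v * (t - t₀))) (Icc α β) := by
  have hℓ' : (ℓ : ℂ) ≠ 0 := by exact_mod_cast hℓ.ne'
  have hx := circle_mul_conj x
  have hr : ∀ t, HasDerivAt (fun t : ℝ => v * (t - t₀)) v t := fun t => by
    simpa using ((hasDerivAt_id t).sub_const t₀).const_mul v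
  have hγ : ∀ t, HasDerivAt (fun t : ℝ => q + 2 * ℓ * (v * (t - t₀) : ℝ) * x) (2 * ℓ * v * x) t :=
    fun t => (((hr t).ofReal_comp.const_mul (2 * ℓ : ℂ)).mul_const (x : ℂ)).const_add q
  have hd : ∀ t ∈ Icc α β, derivWithin (fun t : ℝ => q + 2 * ℓ * (v * (t - t₀) : ℝ) * x)
      (Icc α β) t = 2 * ℓ * v * x := fun t ht =>
    (hγ t).hasDerivWithinAt.derivWithin (uniqueDiffOn_Icc hαβ t ht)
  refine ⟨?_, fun t ht => ?_, fun t ht => ?_⟩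
  · have : ContDiff ℝ 1 fun t : ℝ => q + 2 * ℓ * (v * (t - t₀) : ℝ) * x := by
      have h1 : ContDiff ℝ 1 fun t : ℝ => ((v * (t - t₀) : ℝ) : ℂ) :=
        Complex.ofRealCLM.contDiff.comp (contDiff_const.mul (contDiff_id.sub contDiff_const))
      exact contDiff_const.add ((contDiff_const.mul h1).mul contDiff_const)
    exact this.contDiffOn
  · rw [hd t ht]
    have h := ((hr t).cosh.ofReal_comp).hasDerivWithinAt (s := Icc α β)
    refine h.congr_deriv ?_
    rw [boost_b]
    simp only [map_neg, map_mul, Complex.conj_ofReal]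
    field_simp
    push_cast
    linear_combination (-(Complex.sinh (v * (t - t₀)) * v)) * hx
  · rw [hd t ht]
    have h := (((hr t).sinh.ofReal_comp.const_mul (x : ℂ)).neg).hasDerivWithinAt (s := Icc α β)
    refine h.congr_deriv ?_
    rw [boost_a]
    simp only [Complex.conj_ofReal]
    field_simp
    push_cast
    ring

/-- The polygons are realized by curves whose sides take time `h`. -/
theorem Reach.exists_frame {ℓ : ℝ} (hℓ : 0 < ℓ) {d : ℂ} {B : SU11} (hB : Reach d B) :
    ∃ n : ℕ, 0 < n ∧ ∀ h > 0, ∀ q : ℂ, ∃ (γ : ℝ → ℂ) (A : ℝ → SU11), γ 0 = q ∧ A 0 = 1 ∧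
      γ (n * h) = q + 2 * ℓ * d ∧ A (n * h) = B ∧
      ∀ i < n, IsFrameOn ℓ γ A (Icc (i * h) ((i + 1 : ℕ) * h)) := by
  induction hB with
  | one =>
    refine ⟨1, one_pos, fun h hh q => ⟨fun _ => q, fun _ => 1, rfl, rfl, by simp, rfl,
      fun i hi => ?_⟩⟩
    have hlt : (i : ℝ) * h < (i + 1 : ℕ) * h := by push_cast; linarith
    exact (isFrameOn_segment hℓ q 1 0 0 hlt).congr (fun t _ => by simp)
      fun t _ => by simp [boost_zero]
  | @step x τ d B _ ih =>
    obtain ⟨n, -, ih⟩ := ih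
    refine ⟨n + 1, n.succ_pos, fun h hh q => ?_⟩
    obtain ⟨γ, A, hγ0, hA0, hγ, hA, hf⟩ := ih h hh q
    have h0 : (0 : ℝ) ≤ n * h := by positivity
    have h1 : (n : ℝ) * h < (n + 1 : ℕ) * h := by push_cast; linarith
    have hseg := (isFrameOn_segment hℓ (q + 2 * ℓ * d) x (τ / h) (n * h) h1).mul_right B
    have hτ : τ / h * ((n + 1 : ℕ) * h - n * h) = τ := by push_cast; field_simp; ring
    refine ⟨fun t => if t ≤ n * h then γ t else
        q + 2 * ℓ * d + 2 * ℓ * (τ / h * (t - n * h) : ℝ) * x,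
      fun t => if t ≤ n * h then A t else SU11.boost x (τ / h * (t - n * h)) * B,
      ?_, ?_, ?_, ?_, fun i hi => ?_⟩
    · simpa [h0] using hγ0
    · simpa [h0] using hA0
    · dsimp only
      rw [if_neg (not_le.2 h1), hτ]
      ring
    · dsimp only
      rw [if_neg (not_le.2 h1), hτ]
    · rcases Nat.lt_succ_iff_lt_or_eq.1 hi with hi | rfl
      · have hle : ∀ t ∈ Icc (i * h) ((i + 1 : ℕ) * h), t ≤ n * h := fun t ht =>
          ht.2.trans (mul_le_mul_of_nonneg_right (by exact_mod_cast hi) hh.le)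
        exact (hf i hi).congr (fun t ht => if_pos (hle t ht)) fun t ht => if_pos (hle t ht)
      · refine hseg.congr (fun t ht => ?_) fun t ht => ?_
        · dsimp only
          split_ifs with hti
          · rw [le_antisymm hti ht.1, hγ]; simp
          · rfl
        · dsimp only
          split_ifs with hti
          · rw [le_antisymm hti ht.1, hA]; simp [boost_zero]
          · rfl

/-- Every element of `SU(1,1)` is the transport along a loop. -/
theorem exists_loop {ℓ : ℝ} (hℓ : 0 < ℓ) (q : ℂ) (B : SU11) :
    ∃ (γ : ℝ → ℂ) (A : ℝ → SU11), IsLoop q γ ∧ IsFrame ℓ γ A ∧ A 0 = 1 ∧ A 1 = B := by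
  obtain ⟨n, hn, hf⟩ := (Reach.loop B).exists_frame hℓ
  have hn' : (0 : ℝ) < n := by exact_mod_cast hn
  have h1 : (n : ℝ) * (n : ℝ)⁻¹ = 1 := mul_inv_cancel₀ hn'.ne'
  obtain ⟨γ, A, hγ0, hA0, hγ, hA, hf⟩ := hf (n : ℝ)⁻¹ (inv_pos.2 hn') q
  rw [h1] at hγ hA
  have hF : IsFrame ℓ γ A := ⟨n, fun i => i * (n : ℝ)⁻¹,
    fun i j hij => mul_le_mul_of_nonneg_right (by exact_mod_cast hij) (inv_nonneg.2 hn'.le),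
    by simp, h1, hf⟩
  exact ⟨γ, A, ⟨hF.isPiecewiseC1_curve, hγ0, by simpa using hγ⟩, hF, hA0, hA⟩

/-! ### Completeness and holonomy -/

theorem isComplete_bundleConnection (ℓ : ℝ) : (bundleConnection ℓ).IsComplete := by
  intro γ hγ e he
  obtain ⟨A, hA, hA0⟩ := exists_isFrame (ℓ := ℓ) hγ
  refine ⟨fun t => (γ t, A t • e.2), ?_, fun c' hc' t ht =>
    hA.eq_smul_of_isHorizontalLift hA0 hc' ht⟩
  have h := hA.isHorizontalLift_config e.2
  rwa [hA0, one_smul, ← he] at h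

theorem holonomy_bundleConnection {ℓ : ℝ} (hℓ : 0 < ℓ) (q : ℂ) :
    (bundleConnection ℓ).holonomy q = (mobiusGroup : Set (Equiv.Perm Circle)) := by
  ext f
  constructor
  · rintro ⟨γ, ⟨hγ, hγ0, hγ1⟩, hf⟩
    obtain ⟨A, hA, hA0⟩ := exists_isFrame (ℓ := ℓ) hγ
    have h : f = (toM0 (A 1) : Equiv.Perm Circle) := by
      ext1 u
      obtain ⟨c, hc, hc1⟩ := hf u
      have h1 := hA.eq_smul_of_isHorizontalLift hA0 hc (right_mem_Icc.2 zero_le_one)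
      rw [hc1] at h1
      exact congrArg Prod.snd h1
    rw [h]
    exact (toM0 (A 1)).2
  · intro hf
    obtain ⟨B, hB⟩ := toM0_surjective ⟨f, hf⟩
    obtain ⟨γ, A, hγ, hA, hA0, hA1⟩ := exists_loop hℓ q B
    refine ⟨γ, hγ, fun u => ⟨fun t => (γ t, A t • u), ?_, ?_⟩⟩
    · have h := hA.isHorizontalLift_config u
      rwa [hA0, one_smul, hγ.2.1] at h
    · have h : B • u = f u := by
        rw [← toM0_smul, hB]
        rfl
      change (γ 1, A 1 • u) = (q, f u)
      rw [hγ.2.2, hA1, h]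

section

variable {G : StructureGroup} {S : G → SU11}

theorem IsLocalInverse.holonomy_principalConnection (hS : IsLocalInverse G S) {ℓ : ℝ} (hℓ : 0 < ℓ)
    (p : Principal G) : (hS.principalConnection ℓ).holonomy p = univ := by
  refine eq_univ_of_forall fun g => ?_
  obtain ⟨A₀, hA₀⟩ := G.cover_surjective p.2
  obtain ⟨A₁, rfl⟩ := G.cover_surjective g
  obtain ⟨γ, A, hγ, hA, hA0, hA1⟩ := exists_loop hℓ p.1 (A₀ * A₁ * A₀⁻¹)
  refine ⟨γ, hγ, fun t => (γ t, G.cover (A t * A₀)),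
    ⟨(hA.mul_right A₀).isHorizontal_principal hS, fun _ _ => rfl, ?_⟩, ?_⟩
  · change (γ 0, G.cover (A 0 * A₀)) = p
    rw [hγ.2.1, hA0, one_mul, hA₀]
  · change (γ 1, G.cover (A 1 * A₀)) = _
    rw [hγ.2.2, hA1, inv_mul_cancel_right, map_mul, hA₀]

end

/-- A structure group has a local inverse of its covering homomorphism, in both cases. -/
theorem exists_isLocalInverse {G : StructureGroup}
    (hG : G = StructureGroup.mobius ∨ G = StructureGroup.specialUnitary) :
    ∃ S : G → SU11, IsLocalInverse G S := by
  rcases hG with rfl | rfl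
  · exact ⟨_, M0.isLocalInverse_principalLift⟩
  · exact ⟨_, isLocalInverse_id⟩

end Planimeter

open Planimeter in
theorem theorem3 (ℓ : ℝ) (hℓ : 0 < ℓ) (G : StructureGroup)
    (hG : G = StructureGroup.mobius ∨ G = StructureGroup.specialUnitary) :
    -- the bundle `E` is isomorphic to the associated bundle, the class of `((q, A), u)`
    -- corresponding to `(q, A u)`
    ∃ Ψ : AssociatedBundle G ≃ₜ Config, AssociatedBundle.IsBundleIso Ψ ∧
      (∀ (q : ℂ) (A : G) (u : Circle), Ψ (AssociatedBundle.mk (q, A) u) = (q, A • u)) ∧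
    ∃ (Φ : BundleConnection) (θ : PrincipalConnection G),
      -- the motion of the planimeter is parallel transport for `Φ`
      Φ.IsComplete ∧
      (∀ c : ℝ → Config, IsPlanimeterMotion ℓ c ↔ IsHorizontal 𝓘E Φ.horizontal c) ∧
      -- `Φ` is induced by the principal connection `θ`
      θ.Induces Ψ Φ ∧
      -- the connection and curvature forms in the standard frame
      (∀ q v : ℂ, θ.localForm q v =
        (1 / (2 * ℓ : ℂ)) • !![0, v; (starRingEnd ℂ) v, 0]) ∧
      (∀ q v w : ℂ, θ.localCurvature q v w =
        (-(1 / (ℓ : ℂ) ^ 2) * ((v.re * w.im - v.im * w.re : ℝ) : ℂ)) •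
          !![Complex.I / 2, 0; 0, -(Complex.I / 2)]) ∧
      -- the holonomy groups
      (∀ p : Principal G, θ.holonomy p = Set.univ) ∧
      (∀ q : ℂ, Φ.holonomy q = (mobiusGroup : Set (Equiv.Perm Circle))) := by
  obtain ⟨S, hS⟩ := exists_isLocalInverse hG
  exact ⟨hS.associatedHomeomorph, hS.isBundleIso_associatedHomeomorph,
    fun q A u => hS.associatedHomeomorph_mk (q, A) u, bundleConnection ℓ, hS.principalConnection ℓ,
    isComplete_bundleConnection ℓ, isPlanimeterMotion_iff hℓ, hS.induces_bundleConnection ℓ,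
    hS.localForm_principalConnection ℓ, hS.localCurvature_principalConnection ℓ,
    hS.holonomy_principalConnection hℓ, holonomy_bundleConnection hℓ⟩
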